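/- **Problem.** Let $\mathcal X\subset\mathbb R^p$ and $\mathcal Y^i\subset\mathbb R^q$ ($i=1,\dots,m$) be closed and convex with $\|y-y'\|\le D_y$ for $y,y'\in\mathcal Y^i$, and $\mathcal Y=\prod_i\mathcal Y^i$. Let $f$ be continuous and $\mu_f$-strongly convex on $\mathcal X$ ($\mu_f\ge0$), and let $g_i$ be continuous on $\mathcal X\times\mathcal Y^i$, convex in $x$ and $\mu_y$-strongly concave in $y^i$ ($\mu_y\ge 0$). Let $\nabla f,\nabla_xg_i$ be fixed selections of subgradients and $\nabla_yg_i$ of supergradients. For constants $L_f,L_g^{xx},L_g^{yx},L_g^{yy},H_f,H_g^x,H_g^y,M_g^x,M_g^y\ge0$ assume, for all $x,x'\in\mathcal X$, $y,y'\in\mathcal Y^i$ and all $i$: (a) $f(x)\le f(x')+\langle\nabla f(x'),x-x'\rangle+\frac{L_f}2\|x-x'\|^2+H_f\|x-x'\|$; (b) $g_i(x,y)-g_i(x',y)-\langle\nabla_xg_i(x',y),x-x'\rangle\le\frac{L_g^{xx}}2\|x-x'\|^2+H_g^x\|x-x'\|$; (c) $\|\nabla_yg_i(x,y)-\nabla_yg_i(x',y')\|\le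 L_g^{yx}\|x-x'\|+L_g^{yy}\|y-y'\|+H_g^y$; (d) $|g_i(x,y)-g_i(x',y')|\le M_g^x\|x-x'\|+M_g^y\|y-y'\|$, and $|\langle\nabla_xg_i(x',y),x-x'\rangle|\le M_g^x\|x-x'\|$ (the latter holds in particular if $\|\nabla_xg_i\|\le M_g^x$). Put $\phi(x,\lambda,y)=f(x)+\sum_i\lambda_ig_i(x,y^i)$, $\|v\|_\lambda^2=\sum_i\lambda_i\|v^i\|^2$, and $\ell_g(x;x',y)=\big(g_i(x',y^i)+\langle\nabla_xg_i(x',y^i),x-x'\rangle\big)_{i=1}^m$. **Oracles.** Let $\nabla F(x,\xi),G_i(x,y^i,\xi),\nabla_xG_i(x,y^i,\xi),\nabla_yG_i(x,y^i,\xi)$ be measurable and, at every $x\in\mathcal X$, $y^i\in\mathcal Y^i$, unbiased for $\nabla f,g_i,\nabla_xg_i,\nabla_yg_i$, with mean squared errors at most $\sigma_{f'}^2,\sigma_g^2,\sigma_{g'}^2,\sigma_{g'}^2$ respectively ($\sigma_{f'},\sigma_g,\sigma_{g'}\ge0$). Define $\ell_G(x,\xi;x',y)$ like $\ell_g$, with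 $G_i,\nabla_xG_i$ in place of $g_i,\nabla_xg_i$. **Algorithm.** Start from deterministic $x_0\in\mathcal X$, $y_0\in\mathcal Y$, $\lambda_0\in\mathbb R^m_+$, with $x_{-2}=x_{-1}=x_0$, $y_{-1}=y_0$. Let $\xi_k^j$ ($k\ge0$, $j=1,\dots,6$) be i.i.d. copies of $\xi$. For $k=0,1,\dots$ let $$u_k^i=\nabla_yG_i(x_k,y_k^i,\xi_k^1)+\theta_k[\nabla_yG_i(x_k,y_k^i,\xi_k^1)-\nabla_yG_i(x_{k-1},y_{k-1}^i,\xi_k^2)],$$ $$y_{k+1}^i=\arg\min_{z\in\mathcal Y^i}-\langle u_k^i,z\rangle+\tfrac{\sigma_k}2\|z-y_k^i\|^2,$$ $$v_k=\ell_G(x_k,\xi_k^3;x_{k-1},y_{k+1})+\theta_k[\ell_G(x_k,\xi_k^4;x_{k-1},y_k)-\ell_G(x_{k-1},\xi_k^5;x_{k-2},y_k)],$$ $$\lambda_{k+1}=\arg\min_{z\ge0}-\langle v_k,z\rangle+\tfrac{\gamma_k}2\|z-\lambda_k\|^2,$$ $$x_{k+1}=\arg\min_{z\in\mathcal X}\Big\langle\nabla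 F(x_k,\xi_k^6)+\sum_i\lambda_{k+1,i}\nabla_xG_i(x_k,y_{k+1}^i,\xi_k^6),z\Big\rangle+\tfrac{\tau_k}2\|z-x_k\|^2 .$$ Let $\bar u_k,\bar v_k$ be $u_k,v_k$ with the exact $g_i,\nabla_xg_i,\nabla_yg_i$ in place of the oracles, and define auxiliary sequences by $\tilde y_0=y_0$, $\tilde\lambda_0=\lambda_0$, $$\tilde y_{k+1}^i=\arg\min_{z\in\mathcal Y^i}\langle u_k^i-\bar u_k^i,z\rangle+\tfrac{\sigma_k}2\|z-\tilde y_k^i\|^2,\qquad \tilde\lambda_{k+1}=\arg\min_{z\ge0}\langle v_k-\bar v_k,z\rangle+\tfrac{\gamma_k}2\|z-\tilde\lambda_k\|^2 .$$ **Claim.** Let $K\ge1$, $t_k,\theta_k\ge0$, $\tau_k,\sigma_k,\gamma_k>0$ for all $k$, $\theta_k\le1$ for $k<K$, and suppose for $k=0,1,\dots,K$: $$\theta_{k+1}t_{k+1}=t_k,$$ $$\tfrac{t_kL_f}2+\tfrac{6mt_{k+1}\theta_{k+1}^2(M_g^x)^2}{\gamma_{k+1}}+\tfrac{24mt_{k+2}\theta_{k+2}^2(M_g^x)^2}{\gamma_{k+2}}+\tfrac{18m\sigma_{g'}^2t_{k+1}}{\gamma_{k+1}}+\tfrac{12m\sigma_{g'}^2t_{k+2}}{\gamma_{k+2}}-\tfrac{t_k\tau_k}{16}\le0,$$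 $$\tfrac{7t_{k+1}(\theta_{k+1}L_g^{yy})^2}{\sigma_{k+1}}-\tfrac{t_k\sigma_k}8\le0,\qquad t_{k+1}\tau_{k+1}-t_{k+1}\mu_f-t_k\tau_k\le0,$$ $$t_{k+1}\sigma_{k+1}-t_k\sigma_k-t_k\mu_y\le0,\qquad t_{k+1}\gamma_{k+1}-t_k\gamma_k+\tfrac{8m\sigma_{g'}^2t_k}{\tau_k}\le0 .$$ Then for every deterministic $x\in\mathcal X$, every random $y\in\mathcal Y$ and every random $\lambda\in\mathbb R_+^m$ with $\|\lambda\|_1\le\Lambda$ a.s. ($y,\lambda$ may depend on all the samples), all expectations below are finite and $$\mathbb E\sum_{k=0}^{K-1}t_k[\phi(x_{k+1},\lambda,y)-\phi(x,\lambda_{k+1},y_{k+1})]$$ $$\le\tfrac{t_0\tau_0-t_0\mu_f}2\|x-x_0\|^2+t_0\gamma_0\mathbb E\|\lambda-\lambda_0\|^2+t_0\sigma_0\mathbb E\|y-y_0\|_\lambda^2+\mathcal T_{\Lambda,K}$$ $$+\sum_{k=0}^{K-1}\tfrac{t_{k+1}\gamma_{k+1}-t_k\gamma_k}2\mathbb E\|\lambda-\tilde\lambda_{k+1}\|^2+\sum_{k=0}^{K-1}\tfrac{t_{k+1}\sigma_{k+1}-t_k\sigma_k}2\mathbb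 E\|y-\tilde y_{k+1}\|_\lambda^2$$ $$-\tfrac{t_K\gamma_K}2\mathbb E\|\lambda-\tilde\lambda_K\|^2-\tfrac{t_K\sigma_K}2\mathbb E\|y-\tilde y_K\|_\lambda^2$$ $$+4[(H_g^x)^2\Lambda^2+H_f^2]\sum_{k=0}^{K-1}\tfrac{t_k}{\tau_k}+7(H_g^y)^2\Lambda\sum_{k=0}^{K}\tfrac{t_k\theta_k^2}{\sigma_k}+\Lambda\sqrt{10m\sigma_{g'}^2D_y^2\sum_{k=0}^{K-1}t_k^2}$$ $$+(2\sigma_{f'}^2+4\sigma_{g'}^2\Lambda^2)\sum_{k=0}^{K-1}\tfrac{t_k}{\tau_k}+15m\Lambda\sigma_{g'}^2\sum_{k=0}^{K-1}\tfrac{t_k}{\sigma_k}+30m\sigma_g^2\sum_{k=0}^{K-1}\tfrac{t_k}{\gamma_k},$$ where $$\mathcal T_{\Lambda,K}=\sum_{k=0}^{K-1}\Big[\tfrac{7t_{k+1}(\theta_{k+1}L_g^{yx})^2\Lambda}{\sigma_{k+1}}+\tfrac{t_kL_g^{xx}\Lambda}2-\tfrac{t_k\tau_k}{16}\Big]\mathbb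 E\|x_{k+1}-x_k\|^2 .$$ -/

import Mathlib

open MeasureTheory ProbabilityTheory

noncomputable section

namespace SIP

/-- `ℝⁿ` with the Euclidean norm. -/
abbrev Vec (n : ℕ) := EuclideanSpace ℝ (Fin n)

/-- The nonnegative orthant `ℝ₊ᵐ`. -/
def orthant (m : ℕ) : Set (Vec m) := {l | ∀ i, 0 ≤ l i}

/-- The `ℓ₁` norm on `ℝᵐ`. -/
def norm1 {m : ℕ} (l : Vec m) : ℝ := ∑ i, |l i|

/-- The weighted square `‖v‖_l² = ∑ i, l i * ‖v i‖²` of a block vector `v = (v¹, …, vᵐ)`. -/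
def wsq {m q : ℕ} (l : Vec m) (v : Fin m → Vec q) : ℝ := ∑ i, l i * ‖v i‖ ^ 2

/-- `w'` is a minimizer over `z ∈ W` of `⟨a, z⟩ + (η / 2) ‖z - w‖²`. -/
def IsProxStep {n : ℕ} (W : Set (Vec n)) (a w : Vec n) (η : ℝ) (w' : Vec n) : Prop :=
  w' ∈ W ∧ IsMinOn (fun z => inner ℝ a z + η / 2 * ‖z - w‖ ^ 2) W w'

/-- The data of a semi-infinite program `min f x` over `x ∈ X` subject to `g i x yⁱ ≤ 0` for all
`yⁱ ∈ Y i`, with a selection of (sub)gradients of `f` and `g i` and the constants attached to it. -/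
structure Problem (p q m : ℕ) where
  X : Set (Vec p)
  Y : Fin m → Set (Vec q)
  f : Vec p → ℝ
  g : Fin m → Vec p → Vec q → ℝ
  /-- the selected (sub)gradient of `f` -/
  gradf : Vec p → Vec p
  /-- the selected (sub)gradient of `g i` in `x` -/
  gradx : Fin m → Vec p → Vec q → Vec p
  /-- the selected (super)gradient of `g i` in `yⁱ` -/
  grady : Fin m → Vec p → Vec q → Vec q
  /-- strong convexity modulus of `f` -/
  μf : ℝ
  /-- strong concavity modulus of `g i` in `yⁱ` -/
  μy : ℝ
  /-- diameter bound for `Y i` -/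
  Dy : ℝ
  Lf : ℝ
  Lxx : ℝ
  Lyx : ℝ
  Lyy : ℝ
  Hf : ℝ
  Hx : ℝ
  Hy : ℝ
  Mx : ℝ
  My : ℝ

namespace Problem

variable {p q m : ℕ} (S : Problem p q m)

/-- Convexity and compactness assumptions, and the fact that `gradf`, `gradx`, `grady` select
(sub/super)gradients. -/
structure IsConvex : Prop where
  X_convex : Convex ℝ S.X
  X_closed : IsClosed S.X
  Y_convex : ∀ i, Convex ℝ (S.Y i)
  Y_closed : ∀ i, IsClosed (S.Y i)
  Y_diam : ∀ i, ∀ y ∈ S.Y i, ∀ y' ∈ S.Y i, ‖y - y'‖ ≤ S.Dy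
  μf_nonneg : 0 ≤ S.μf
  μy_nonneg : 0 ≤ S.μy
  f_cont : ContinuousOn S.f S.X
  g_cont : ∀ i, ContinuousOn (fun z : Vec p × Vec q => S.g i z.1 z.2) (S.X ×ˢ S.Y i)
  f_convex : StrongConvexOn S.X S.μf S.f
  g_convex : ∀ i, ∀ y ∈ S.Y i, ConvexOn ℝ S.X (fun x => S.g i x y)
  g_concave : ∀ i, ∀ x ∈ S.X, StrongConcaveOn (S.Y i) S.μy (fun y => S.g i x y)
  gradf_sub : ∀ x' ∈ S.X, ∀ x ∈ S.X, S.f x' + inner ℝ (S.gradf x') (x - x') ≤ S.f x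
  gradx_sub : ∀ i, ∀ y ∈ S.Y i, ∀ x' ∈ S.X, ∀ x ∈ S.X,
    S.g i x' y + inner ℝ (S.gradx i x' y) (x - x') ≤ S.g i x y
  grady_super : ∀ i, ∀ x ∈ S.X, ∀ y' ∈ S.Y i, ∀ y ∈ S.Y i,
    S.g i x y ≤ S.g i x y' + inner ℝ (S.grady i x y') (y - y')

/-- Smoothness and Lipschitz continuity assumptions.  The last field says that the selected
subgradients in `x` respect the Lipschitz constant `Mx` along the feasible directions; it follows
from `‖gradx i x' y‖ ≤ Mx`, and from the other fields where `Hx = 0` or `x'` is interior. -/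
structure IsRegular : Prop where
  Lf_nonneg : 0 ≤ S.Lf
  Lxx_nonneg : 0 ≤ S.Lxx
  Lyx_nonneg : 0 ≤ S.Lyx
  Lyy_nonneg : 0 ≤ S.Lyy
  Hf_nonneg : 0 ≤ S.Hf
  Hx_nonneg : 0 ≤ S.Hx
  Hy_nonneg : 0 ≤ S.Hy
  Mx_nonneg : 0 ≤ S.Mx
  My_nonneg : 0 ≤ S.My
  f_upper : ∀ x ∈ S.X, ∀ x' ∈ S.X,
    S.f x ≤ S.f x' + inner ℝ (S.gradf x') (x - x') + S.Lf / 2 * ‖x - x'‖ ^ 2 + S.Hf * ‖x - x'‖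
  g_upper : ∀ i, ∀ x ∈ S.X, ∀ x' ∈ S.X, ∀ y ∈ S.Y i,
    S.g i x y - S.g i x' y - inner ℝ (S.gradx i x' y) (x - x')
      ≤ S.Lxx / 2 * ‖x - x'‖ ^ 2 + S.Hx * ‖x - x'‖
  grady_lip : ∀ i, ∀ x ∈ S.X, ∀ x' ∈ S.X, ∀ y ∈ S.Y i, ∀ y' ∈ S.Y i,
    ‖S.grady i x y - S.grady i x' y'‖ ≤ S.Lyx * ‖x - x'‖ + S.Lyy * ‖y - y'‖ + S.Hy
  g_lip : ∀ i, ∀ x ∈ S.X, ∀ x' ∈ S.X, ∀ y ∈ S.Y i, ∀ y' ∈ S.Y i,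
    |S.g i x y - S.g i x' y'| ≤ S.Mx * ‖x - x'‖ + S.My * ‖y - y'‖
  gradx_bound : ∀ i, ∀ x ∈ S.X, ∀ x' ∈ S.X, ∀ y ∈ S.Y i,
    |inner ℝ (S.gradx i x' y) (x - x')| ≤ S.Mx * ‖x - x'‖

/-- The Lagrangian `φ(x, l, y) = f(x) + lᵀ g(x, y)`. -/
def phi (x : Vec p) (l : Vec m) (y : Fin m → Vec q) : ℝ := S.f x + ∑ i, l i * S.g i x (y i)

/-- The linearization `ℓ_g(x; x', y) = g(x', y) + ∇ₓg(x', y) (x - x')`. -/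
def lin (x x' : Vec p) (y : Fin m → Vec q) : Vec m :=
  WithLp.toLp 2 fun i => S.g i x' (y i) + inner ℝ (S.gradx i x' (y i)) (x - x')

end Problem

/-- Stochastic oracles for `∇f`, `g i`, `∇ₓ g i` and `∇_y g i`, with the variance bounds. -/
structure Oracle (p q m : ℕ) (Ξ : Type*) where
  gradF : Vec p → Ξ → Vec p
  G : Fin m → Vec p → Vec q → Ξ → ℝ
  gradX : Fin m → Vec p → Vec q → Ξ → Vec p
  gradY : Fin m → Vec p → Vec q → Ξ → Vec q
  /-- `σ_{f'}` -/
  sf' : ℝ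
  /-- `σ_g` -/
  sg : ℝ
  /-- `σ_{g'}` -/
  sg' : ℝ

namespace Oracle

variable {p q m : ℕ} {Ξ : Type*} (O : Oracle p q m Ξ)

/-- The stochastic linearization
`ℓ_G(x, s; x', y) = G(x', y, s) + ∇ₓG(x', y, s) (x - x')`. -/
def lin (x : Vec p) (s : Ξ) (x' : Vec p) (y : Fin m → Vec q) : Vec m :=
  WithLp.toLp 2 fun i => O.G i x' (y i) s + inner ℝ (O.gradX i x' (y i) s) (x - x')

/-- Unbiasedness and bounded variance of the oracles when the sample has law `ν`. -/
structure IsOracleFor [MeasurableSpace Ξ] (ν : Measure Ξ) (S : Problem p q m) : Prop where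
  sf'_nonneg : 0 ≤ O.sf'
  sg_nonneg : 0 ≤ O.sg
  sg'_nonneg : 0 ≤ O.sg'
  gradF_meas : Measurable fun z : Vec p × Ξ => O.gradF z.1 z.2
  G_meas : ∀ i, Measurable fun z : Vec p × Vec q × Ξ => O.G i z.1 z.2.1 z.2.2
  gradX_meas : ∀ i, Measurable fun z : Vec p × Vec q × Ξ => O.gradX i z.1 z.2.1 z.2.2
  gradY_meas : ∀ i, Measurable fun z : Vec p × Vec q × Ξ => O.gradY i z.1 z.2.1 z.2.2
  gradF_mean : ∀ x ∈ S.X,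
    Integrable (fun s => O.gradF x s) ν ∧ ∫ s, O.gradF x s ∂ν = S.gradf x
  G_mean : ∀ i, ∀ x ∈ S.X, ∀ y ∈ S.Y i,
    Integrable (fun s => O.G i x y s) ν ∧ ∫ s, O.G i x y s ∂ν = S.g i x y
  gradX_mean : ∀ i, ∀ x ∈ S.X, ∀ y ∈ S.Y i,
    Integrable (fun s => O.gradX i x y s) ν ∧ ∫ s, O.gradX i x y s ∂ν = S.gradx i x y
  gradY_mean : ∀ i, ∀ x ∈ S.X, ∀ y ∈ S.Y i,
    Integrable (fun s => O.gradY i x y s) ν ∧ ∫ s, O.gradY i x y s ∂ν = S.grady i x y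
  gradF_var : ∀ x ∈ S.X,
    Integrable (fun s => ‖O.gradF x s - S.gradf x‖ ^ 2) ν ∧
      ∫ s, ‖O.gradF x s - S.gradf x‖ ^ 2 ∂ν ≤ O.sf' ^ 2
  G_var : ∀ i, ∀ x ∈ S.X, ∀ y ∈ S.Y i,
    Integrable (fun s => ‖O.G i x y s - S.g i x y‖ ^ 2) ν ∧
      ∫ s, ‖O.G i x y s - S.g i x y‖ ^ 2 ∂ν ≤ O.sg ^ 2
  gradX_var : ∀ i, ∀ x ∈ S.X, ∀ y ∈ S.Y i,
    Integrable (fun s => ‖O.gradX i x y s - S.gradx i x y‖ ^ 2) ν ∧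
      ∫ s, ‖O.gradX i x y s - S.gradx i x y‖ ^ 2 ∂ν ≤ O.sg' ^ 2
  gradY_var : ∀ i, ∀ x ∈ S.X, ∀ y ∈ S.Y i,
    Integrable (fun s => ‖O.gradY i x y s - S.grady i x y‖ ^ 2) ν ∧
      ∫ s, ‖O.gradY i x y s - S.grady i x y‖ ^ 2 ∂ν ≤ O.sg' ^ 2

end Oracle

/-- The parameters `t_k, θ_k, τ_k, σ_k, γ_k` of the algorithm. -/
structure Params where
  t : ℕ → ℝ
  θ : ℕ → ℝ
  τ : ℕ → ℝ
  σ : ℕ → ℝ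
  γ : ℕ → ℝ

namespace Params

/-- Sign conditions on the parameters; `θ_k ∈ [0, 1]` in the `K` iterations that are run. -/
structure IsAdmissible (a : Params) (K : ℕ) : Prop where
  t_nonneg : ∀ k, 0 ≤ a.t k
  θ_nonneg : ∀ k, 0 ≤ a.θ k
  θ_le_one : ∀ k < K, a.θ k ≤ 1
  τ_pos : ∀ k, 0 < a.τ k
  σ_pos : ∀ k, 0 < a.σ k
  γ_pos : ∀ k, 0 < a.γ k

/-- The coupling conditions on the parameters, for `k = 0, 1, …, K`. -/
structure IsCoupled {p q m : ℕ} {Ξ : Type*} (a : Params) (S : Problem p q m)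
    (O : Oracle p q m Ξ) (K : ℕ) : Prop where
  theta_t : ∀ k ≤ K, a.θ (k + 1) * a.t (k + 1) = a.t k
  cond_x : ∀ k ≤ K,
    a.t k * S.Lf / 2
      + 6 * m * a.t (k + 1) * a.θ (k + 1) ^ 2 * S.Mx ^ 2 / a.γ (k + 1)
      + 24 * m * a.t (k + 2) * a.θ (k + 2) ^ 2 * S.Mx ^ 2 / a.γ (k + 2)
      + 18 * m * O.sg' ^ 2 * a.t (k + 1) / a.γ (k + 1)
      + 12 * m * O.sg' ^ 2 * a.t (k + 2) / a.γ (k + 2)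
      - a.t k * a.τ k / 16 ≤ 0
  cond_y : ∀ k ≤ K,
    7 * a.t (k + 1) * (a.θ (k + 1) * S.Lyy) ^ 2 / a.σ (k + 1) - a.t k * a.σ k / 8 ≤ 0
  cond_τ : ∀ k ≤ K, a.t (k + 1) * a.τ (k + 1) - a.t (k + 1) * S.μf - a.t k * a.τ k ≤ 0
  cond_σ : ∀ k ≤ K, a.t (k + 1) * a.σ (k + 1) - a.t k * a.σ k - a.t k * S.μy ≤ 0
  cond_γ : ∀ k ≤ K,
    a.t (k + 1) * a.γ (k + 1) - a.t k * a.γ k + 8 * m * O.sg' ^ 2 * a.t k / a.τ k ≤ 0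

end Params

/-- The processes attached to the algorithm: the samples `ξ k j` (`j = 0, …, 5` stands for the
`(j+1)`-st sample of iteration `k`), the iterates `x, y, lam`, and the auxiliary sequences
`ỹ, λ̃` (`yt, lamt`). -/
structure Processes (p q m : ℕ) (Ω Ξ : Type*) where
  ξ : ℕ → Fin 6 → Ω → Ξ
  x : ℕ → Ω → Vec p
  y : ℕ → Ω → Fin m → Vec q
  lam : ℕ → Ω → Vec m
  yt : ℕ → Ω → Fin m → Vec q
  lamt : ℕ → Ω → Vec m

namespace Processes

variable {p q m : ℕ} {Ω Ξ : Type*} (Z : Processes p q m Ω Ξ)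
  (S : Problem p q m) (O : Oracle p q m Ξ) (a : Params)

/- Iterates with a negative index equal the iterate of index `0`; this is exactly what truncated
subtraction on `ℕ` does in `x (k - 1)`, `x (k - 2)` and `y (k - 1)` below. -/

/-- The direction `u_kⁱ` of the `y`-step. -/
def u (k : ℕ) (ω : Ω) (i : Fin m) : Vec q :=
  O.gradY i (Z.x k ω) (Z.y k ω i) (Z.ξ k 0 ω)
    + a.θ k • (O.gradY i (Z.x k ω) (Z.y k ω i) (Z.ξ k 0 ω)
        - O.gradY i (Z.x (k - 1) ω) (Z.y (k - 1) ω i) (Z.ξ k 1 ω))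

/-- The direction `v_k` of the multiplier step. -/
def v (k : ℕ) (ω : Ω) : Vec m :=
  O.lin (Z.x k ω) (Z.ξ k 2 ω) (Z.x (k - 1) ω) (Z.y (k + 1) ω)
    + a.θ k • (O.lin (Z.x k ω) (Z.ξ k 3 ω) (Z.x (k - 1) ω) (Z.y k ω)
        - O.lin (Z.x (k - 1) ω) (Z.ξ k 4 ω) (Z.x (k - 2) ω) (Z.y k ω))

/-- The direction `∇F(x_k, ξ_k⁶) + ∇ₓG(x_k, y_{k+1}, ξ_k⁶)ᵀ λ_{k+1}` of the `x`-step. -/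
def d (k : ℕ) (ω : Ω) : Vec p :=
  O.gradF (Z.x k ω) (Z.ξ k 5 ω)
    + ∑ i, Z.lam (k + 1) ω i • O.gradX i (Z.x k ω) (Z.y (k + 1) ω i) (Z.ξ k 5 ω)

/-- The exact counterpart of `u`. -/
def ubar (k : ℕ) (ω : Ω) (i : Fin m) : Vec q :=
  S.grady i (Z.x k ω) (Z.y k ω i)
    + a.θ k • (S.grady i (Z.x k ω) (Z.y k ω i)
        - S.grady i (Z.x (k - 1) ω) (Z.y (k - 1) ω i))

/-- The exact counterpart of `v`. -/
def vbar (k : ℕ) (ω : Ω) : Vec m :=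
  S.lin (Z.x k ω) (Z.x (k - 1) ω) (Z.y (k + 1) ω)
    + a.θ k • (S.lin (Z.x k ω) (Z.x (k - 1) ω) (Z.y k ω)
        - S.lin (Z.x (k - 1) ω) (Z.x (k - 2) ω) (Z.y k ω))

/-- The samples are independent (over all iterations and all six slots) with common law `ν`. -/
structure IsSampled [MeasurableSpace Ω] [MeasurableSpace Ξ] (P : Measure Ω) (ν : Measure Ξ) :
    Prop where
  meas : ∀ k j, Measurable (Z.ξ k j)
  law : ∀ k j, P.map (Z.ξ k j) = ν
  indep : iIndepFun (fun kj : ℕ × Fin 6 => Z.ξ kj.1 kj.2) P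

/-- `x, y, lam` are the iterates of the stochastic gradient method started at the deterministic
point `(x0, y0, l0)`. -/
structure IsRun (x0 : Vec p) (y0 : Fin m → Vec q) (l0 : Vec m) : Prop where
  x_zero : ∀ ω, Z.x 0 ω = x0
  y_zero : ∀ ω, Z.y 0 ω = y0
  lam_zero : ∀ ω, Z.lam 0 ω = l0
  y_step : ∀ k ω i,
    IsProxStep (S.Y i) (-Z.u O a k ω i) (Z.y k ω i) (a.σ k) (Z.y (k + 1) ω i)
  lam_step : ∀ k ω,
    IsProxStep (orthant m) (-Z.v O a k ω) (Z.lam k ω) (a.γ k) (Z.lam (k + 1) ω)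
  x_step : ∀ k ω, IsProxStep S.X (Z.d O k ω) (Z.x k ω) (a.τ k) (Z.x (k + 1) ω)

/-- `yt, lamt` are the auxiliary sequences driven by the oracle errors. -/
structure IsAux (y0 : Fin m → Vec q) (l0 : Vec m) : Prop where
  yt_zero : ∀ ω, Z.yt 0 ω = y0
  lamt_zero : ∀ ω, Z.lamt 0 ω = l0
  yt_step : ∀ k ω i,
    IsProxStep (S.Y i) (Z.u O a k ω i - Z.ubar S a k ω i) (Z.yt k ω i) (a.σ k)
      (Z.yt (k + 1) ω i)
  lamt_step : ∀ k ω,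
    IsProxStep (orthant m) (Z.v O a k ω - Z.vbar S a k ω) (Z.lamt k ω) (a.γ k)
      (Z.lamt (k + 1) ω)

/-- The weighted primal-dual gap
`∑_{k<K} t_k [φ(x_{k+1}, l, y) - φ(x, λ_{k+1}, y_{k+1})]` at the outcome `ω`. -/
def gap (K : ℕ) (x : Vec p) (l : Vec m) (y : Fin m → Vec q) (ω : Ω) : ℝ :=
  ∑ k ∈ Finset.range K, a.t k *
    (S.phi (Z.x (k + 1) ω) l y - S.phi x (Z.lam (k + 1) ω) (Z.y (k + 1) ω))

/-- The residual `𝒯_{Λ,K}`. -/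
def residual [MeasurableSpace Ω] (P : Measure Ω) (Λ : ℝ) (K : ℕ) : ℝ :=
  ∑ k ∈ Finset.range K,
    (7 * a.t (k + 1) * (a.θ (k + 1) * S.Lyx) ^ 2 * Λ / a.σ (k + 1)
      + a.t k * S.Lxx * Λ / 2 - a.t k * a.τ k / 16)
    * ∫ ω, ‖Z.x (k + 1) ω - Z.x k ω‖ ^ 2 ∂P

end Processes

end SIP

end

/-! The bound is pathwise first, probabilistic second.

Pathwise, strong convexity of `f`, concavity in `y` and the smoothness bounds reduce one term of the
gap to three linear pairings, one per block, plus powers of the `x`-increment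
(`Problem.phi_sub_phi_le`). A proximal step controls its own pairing up to a telescoping distance.
The `y`- and `λ`-steps, however, use extrapolated directions built from old data, while the pairing
involves new data. With `r` the successive differences of the data, the new datum is `ub k + r (k +
1) - θ k • r k`. Since `θ (k + 1) * t (k + 1) = t k`, the weighted sum telescopes, leaving one
boundary term and products of `r k` with an increment of the iterate (`sum_inner_extrapolation`,
`sum_inner_block`). Young's inequality and the quadratic terms of the proximal steps absorb these.

The comparison points `y` and `l` may depend on every sample, so their pairing with the oracle
errors has no reason to be centered. The auxiliary sequences repair this: they run the same proximal
step along the error alone, so by a regret bound valid for every comparison point, `z` may be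
exchanged for the adapted point `wt` (`IsProxStep.noisy_aux`). The price is a second telescoping
distance, whence the doubled initial distances, and half a squared error. The point `x` is
deterministic and needs no such device.

In expectation, the errors of `v` and `d` are orthogonal to the past. The `y`-errors are still
multiplied by the random weights `l i`; there the martingale sums are bounded in `L²` by
orthogonality of increments and the weights by `Λ` (`expectationLE_weighted_sum`). The variances of
`v` and `d` depend on the run, through `x`-increments and `λ_{k+1}`. The last two sums subtracted in
`gap_le`, supplied by `cond_x` and `cond_γ`, are reserves that cancel precisely these parts.

All this requires adapted, square-integrable iterates. Measurability comes from nonexpansiveness of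
proximal steps (`measurable_of_isProxStep`); moments come from an induction (`memLp_state`) whose
delicate step is the length of the `x`-step (`Problem.sq_norm_step_le`). -/

noncomputable section

namespace SIP

variable {p q m : ℕ}

/-! ### Proximal steps -/

section Prox

variable {n : ℕ} {W : Set (Vec n)} {a w w' z : Vec n} {η : ℝ}

/-- Let `s` tend to `0`. This turns an inequality along a segment into a first-order one, `b` being
the coefficient of the quadratic remainder. -/
theorem nonneg_of_forall_add_mul {c b : ℝ} (h : ∀ s : ℝ, 0 < s → s ≤ 1 → 0 ≤ c + b * s) :
    0 ≤ c := by
  by_contra! hc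
  have hb : 0 < |b| + 1 := by positivity
  set s := min 1 (-c / (2 * (|b| + 1))) with hs
  have hs0 : 0 < s := lt_min one_pos (by apply div_pos <;> linarith)
  have h1 := h s hs0 (min_le_left _ _)
  have h2 : s ≤ -c / (2 * (|b| + 1)) := min_le_right _ _
  rw [le_div_iff₀ (by positivity)] at h2
  nlinarith [le_abs_self b]

/-- The variational inequality characterizing a proximal step. -/
theorem IsProxStep.variational (h : IsProxStep W a w η w') (hW : Convex ℝ W) (hz : z ∈ W) :
    0 ≤ inner ℝ (a + η • (w' - w)) (z - w') := by
  apply nonneg_of_forall_add_mul (b := η / 2 * ‖z - w'‖ ^ 2)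
  intro s hs hs1
  have hmem : w' + s • (z - w') ∈ W := hW.add_smul_sub_mem h.1 hz ⟨hs.le, hs1⟩
  have key := h.2 hmem
  simp only [Set.mem_ofPred_eq] at key
  have e : w' + s • (z - w') - w = (w' - w) + s • (z - w') := by abel
  rw [e, norm_add_sq_real, inner_add_right, inner_smul_right, inner_smul_right, norm_smul,
    mul_pow, Real.norm_eq_abs, sq_abs] at key
  rw [inner_add_left, inner_smul_left]
  simp only [conj_trivial]
  have : 0 ≤ s * (inner ℝ a (z - w') + η * inner ℝ (w' - w) (z - w')
      + η / 2 * ‖z - w'‖ ^ 2 * s) := by nlinarith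
  exact nonneg_of_mul_nonneg_right this hs

theorem IsProxStep.three_point (h : IsProxStep W a w η w') (hW : Convex ℝ W) (hz : z ∈ W) :
    inner ℝ a (w' - z) ≤ η / 2 * (‖z - w‖ ^ 2 - ‖z - w'‖ ^ 2) - η / 2 * ‖w' - w‖ ^ 2 := by
  have h1 := h.variational hW hz
  rw [inner_add_left, inner_smul_left] at h1
  simp only [conj_trivial] at h1
  have e : z - w = (w' - w) + (z - w') := by abel
  have e2 : inner ℝ a (w' - z) = - inner ℝ a (z - w') := by rw [← inner_neg_right, neg_sub]
  rw [e, norm_add_sq_real, e2]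
  nlinarith

theorem inner_le_young {E : Type*} [NormedAddCommGroup E] [InnerProductSpace ℝ E] (u v : E)
    {c : ℝ} (hc : 0 < c) : inner ℝ u v ≤ ‖u‖ ^ 2 / (4 * c) + c * ‖v‖ ^ 2 := by
  have h1 := real_inner_le_norm u v
  have h2 : ‖u‖ ^ 2 / (4 * c) + c * ‖v‖ ^ 2 - ‖u‖ * ‖v‖ = (‖u‖ - 2 * c * ‖v‖) ^ 2 / (4 * c) := by
    field_simp; ring
  have h3 : 0 ≤ (‖u‖ - 2 * c * ‖v‖) ^ 2 / (4 * c) := by positivity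
  linarith

/-- A proximal step along `d` compared with its exact direction `db`. -/
theorem IsProxStep.noisy {d db : Vec n} (h : IsProxStep W d w η w') (hW : Convex ℝ W)
    (hz : z ∈ W) (hη : 0 < η) :
    inner ℝ db (w' - z) ≤ η / 2 * (‖z - w‖ ^ 2 - ‖z - w'‖ ^ 2) - η / 4 * ‖w' - w‖ ^ 2
      - inner ℝ (d - db) (w - z) + ‖d - db‖ ^ 2 / η := by
  have h1 := h.three_point hW hz
  -- The choice `η / 4` spends half of the quadratic term of the three-point inequality on the
  -- noise; the other half is kept for the extrapolation and smoothness errors.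
  have h2 := inner_le_young (-(d - db)) (w' - w) (c := η / 4) (by linarith)
  rw [norm_neg, inner_neg_left, show 4 * (η / 4) = η by ring] at h2
  have h3 : inner ℝ db (w' - z) = inner ℝ d (w' - z) - inner ℝ (d - db) (w' - w)
      - inner ℝ (d - db) (w - z) := by
    have e : w' - z = (w' - w) + (w - z) := by abel
    rw [e, inner_add_right, inner_add_right, inner_sub_left, inner_sub_left]; ring
  linarith

/-- The pairing is evaluated at the old point `w`, which does not depend on the current direction.
Passing from `w'` to `w` uses up the whole quadratic term. -/
theorem IsProxStep.aux (h : IsProxStep W a w η w') (hW : Convex ℝ W) (hz : z ∈ W) (hη : 0 < η) :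
    inner ℝ a (w - z) ≤ η / 2 * (‖z - w‖ ^ 2 - ‖z - w'‖ ^ 2) + ‖a‖ ^ 2 / (2 * η) := by
  have h1 := h.three_point hW hz
  have h2 := inner_le_young (-a) (w' - w) (c := η / 2) (by linarith)
  rw [norm_neg, inner_neg_left, show 4 * (η / 2) = 2 * η by ring] at h2
  have e : w - z = (w' - z) - (w' - w) := by abel
  rw [e, inner_sub_right]
  linarith

/-- An ascent step along `u` and an auxiliary step along the error `u - ub`. -/
theorem IsProxStep.noisy_aux {u ub wt wt' : Vec n} (h : IsProxStep W (-u) w η w')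
    (ht : IsProxStep W (u - ub) wt η wt') (hW : Convex ℝ W) (hz : z ∈ W) (hη : 0 < η) :
    inner ℝ ub (z - w') ≤ η / 2 * (‖z - w‖ ^ 2 - ‖z - w'‖ ^ 2) - η / 4 * ‖w' - w‖ ^ 2
      + η / 2 * (‖z - wt‖ ^ 2 - ‖z - wt'‖ ^ 2)
      + inner ℝ (u - ub) (w - wt) + 3 / 2 * (‖u - ub‖ ^ 2 / η) := by
  have h1 := h.noisy (db := -ub) hW hz hη
  have h2 := ht.aux hW hz hη
  have e : -u - -ub = -(u - ub) := by abel
  rw [e, norm_neg, inner_neg_left, inner_neg_left, ← inner_neg_right, neg_sub] at h1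
  -- The part along `w - wt` is centered in expectation; the part along `wt - z` is bounded by the
  -- auxiliary step for every `z`. The factor `3 / 2` is `1` from the main step plus `1 / 2` from
  -- the auxiliary one.
  have e2 : inner ℝ (u - ub) (w - z) = inner ℝ (u - ub) (w - wt) + inner ℝ (u - ub) (wt - z) := by
    rw [← inner_add_right]; congr 1; abel
  have e3 : ‖u - ub‖ ^ 2 / (2 * η) = 1 / 2 * (‖u - ub‖ ^ 2 / η) := by field_simp
  linarith

theorem IsProxStep.norm_sub_le (h : IsProxStep W a w η w') (hW : Convex ℝ W) (hw : w ∈ W)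
    (hη : 0 < η) : ‖w' - w‖ ≤ ‖a‖ / η := by
  have h1 := h.variational hW hw
  rw [inner_add_left, inner_smul_left] at h1
  simp only [conj_trivial] at h1
  have e : w - w' = -(w' - w) := by abel
  rw [e, inner_neg_right, inner_neg_right, real_inner_self_eq_norm_sq] at h1
  have h2 : -inner ℝ a (w' - w) ≤ ‖a‖ * ‖w' - w‖ := by
    rw [← inner_neg_left]; simpa using real_inner_le_norm (-a) (w' - w)
  rw [le_div_iff₀ hη]
  by_contra! hc
  have h3 : 0 < ‖w' - w‖ := by
    by_contra! h0
    have := norm_nonneg a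
    have : ‖w' - w‖ = 0 := le_antisymm h0 (norm_nonneg _)
    rw [this] at hc; linarith
  nlinarith

/-- Proximal steps are nonexpansive. -/
theorem IsProxStep.nonexpansive {a₂ w₂ w₂' : Vec n} (h : IsProxStep W a w η w')
    (h₂ : IsProxStep W a₂ w₂ η w₂') (hW : Convex ℝ W) (hη : 0 < η) :
    ‖w' - w₂'‖ ≤ ‖(w - η⁻¹ • a) - (w₂ - η⁻¹ • a₂)‖ := by
  have h1 := h.variational hW h₂.1
  have h2 := h₂.variational hW h.1
  set c := w - η⁻¹ • a with hc
  set c₂ := w₂ - η⁻¹ • a₂ with hc₂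
  have e1 : a + η • (w' - w) = η • (w' - c) := by
    rw [hc, smul_sub, smul_sub, smul_sub, smul_inv_smul₀ hη.ne']; abel
  have e2 : a₂ + η • (w₂' - w₂) = η • (w₂' - c₂) := by
    rw [hc₂, smul_sub, smul_sub, smul_sub, smul_inv_smul₀ hη.ne']; abel
  rw [e1, inner_smul_left] at h1
  rw [e2, inner_smul_left] at h2
  simp only [conj_trivial] at h1 h2
  have h1' := nonneg_of_mul_nonneg_right h1 hη
  have h2' := nonneg_of_mul_nonneg_right h2 hη
  have e3 : w₂' - w' = -(w' - w₂') := by abel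
  rw [e3, inner_neg_right] at h1'
  have h4 : inner ℝ (w' - w₂') (w' - w₂') ≤ inner ℝ (c - c₂) (w' - w₂') := by
    have : inner ℝ (c - c₂) (w' - w₂') - inner ℝ (w' - w₂') (w' - w₂')
        = inner ℝ (w₂' - c₂) (w' - w₂') - inner ℝ (w' - c) (w' - w₂') := by
      rw [← inner_sub_left, ← inner_sub_left]; congr 1; abel
    linarith
  rw [real_inner_self_eq_norm_sq] at h4
  have h5 := real_inner_le_norm (c - c₂) (w' - w₂')
  by_contra! hlt
  have := norm_nonneg (c - c₂)
  nlinarith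

end Prox

/-! ### Strong convexity -/

section StrongConvexity

variable {E : Type*} [NormedAddCommGroup E] [InnerProductSpace ℝ E] {X : Set E} {f : E → ℝ}
  {μ : ℝ} {x x' v : E}

/-- Apply the subgradient inequality at a point of the segment, bound the value there by strong
convexity, divide by `s` and let `s` tend to `0`. Hence every selected subgradient gains the
quadratic term. -/
theorem le_of_strongConvexOn (hf : StrongConvexOn X μ f) (hx : x ∈ X) (hx' : x' ∈ X)
    (hv : ∀ z ∈ X, f x' + inner ℝ v (z - x') ≤ f z) :
    f x' + inner ℝ v (x - x') + μ / 2 * ‖x - x'‖ ^ 2 ≤ f x := by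
  suffices 0 ≤ f x - f x' - inner ℝ v (x - x') - μ / 2 * ‖x - x'‖ ^ 2 by linarith
  apply nonneg_of_forall_add_mul (b := μ / 2 * ‖x - x'‖ ^ 2)
  intro s hs hs1
  have h1 := hf.2 hx hx' hs.le (sub_nonneg.2 hs1) (by ring)
  have hmem : s • x + (1 - s) • x' ∈ X := hf.1 hx hx' hs.le (sub_nonneg.2 hs1) (by ring)
  have h2 := hv _ hmem
  have e : s • x + (1 - s) • x' - x' = s • (x - x') := by
    rw [sub_smul, one_smul, smul_sub]; abel
  rw [e, inner_smul_right] at h2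
  simp only [smul_eq_mul] at h1
  have : 0 ≤ s * (f x - f x' - inner ℝ v (x - x') - μ / 2 * ‖x - x'‖ ^ 2
      + μ / 2 * ‖x - x'‖ ^ 2 * s) := by nlinarith
  exact nonneg_of_mul_nonneg_right this hs

theorem le_of_strongConcaveOn (hf : StrongConcaveOn X μ f) (hx : x ∈ X) (hx' : x' ∈ X)
    (hv : ∀ z ∈ X, f z ≤ f x' + inner ℝ v (z - x')) :
    f x ≤ f x' + inner ℝ v (x - x') - μ / 2 * ‖x - x'‖ ^ 2 := by
  have h1 : StrongConvexOn X μ (-f) := UniformConcaveOn.neg hf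
  have h2 := le_of_strongConvexOn (v := -v) h1 hx hx' (fun z hz => by
    simpa [inner_neg_left] using by linarith [hv z hz])
  simp only [Pi.neg_apply, inner_neg_left] at h2
  linarith

end StrongConvexity

/-! ### Weighted sums along the iterations -/

open Finset in
theorem sum_mul_sub_succ (c A : ℕ → ℝ) (K : ℕ) :
    ∑ k ∈ range K, c k / 2 * (A k - A (k + 1))
      = c 0 / 2 * A 0 + ∑ k ∈ range K, (c (k + 1) - c k) / 2 * A (k + 1) - c K / 2 * A K := by
  induction K with
  | zero => simp
  | succ K ih => rw [sum_range_succ, sum_range_succ, ih]; ring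

theorem sum_range_succ_eq_of_zero (f : ℕ → ℝ) (h0 : f 0 = 0) (K : ℕ) :
    ∑ k ∈ Finset.range (K + 1), f k = ∑ k ∈ Finset.range K, f (k + 1) := by
  rw [Finset.sum_range_succ', h0, add_zero]

theorem sum_range_le_shift (f : ℕ → ℝ) (h0 : f 0 = 0) (hf : ∀ k, 0 ≤ f k) (K : ℕ) :
    ∑ k ∈ Finset.range K, f k ≤ ∑ k ∈ Finset.range K, f (k + 1) := by
  rw [← sum_range_succ_eq_of_zero f h0, Finset.sum_range_succ]
  linarith [hf K]

section Extrapolation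

variable {E : Type*} [NormedAddCommGroup E] [InnerProductSpace ℝ E]

open Finset in
-- In `-θ k • r k` write `z - w (k + 1)` as `(z - w k) - (w (k + 1) - w k)`. The first part cancels
-- the positive term of the previous iteration, because the weights agree; `r 0 = 0` leaves nothing
-- to cancel at the start.
theorem sum_inner_extrapolation (t θ : ℕ → ℝ) (r w : ℕ → E) (z : E) (h0 : r 0 = 0) (K : ℕ)
    (hθ : ∀ k < K, θ (k + 1) * t (k + 1) = t k) :
    ∑ k ∈ range K, t k * inner ℝ (r (k + 1) - θ k • r k) (z - w (k + 1))
      = t K * θ K * inner ℝ (r K) (z - w K)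
        + ∑ k ∈ range K, t k * θ k * inner ℝ (r k) (w (k + 1) - w k) := by
  induction K with
  | zero => simp [h0]
  | succ K ih =>
    rw [sum_range_succ, sum_range_succ, ih fun k hk => hθ k (by omega)]
    have e : w (K + 1) - w K = (z - w K) - (z - w (K + 1)) := by abel
    have h1 := hθ K (by omega)
    rw [e]
    simp only [inner_sub_right, inner_sub_left, inner_smul_left, conj_trivial] at *
    linear_combination (inner ℝ (r (K + 1)) (w (K + 1)) - inner ℝ (r (K + 1)) z) * h1

end Extrapolation

/-- One block of the extrapolated proximal ascent method with noisy directions `u`, exact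
directions `ub` and targets `ub k + r (k + 1) - θ k • r k`. -/
theorem sum_inner_block {n : ℕ} {W : Set (Vec n)} (hW : Convex ℝ W) (t θ η : ℕ → ℝ)
    (ht : ∀ k, 0 ≤ t k) (hη : ∀ k, 0 < η k) (K : ℕ)
    (hθt : ∀ k < K, θ (k + 1) * t (k + 1) = t k)
    (u ub r w wt : ℕ → Vec n) {z : Vec n} (hz : z ∈ W) (h0 : r 0 = 0) (hwt : wt 0 = w 0)
    (hw : ∀ k, IsProxStep W (-u k) (w k) (η k) (w (k + 1)))
    (hwt' : ∀ k, IsProxStep W (u k - ub k) (wt k) (η k) (wt (k + 1))) :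
    ∑ k ∈ Finset.range K, t k * inner ℝ (ub k + (r (k + 1) - θ k • r k)) (z - w (k + 1))
      ≤ t 0 * η 0 * ‖z - w 0‖ ^ 2
        + ∑ k ∈ Finset.range K, (t (k + 1) * η (k + 1) - t k * η k) / 2 * ‖z - w (k + 1)‖ ^ 2
        + ∑ k ∈ Finset.range K, (t (k + 1) * η (k + 1) - t k * η k) / 2 * ‖z - wt (k + 1)‖ ^ 2
        - t K * η K / 2 * ‖z - wt K‖ ^ 2
        + ∑ k ∈ Finset.range K, t k * inner ℝ (u k - ub k) (w k - wt k)
        + ∑ k ∈ Finset.range K, 3 / 2 * (t k / η k) * ‖u k - ub k‖ ^ 2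
        - ∑ k ∈ Finset.range K, t k * η k / 8 * ‖w (k + 1) - w k‖ ^ 2
        + ∑ k ∈ Finset.range (K + 1), 2 * (t k * θ k ^ 2 / η k) * ‖r k‖ ^ 2 := by
  have hstep : ∀ k, t k * inner ℝ (ub k + (r (k + 1) - θ k • r k)) (z - w (k + 1))
      + t k * η k / 8 * ‖w (k + 1) - w k‖ ^ 2
      ≤ t k * η k / 2 * (‖z - w k‖ ^ 2 - ‖z - w (k + 1)‖ ^ 2)
        + t k * η k / 2 * (‖z - wt k‖ ^ 2 - ‖z - wt (k + 1)‖ ^ 2)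
        + t k * inner ℝ (u k - ub k) (w k - wt k)
        + 3 / 2 * (t k / η k) * ‖u k - ub k‖ ^ 2
        + (t k * inner ℝ (r (k + 1) - θ k • r k) (z - w (k + 1))
          - t k * θ k * inner ℝ (r k) (w (k + 1) - w k))
        + 2 * (t k * θ k ^ 2 / η k) * ‖r k‖ ^ 2 := by
    intro k
    have h1 := (hw k).noisy_aux (hwt' k) hW hz (hη k)
    -- `noisy_aux` leaves `η / 4`; half pays for the extrapolation, and the remaining `η / 8` is
    -- available against the part of `r` that depends on the iterate itself.
    have h2 := inner_le_young (θ k • r k) (w (k + 1) - w k) (c := η k / 8) (by linarith [hη k])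
    rw [inner_smul_left, norm_smul, mul_pow, Real.norm_eq_abs, sq_abs] at h2
    simp only [conj_trivial] at h2
    have e : θ k ^ 2 * ‖r k‖ ^ 2 / (4 * (η k / 8)) = 2 * (θ k ^ 2 / η k) * ‖r k‖ ^ 2 := by
      have := (hη k).ne'
      field_simp; ring
    rw [e] at h2
    have h3 := mul_le_mul_of_nonneg_left (add_le_add h1 h2) (ht k)
    rw [inner_add_left]
    calc _ = t k * (inner ℝ (ub k) (z - w (k + 1)) + θ k * inner ℝ (r k) (w (k + 1) - w k))
          + (t k * inner ℝ (r (k + 1) - θ k • r k) (z - w (k + 1))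
            - t k * θ k * inner ℝ (r k) (w (k + 1) - w k))
          + t k * η k / 8 * ‖w (k + 1) - w k‖ ^ 2 := by ring
      _ ≤ _ := by
        have e1 : 3 / 2 * (t k / η k) * ‖u k - ub k‖ ^ 2
            = t k * (3 / 2 * (‖u k - ub k‖ ^ 2 / η k)) := by ring
        have e2 : 2 * (t k * θ k ^ 2 / η k) * ‖r k‖ ^ 2
            = t k * (2 * (θ k ^ 2 / η k) * ‖r k‖ ^ 2) := by ring
        rw [e1, e2]
        linarith
  have hsum := Finset.sum_le_sum fun k (_ : k ∈ Finset.range K) => hstep k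
  simp only [Finset.sum_add_distrib, Finset.sum_sub_distrib] at hsum
  rw [sum_inner_extrapolation t θ r w z h0 K hθt,
    sum_mul_sub_succ (fun k => t k * η k) (fun k => ‖z - w k‖ ^ 2),
    sum_mul_sub_succ (fun k => t k * η k) (fun k => ‖z - wt k‖ ^ 2)] at hsum
  -- The boundary term consumes the final `-t K * η K / 2 * ‖z - w K‖ ^ 2` left by telescoping, so
  -- only its auxiliary analogue survives. The constant is then rounded up from `1 / 2` to `2` to
  -- make this the last term of the sum over `range (K + 1)`.
  have hlast := inner_le_young (θ K • r K) (z - w K) (c := η K / 2) (by linarith [hη K])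
  rw [inner_smul_left, norm_smul, mul_pow, Real.norm_eq_abs, sq_abs] at hlast
  simp only [conj_trivial] at hlast
  have hlast' : t K * θ K * inner ℝ (r K) (z - w K)
      ≤ 2 * (t K * θ K ^ 2 / η K) * ‖r K‖ ^ 2 + t K * η K / 2 * ‖z - w K‖ ^ 2 := by
    have h3 := mul_le_mul_of_nonneg_left hlast (ht K)
    have e : t K * (θ K ^ 2 * ‖r K‖ ^ 2 / (4 * (η K / 2)))
        = 1 / 2 * (t K * θ K ^ 2 / η K * ‖r K‖ ^ 2) := by
      have := (hη K).ne'
      field_simp; norm_num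
    have h4 : 0 ≤ t K * θ K ^ 2 / η K * ‖r K‖ ^ 2 :=
      mul_nonneg (div_nonneg (mul_nonneg (ht K) (sq_nonneg _)) (hη K).le) (sq_nonneg _)
    rw [mul_add, e] at h3
    linarith
  rw [Finset.sum_range_succ (fun k => 2 * (t k * θ k ^ 2 / η k) * ‖r k‖ ^ 2)]
  rw [hwt] at hsum
  linarith

/-- The descent block with noisy directions `d` and exact directions `db`. -/
theorem sum_inner_descent {n : ℕ} {W : Set (Vec n)} (hW : Convex ℝ W) (t τ : ℕ → ℝ) (μ : ℝ)
    (ht : ∀ k, 0 ≤ t k) (hτ : ∀ k, 0 < τ k) (K : ℕ) (hK : 1 ≤ K)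
    (hc : ∀ k < K, t (k + 1) * τ (k + 1) - t (k + 1) * μ - t k * τ k ≤ 0)
    (d db w : ℕ → Vec n) {z : Vec n} (hz : z ∈ W)
    (hw : ∀ k, IsProxStep W (d k) (w k) (τ k) (w (k + 1))) :
    ∑ k ∈ Finset.range K, t k * (inner ℝ (db k) (w (k + 1) - z) - μ / 2 * ‖z - w k‖ ^ 2)
      ≤ (t 0 * τ 0 - t 0 * μ) / 2 * ‖z - w 0‖ ^ 2
        - ∑ k ∈ Finset.range K, t k * inner ℝ (d k - db k) (w k - z)
        + ∑ k ∈ Finset.range K, t k / τ k * ‖d k - db k‖ ^ 2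
        - ∑ k ∈ Finset.range K, t k * τ k / 4 * ‖w (k + 1) - w k‖ ^ 2 := by
  have hstep : ∀ k, t k * (inner ℝ (db k) (w (k + 1) - z) - μ / 2 * ‖z - w k‖ ^ 2)
      ≤ t k * τ k / 2 * (‖z - w k‖ ^ 2 - ‖z - w (k + 1)‖ ^ 2) - t k * μ / 2 * ‖z - w k‖ ^ 2
        - t k * inner ℝ (d k - db k) (w k - z) + t k / τ k * ‖d k - db k‖ ^ 2
        - t k * τ k / 4 * ‖w (k + 1) - w k‖ ^ 2 := by
    intro k
    have h1 := mul_le_mul_of_nonneg_left ((hw k).noisy (db := db k) hW hz (hτ k)) (ht k)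
    have e : t k / τ k * ‖d k - db k‖ ^ 2 = t k * (‖d k - db k‖ ^ 2 / τ k) := by ring
    rw [e]
    linarith
  have hsum := Finset.sum_le_sum fun k (_ : k ∈ Finset.range K) => hstep k
  simp only [Finset.sum_add_distrib, Finset.sum_sub_distrib] at hsum
  rw [sum_mul_sub_succ (fun k => t k * τ k) (fun k => ‖z - w k‖ ^ 2)] at hsum
  -- The strong convexity gain sits at the old point `w k`, so it pays for the distance increments
  -- of the preceding index. The gain at `k = 0` remains, which is where `1 ≤ K` enters.
  have hμsum : ∑ k ∈ Finset.range K, (t (k + 1) * τ (k + 1) - t k * τ k) / 2 * ‖z - w (k + 1)‖ ^ 2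
      - t K * τ K / 2 * ‖z - w K‖ ^ 2
      ≤ ∑ k ∈ Finset.range K, t k * μ / 2 * ‖z - w k‖ ^ 2 - t 0 * μ / 2 * ‖z - w 0‖ ^ 2 := by
    obtain ⟨N, rfl⟩ : ∃ N, K = N + 1 := ⟨K - 1, by omega⟩
    rw [Finset.sum_range_succ' (fun k => t k * μ / 2 * ‖z - w k‖ ^ 2), add_sub_cancel_right,
      Finset.sum_range_succ]
    have h1 : ∑ k ∈ Finset.range N, (t (k + 1) * τ (k + 1) - t k * τ k) / 2 * ‖z - w (k + 1)‖ ^ 2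
        ≤ ∑ k ∈ Finset.range N, t (k + 1) * μ / 2 * ‖z - w (k + 1)‖ ^ 2 := by
      refine Finset.sum_le_sum fun k hk => ?_
      have := hc k (by have := Finset.mem_range.1 hk; omega)
      exact mul_le_mul_of_nonneg_right (by linarith) (sq_nonneg _)
    have h2 : 0 ≤ t N * τ N / 2 * ‖z - w (N + 1)‖ ^ 2 :=
      mul_nonneg (by have := mul_nonneg (ht N) (hτ N).le; linarith) (sq_nonneg _)
    linarith
  linarith

/-! ### Pathwise estimates -/

theorem norm_sq_eq_sum {m : ℕ} (v : Vec m) : ‖v‖ ^ 2 = ∑ i, v i ^ 2 :=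
  EuclideanSpace.real_norm_sq_eq v

theorem inner_eq_sum {m : ℕ} (v w : Vec m) : inner ℝ v w = ∑ i, v i * w i := by
  simp [PiLp.inner_apply, mul_comm]

theorem sum_le_of_norm1_le {m : ℕ} {l : Vec m} {Λ : ℝ} (hΛ : norm1 l ≤ Λ) : ∑ i, l i ≤ Λ :=
  (Finset.sum_le_sum fun i _ => le_abs_self (l i)).trans hΛ

theorem sum_mul_le_of_norm1_le {m : ℕ} {l : Vec m} {Λ : ℝ} (hΛ : norm1 l ≤ Λ)
    {c : ℝ} (hc : 0 ≤ c) : ∑ i, l i * c ≤ Λ * c := by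
  rw [← Finset.sum_mul]
  exact mul_le_mul_of_nonneg_right (sum_le_of_norm1_le hΛ) hc

theorem le_of_mem_orthant {m : ℕ} {l : Vec m} (hl : l ∈ orthant m) {Λ : ℝ}
    (hΛ : norm1 l ≤ Λ) (i : Fin m) : l i ≤ Λ :=
  (Finset.single_le_sum (fun j _ => hl j) (Finset.mem_univ i)).trans (sum_le_of_norm1_le hΛ)

theorem convex_orthant (m : ℕ) : Convex ℝ (orthant m) := by
  intro u hu v hv s t hs ht _ i
  have h1 := mul_nonneg hs (hu i)
  have h2 := mul_nonneg ht (hv i)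
  simpa using add_nonneg h1 h2

variable {p q m : ℕ}

/-- The gap at one iteration, bounded by the linear terms that the three steps control. -/
theorem Problem.phi_sub_phi_le (S : Problem p q m) (hconv : S.IsConvex) (hreg : S.IsRegular)
    {x xk xk1 : Vec p} (hx : x ∈ S.X) (hxk : xk ∈ S.X) (hxk1 : xk1 ∈ S.X)
    {y yk1 : Fin m → Vec q} (hy : ∀ i, y i ∈ S.Y i) (hyk1 : ∀ i, yk1 i ∈ S.Y i)
    {l lk1 : Vec m} (hl : l ∈ orthant m) (hlk1 : lk1 ∈ orthant m) {Λ : ℝ} (hΛ : norm1 l ≤ Λ) :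
    S.phi xk1 l y - S.phi x lk1 yk1
      ≤ (inner ℝ (S.gradf xk + ∑ i, lk1 i • S.gradx i xk (yk1 i)) (xk1 - x)
          - S.μf / 2 * ‖x - xk‖ ^ 2)
        + (S.Lf / 2 * ‖xk1 - xk‖ ^ 2 + S.Hf * ‖xk1 - xk‖)
        + Λ * (S.Lxx / 2 * ‖xk1 - xk‖ ^ 2 + S.Hx * ‖xk1 - xk‖)
        + inner ℝ (S.lin xk1 xk yk1) (l - lk1)
        + ∑ i, l i * (inner ℝ (S.grady i xk1 (yk1 i)) (y i - yk1 i)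
            - S.μy / 2 * ‖y i - yk1 i‖ ^ 2) := by
  have hf1 := hreg.f_upper xk1 hxk1 xk hxk
  have hf2 := le_of_strongConvexOn hconv.f_convex hx hxk (hconv.gradf_sub xk hxk)
  have hf3 : inner ℝ (S.gradf xk) (xk1 - x)
      = inner ℝ (S.gradf xk) (xk1 - xk) - inner ℝ (S.gradf xk) (x - xk) := by
    rw [← inner_sub_right]; congr 1; abel
  set c := S.Lxx / 2 * ‖xk1 - xk‖ ^ 2 + S.Hx * ‖xk1 - xk‖ with hc
  have hc0 : 0 ≤ c := by
    have := hreg.Lxx_nonneg; have := hreg.Hx_nonneg; positivity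
  have hterm : ∀ i, l i * S.g i xk1 (y i) - lk1 i * S.g i x (yk1 i)
      ≤ lk1 i * inner ℝ (S.gradx i xk (yk1 i)) (xk1 - x) + l i * c
        + S.lin xk1 xk yk1 i * (l - lk1) i
        + l i * (inner ℝ (S.grady i xk1 (yk1 i)) (y i - yk1 i)
            - S.μy / 2 * ‖y i - yk1 i‖ ^ 2) := by
    -- Concavity linearizes in `y` at `yk1`, the upper bound in `x` replaces `g` at `xk1` by its
    -- linearization from `xk`, and convexity bounds `g` at `x` below by that same linearization.
    intro i
    have h1 := le_of_strongConcaveOn (hconv.g_concave i xk1 hxk1) (hy i) (hyk1 i)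
      (hconv.grady_super i xk1 hxk1 _ (hyk1 i))
    have h2 := hreg.g_upper i xk1 hxk1 xk hxk _ (hyk1 i)
    have h3 := hconv.gradx_sub i _ (hyk1 i) xk hxk x hx
    have h4 : inner ℝ (S.gradx i xk (yk1 i)) (x - xk)
        = inner ℝ (S.gradx i xk (yk1 i)) (xk1 - xk)
          - inner ℝ (S.gradx i xk (yk1 i)) (xk1 - x) := by
      rw [← inner_sub_right]; congr 1; abel
    rw [h4] at h3
    have h5 := mul_le_mul_of_nonneg_left (h1.trans (by linarith :
      _ ≤ S.g i xk (yk1 i) + inner ℝ (S.gradx i xk (yk1 i)) (xk1 - xk) + c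
        + (inner ℝ (S.grady i xk1 (yk1 i)) (y i - yk1 i)
            - S.μy / 2 * ‖y i - yk1 i‖ ^ 2))) (hl i)
    have h6 := mul_le_mul_of_nonneg_left h3 (hlk1 i)
    simp only [Problem.lin, PiLp.sub_apply]
    linarith
  have hsum := Finset.sum_le_sum fun i (_ : i ∈ Finset.univ) => hterm i
  simp only [Finset.sum_add_distrib, Finset.sum_sub_distrib] at hsum
  have hΛc := sum_mul_le_of_norm1_le hΛ hc0
  have e1 : inner ℝ (S.gradf xk + ∑ i, lk1 i • S.gradx i xk (yk1 i)) (xk1 - x)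
      = inner ℝ (S.gradf xk) (xk1 - x)
        + ∑ i, lk1 i * inner ℝ (S.gradx i xk (yk1 i)) (xk1 - x) := by
    rw [inner_add_left, sum_inner]
    simp [inner_smul_left]
  rw [e1, inner_eq_sum (S.lin xk1 xk yk1)]
  simp only [Problem.phi, Finset.sum_sub_distrib, mul_sub] at hsum ⊢
  linarith

section Path

variable {Ω Ξ : Type*} {S : Problem p q m} {O : Oracle p q m Ξ} {a : Params}
  {Z : Processes p q m Ω Ξ} {K : ℕ} {x0 : Vec p} {y0 : Fin m → Vec q} {l0 : Vec m}

namespace Processes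

/-- The exact counterpart of `d`. -/
def dbar (Z : Processes p q m Ω Ξ) (S : Problem p q m) (k : ℕ) (ω : Ω) : Vec p :=
  S.gradf (Z.x k ω) + ∑ i, Z.lam (k + 1) ω i • S.gradx i (Z.x k ω) (Z.y (k + 1) ω i)

theorem IsRun.x_mem (hrun : Z.IsRun S O a x0 y0 l0) (hx0 : x0 ∈ S.X) (k : ℕ) (ω : Ω) :
    Z.x k ω ∈ S.X := by
  cases k with
  | zero => rw [hrun.x_zero]; exact hx0
  | succ k => exact (hrun.x_step k ω).1

theorem IsRun.y_mem (hrun : Z.IsRun S O a x0 y0 l0) (hy0 : ∀ i, y0 i ∈ S.Y i) (k : ℕ) (ω : Ω)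
    (i : Fin m) : Z.y k ω i ∈ S.Y i := by
  cases k with
  | zero => rw [hrun.y_zero]; exact hy0 i
  | succ k => exact (hrun.y_step k ω i).1

theorem IsRun.lam_mem (hrun : Z.IsRun S O a x0 y0 l0) (hl0 : l0 ∈ orthant m) (k : ℕ) (ω : Ω) :
    Z.lam k ω ∈ orthant m := by
  cases k with
  | zero => rw [hrun.lam_zero]; exact hl0
  | succ k => exact (hrun.lam_step k ω).1

theorem IsAux.yt_mem (haux : Z.IsAux S O a y0 l0) (hy0 : ∀ i, y0 i ∈ S.Y i) (k : ℕ) (ω : Ω)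
    (i : Fin m) : Z.yt k ω i ∈ S.Y i := by
  cases k with
  | zero => rw [haux.yt_zero]; exact hy0 i
  | succ k => exact (haux.yt_step k ω i).1

theorem IsAux.lamt_mem (haux : Z.IsAux S O a y0 l0) (hl0 : l0 ∈ orthant m) (k : ℕ) (ω : Ω) :
    Z.lamt k ω ∈ orthant m := by
  cases k with
  | zero => rw [haux.lamt_zero]; exact hl0
  | succ k => exact (haux.lamt_step k ω).1

/-- Here `r k` is the difference of two successive exact gradients, so the target of
`sum_inner_block` is the gradient at the new pair. The modulus `μy` absorbs the growing weights of
the distances to `y`; distances to `yt` have no such compensation and stay. In `‖r k‖²` the `Lyx`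
part goes to the residual, the `Lyy` part is absorbed through `cond_y`, and the `Hy` part becomes
explicit. -/
theorem y_block (hconv : S.IsConvex) (hreg : S.IsRegular)
    (ha : a.IsAdmissible K) (hcoupled : a.IsCoupled S O K)
    (hx0 : x0 ∈ S.X) (hy0 : ∀ i, y0 i ∈ S.Y i)
    (hrun : Z.IsRun S O a x0 y0 l0) (haux : Z.IsAux S O a y0 l0) (ω : Ω) (i : Fin m)
    {z : Vec q} (hz : z ∈ S.Y i) :
    ∑ k ∈ Finset.range K, a.t k * (inner ℝ (S.grady i (Z.x (k + 1) ω) (Z.y (k + 1) ω i))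
        (z - Z.y (k + 1) ω i) - S.μy / 2 * ‖z - Z.y (k + 1) ω i‖ ^ 2)
      ≤ a.t 0 * a.σ 0 * ‖z - y0 i‖ ^ 2
        + ∑ k ∈ Finset.range K, (a.t (k + 1) * a.σ (k + 1) - a.t k * a.σ k) / 2
            * ‖z - Z.yt (k + 1) ω i‖ ^ 2
        - a.t K * a.σ K / 2 * ‖z - Z.yt K ω i‖ ^ 2
        + ∑ k ∈ Finset.range K, a.t k
            * inner ℝ (Z.u O a k ω i - Z.ubar S a k ω i) (Z.y k ω i - Z.yt k ω i)
        + ∑ k ∈ Finset.range K, 3 / 2 * (a.t k / a.σ k)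
            * ‖Z.u O a k ω i - Z.ubar S a k ω i‖ ^ 2
        + ∑ k ∈ Finset.range K, 7 * a.t (k + 1) * (a.θ (k + 1) * S.Lyx) ^ 2 / a.σ (k + 1)
            * ‖Z.x (k + 1) ω - Z.x k ω‖ ^ 2
        + 7 * S.Hy ^ 2 * ∑ k ∈ Finset.range (K + 1), a.t k * a.θ k ^ 2 / a.σ k := by
  set r : ℕ → Vec q := fun k => S.grady i (Z.x k ω) (Z.y k ω i)
    - S.grady i (Z.x (k - 1) ω) (Z.y (k - 1) ω i) with hr
  have hblock := sum_inner_block (hconv.Y_convex i) a.t a.θ a.σ ha.t_nonneg ha.σ_pos K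
    (fun k hk => hcoupled.theta_t k hk.le)
    (fun k => Z.u O a k ω i) (fun k => Z.ubar S a k ω i) r
    (fun k => Z.y k ω i) (fun k => Z.yt k ω i) hz (by simp [hr])
    (by rw [haux.yt_zero, hrun.y_zero])
    (fun k => by simpa using hrun.y_step k ω i) (fun k => haux.yt_step k ω i)
  have hT : ∀ k, Z.ubar S a k ω i + (r (k + 1) - a.θ k • r k)
      = S.grady i (Z.x (k + 1) ω) (Z.y (k + 1) ω i) := by
    intro k
    simp only [hr, ubar, Nat.add_sub_cancel]
    abel
  simp only [hT] at hblock
  rw [hrun.y_zero] at hblock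
  have hμ : ∑ k ∈ Finset.range K, (a.t (k + 1) * a.σ (k + 1) - a.t k * a.σ k) / 2
        * ‖z - Z.y (k + 1) ω i‖ ^ 2
      ≤ ∑ k ∈ Finset.range K, a.t k * (S.μy / 2 * ‖z - Z.y (k + 1) ω i‖ ^ 2) := by
    refine Finset.sum_le_sum fun k hk => ?_
    have := hcoupled.cond_σ k (Finset.mem_range.1 hk).le
    have h := mul_le_mul_of_nonneg_right (by linarith :
      (a.t (k + 1) * a.σ (k + 1) - a.t k * a.σ k) / 2 ≤ a.t k * (S.μy / 2))
      (sq_nonneg ‖z - Z.y (k + 1) ω i‖)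
    linarith
  set c : ℕ → ℝ := fun k => a.t k * a.θ k ^ 2 / a.σ k with hc
  have hc0 : ∀ k, 0 ≤ c k := fun k =>
    div_nonneg (mul_nonneg (ha.t_nonneg k) (sq_nonneg _)) (ha.σ_pos k).le
  have hrk : ∀ k, 2 * c k * ‖r k‖ ^ 2
      ≤ 6 * c k * S.Lyx ^ 2 * ‖Z.x k ω - Z.x (k - 1) ω‖ ^ 2
        + 6 * c k * S.Lyy ^ 2 * ‖Z.y k ω i - Z.y (k - 1) ω i‖ ^ 2 + 6 * c k * S.Hy ^ 2 := by
    intro k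
    have h1 := hreg.grady_lip i _ (hrun.x_mem hx0 k ω) _ (hrun.x_mem hx0 (k - 1) ω) _
      (hrun.y_mem hy0 k ω i) _ (hrun.y_mem hy0 (k - 1) ω i)
    set A := S.Lyx * ‖Z.x k ω - Z.x (k - 1) ω‖
    set B := S.Lyy * ‖Z.y k ω i - Z.y (k - 1) ω i‖
    have h2 : ‖r k‖ ^ 2 ≤ 3 * (A ^ 2 + B ^ 2 + S.Hy ^ 2) := by
      have h3 : ‖r k‖ ^ 2 ≤ (A + B + S.Hy) ^ 2 := pow_le_pow_left₀ (norm_nonneg _) h1 2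
      nlinarith [sq_nonneg (A - B), sq_nonneg (A - S.Hy), sq_nonneg (B - S.Hy)]
    have h4 := mul_le_mul_of_nonneg_left h2 (mul_nonneg zero_le_two (hc0 k))
    simp only [A, B, mul_pow] at h4
    linarith
  have hrsum := Finset.sum_le_sum fun k (_ : k ∈ Finset.range (K + 1)) => hrk k
  simp only [Finset.sum_add_distrib] at hrsum
  rw [sum_range_succ_eq_of_zero (fun k => 6 * c k * S.Lyx ^ 2 * ‖Z.x k ω - Z.x (k - 1) ω‖ ^ 2)
      (by simp),
    sum_range_succ_eq_of_zero
      (fun k => 6 * c k * S.Lyy ^ 2 * ‖Z.y k ω i - Z.y (k - 1) ω i‖ ^ 2) (by simp)] at hrsum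
  simp only [Nat.add_sub_cancel] at hrsum
  have hx : ∑ k ∈ Finset.range K, 6 * c (k + 1) * S.Lyx ^ 2 * ‖Z.x (k + 1) ω - Z.x k ω‖ ^ 2
      ≤ ∑ k ∈ Finset.range K, 7 * a.t (k + 1) * (a.θ (k + 1) * S.Lyx) ^ 2 / a.σ (k + 1)
            * ‖Z.x (k + 1) ω - Z.x k ω‖ ^ 2 := by
    refine Finset.sum_le_sum fun k _ => mul_le_mul_of_nonneg_right ?_ (sq_nonneg _)
    have e : 7 * a.t (k + 1) * (a.θ (k + 1) * S.Lyx) ^ 2 / a.σ (k + 1)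
        = 7 * (c (k + 1) * S.Lyx ^ 2) := by simp only [hc]; ring
    rw [e]
    have := mul_nonneg (hc0 (k + 1)) (sq_nonneg S.Lyx)
    linarith
  have hy : ∑ k ∈ Finset.range K, 6 * c (k + 1) * S.Lyy ^ 2
        * ‖Z.y (k + 1) ω i - Z.y k ω i‖ ^ 2
      ≤ ∑ k ∈ Finset.range K, a.t k * a.σ k / 8 * ‖Z.y (k + 1) ω i - Z.y k ω i‖ ^ 2 := by
    refine Finset.sum_le_sum fun k hk => mul_le_mul_of_nonneg_right ?_ (sq_nonneg _)
    have h1 := hcoupled.cond_y k (Finset.mem_range.1 hk).le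
    have e : 7 * a.t (k + 1) * (a.θ (k + 1) * S.Lyy) ^ 2 / a.σ (k + 1)
        = 7 * (c (k + 1) * S.Lyy ^ 2) := by simp only [hc]; ring
    rw [e] at h1
    have := mul_nonneg (hc0 (k + 1)) (sq_nonneg S.Lyy)
    linarith
  have hH : ∑ k ∈ Finset.range (K + 1), 6 * c k * S.Hy ^ 2
      ≤ 7 * S.Hy ^ 2 * ∑ k ∈ Finset.range (K + 1), c k := by
    rw [Finset.mul_sum]
    refine Finset.sum_le_sum fun k _ => ?_
    have := mul_nonneg (hc0 k) (sq_nonneg S.Hy)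
    linarith
  simp only [mul_sub, Finset.sum_sub_distrib] at hblock ⊢
  linarith

/-- Here `r k` compares two successive linearizations at the same `y k`, so it involves only two
successive `x`-increments and not the variation of `y` or `λ`. This is the purpose of evaluating
both extrapolation terms of `v` at `y k`. -/
theorem lam_block (hreg : S.IsRegular)
    (ha : a.IsAdmissible K) (hcoupled : a.IsCoupled S O K)
    (hx0 : x0 ∈ S.X) (hy0 : ∀ i, y0 i ∈ S.Y i)
    (hrun : Z.IsRun S O a x0 y0 l0) (haux : Z.IsAux S O a y0 l0) (ω : Ω)
    {l : Vec m} (hl : l ∈ orthant m) :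
    ∑ k ∈ Finset.range K, a.t k * inner ℝ (S.lin (Z.x (k + 1) ω) (Z.x k ω) (Z.y (k + 1) ω))
        (l - Z.lam (k + 1) ω)
      ≤ a.t 0 * a.γ 0 * ‖l - l0‖ ^ 2
        + ∑ k ∈ Finset.range K, (a.t (k + 1) * a.γ (k + 1) - a.t k * a.γ k) / 2
            * ‖l - Z.lam (k + 1) ω‖ ^ 2
        + ∑ k ∈ Finset.range K, (a.t (k + 1) * a.γ (k + 1) - a.t k * a.γ k) / 2
            * ‖l - Z.lamt (k + 1) ω‖ ^ 2
        - a.t K * a.γ K / 2 * ‖l - Z.lamt K ω‖ ^ 2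
        + ∑ k ∈ Finset.range K, a.t k
            * inner ℝ (Z.v O a k ω - Z.vbar S a k ω) (Z.lam k ω - Z.lamt k ω)
        + ∑ k ∈ Finset.range K, 3 / 2 * (a.t k / a.γ k) * ‖Z.v O a k ω - Z.vbar S a k ω‖ ^ 2
        + ∑ k ∈ Finset.range K, (6 * m * a.t (k + 1) * a.θ (k + 1) ^ 2 * S.Mx ^ 2 / a.γ (k + 1)
            + 24 * m * a.t (k + 2) * a.θ (k + 2) ^ 2 * S.Mx ^ 2 / a.γ (k + 2))
            * ‖Z.x (k + 1) ω - Z.x k ω‖ ^ 2 := by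
  set r : ℕ → Vec m := fun k => S.lin (Z.x k ω) (Z.x (k - 1) ω) (Z.y k ω)
    - S.lin (Z.x (k - 1) ω) (Z.x (k - 2) ω) (Z.y k ω) with hr
  have hblock := sum_inner_block (convex_orthant m) a.t a.θ a.γ ha.t_nonneg ha.γ_pos K
    (fun k hk => hcoupled.theta_t k hk.le)
    (fun k => Z.v O a k ω) (fun k => Z.vbar S a k ω) r
    (fun k => Z.lam k ω) (fun k => Z.lamt k ω) hl (by simp [hr])
    (by rw [haux.lamt_zero, hrun.lam_zero])
    (fun k => by simpa using hrun.lam_step k ω) (fun k => haux.lamt_step k ω)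
  have hT : ∀ k, Z.vbar S a k ω + (r (k + 1) - a.θ k • r k)
      = S.lin (Z.x (k + 1) ω) (Z.x k ω) (Z.y (k + 1) ω) := by
    intro k
    simp only [hr, vbar, Nat.add_sub_cancel, show k + 1 - 2 = k - 1 by omega]
    abel
  simp only [hT] at hblock
  rw [hrun.lam_zero] at hblock
  set D : ℕ → ℝ := fun k => ‖Z.x k ω - Z.x (k - 1) ω‖ ^ 2 with hD
  have hD0 : D 0 = 0 := by simp [hD]
  have hDn : ∀ k, 0 ≤ D k := fun k => sq_nonneg _
  set c : ℕ → ℝ := fun k => a.t k * a.θ k ^ 2 / a.γ k with hc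
  have hc0 : ∀ k, 0 ≤ c k := fun k =>
    div_nonneg (mul_nonneg (ha.t_nonneg k) (sq_nonneg _)) (ha.γ_pos k).le
  have hrk : ∀ k, ‖r k‖ ^ 2 ≤ m * S.Mx ^ 2 * (2 * D k + 8 * D (k - 1)) := by
    intro k
    rw [norm_sq_eq_sum]
    have hterm : ∀ i, r k i ^ 2 ≤ S.Mx ^ 2 * (2 * D k + 8 * D (k - 1)) := by
      intro i
      have hyk := hrun.y_mem hy0 k ω i
      have h1 := hreg.g_lip i _ (hrun.x_mem hx0 (k - 1) ω) _ (hrun.x_mem hx0 (k - 2) ω) _ hyk _ hyk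
      have h2 := hreg.gradx_bound i _ (hrun.x_mem hx0 k ω) _ (hrun.x_mem hx0 (k - 1) ω) _ hyk
      have h3 := hreg.gradx_bound i _ (hrun.x_mem hx0 (k - 1) ω) _ (hrun.x_mem hx0 (k - 2) ω) _ hyk
      rw [sub_self, norm_zero, mul_zero, add_zero] at h1
      simp only [hr, hD, Problem.lin, PiLp.sub_apply, show k - 1 - 1 = k - 2 by omega]
      set A := ‖Z.x k ω - Z.x (k - 1) ω‖
      set B := ‖Z.x (k - 1) ω - Z.x (k - 2) ω‖
      rw [abs_le] at h1 h2 h3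
      have h4 : |S.g i (Z.x (k - 1) ω) (Z.y k ω i)
            + inner ℝ (S.gradx i (Z.x (k - 1) ω) (Z.y k ω i)) (Z.x k ω - Z.x (k - 1) ω)
            - (S.g i (Z.x (k - 2) ω) (Z.y k ω i)
              + inner ℝ (S.gradx i (Z.x (k - 2) ω) (Z.y k ω i)) (Z.x (k - 1) ω - Z.x (k - 2) ω))|
          -- The older increment `B` counts twice: once for the change of `g`, once for its own
          -- linear term.
          ≤ S.Mx * (A + 2 * B) := by
        rw [abs_le]; constructor <;> linarith
      have h5 := pow_le_pow_left₀ (abs_nonneg _) h4 2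
      rw [sq_abs, mul_pow] at h5
      refine h5.trans (mul_le_mul_of_nonneg_left ?_ (sq_nonneg _))
      nlinarith [sq_nonneg (A - 2 * B)]
    calc ∑ i, r k i ^ 2 ≤ ∑ _i : Fin m, S.Mx ^ 2 * (2 * D k + 8 * D (k - 1)) :=
          Finset.sum_le_sum fun i _ => hterm i
      _ = m * S.Mx ^ 2 * (2 * D k + 8 * D (k - 1)) := by simp; ring
  have hrk' : ∀ k, 2 * c k * ‖r k‖ ^ 2
      ≤ 6 * m * c k * S.Mx ^ 2 * D k + 24 * m * c k * S.Mx ^ 2 * D (k - 1) := by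
    intro k
    have h1 := mul_le_mul_of_nonneg_left (hrk k) (mul_nonneg zero_le_two (hc0 k))
    have h2 : 0 ≤ m * c k * S.Mx ^ 2 * (D k + 4 * D (k - 1)) := by
      have := hc0 k; have := hDn k; have := hDn (k - 1)
      positivity
    linarith
  have hrsum := Finset.sum_le_sum fun k (_ : k ∈ Finset.range (K + 1)) => hrk' k
  simp only [Finset.sum_add_distrib] at hrsum
  rw [sum_range_succ_eq_of_zero (fun k => 6 * m * c k * S.Mx ^ 2 * D k) (by simp [hD0]),
    sum_range_succ_eq_of_zero (fun k => 24 * m * c k * S.Mx ^ 2 * D (k - 1)) (by simp [hD0])]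
    at hrsum
  -- The older increment is reindexed to `D (k + 1)`, adding a nonnegative last term; hence the
  -- coefficients of index `k + 2` in `cond_x`.
  have hshift := sum_range_le_shift (fun k => 24 * m * c (k + 1) * S.Mx ^ 2 * D k) (by simp [hD0])
    (fun k => by have := hc0 (k + 1); have := hDn k; positivity) K
  have e : ∑ k ∈ Finset.range K,
        (6 * m * a.t (k + 1) * a.θ (k + 1) ^ 2 * S.Mx ^ 2 / a.γ (k + 1)
            + 24 * m * a.t (k + 2) * a.θ (k + 2) ^ 2 * S.Mx ^ 2 / a.γ (k + 2))
            * ‖Z.x (k + 1) ω - Z.x k ω‖ ^ 2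
      = ∑ k ∈ Finset.range K, 6 * m * c (k + 1) * S.Mx ^ 2 * D (k + 1)
        + ∑ k ∈ Finset.range K, 24 * m * c (k + 1 + 1) * S.Mx ^ 2 * D (k + 1) := by
    rw [← Finset.sum_add_distrib]
    refine Finset.sum_congr rfl fun k _ => ?_
    simp only [hc, hD, Nat.add_sub_cancel]
    ring
  rw [e]
  simp only [Nat.add_sub_cancel] at hrsum
  -- Since `r` does not involve `λ`, the leftover quadratic term is not needed and is dropped.
  have hneg : 0 ≤ ∑ k ∈ Finset.range K, a.t k * a.γ k / 8 * ‖Z.lam (k + 1) ω - Z.lam k ω‖ ^ 2 :=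
    Finset.sum_nonneg fun k _ => mul_nonneg
      (by have := mul_nonneg (ha.t_nonneg k) (ha.γ_pos k).le; linarith) (sq_nonneg _)
  linarith

/-- The weights `l i` do not vary with `k`, so the block bounds may be averaged after summation.
Only the nonnegative error terms are enlarged using `Λ`; the signed distance and martingale terms
must keep `l`. -/
theorem y_blocks (hconv : S.IsConvex) (hreg : S.IsRegular)
    (ha : a.IsAdmissible K) (hcoupled : a.IsCoupled S O K)
    (hx0 : x0 ∈ S.X) (hy0 : ∀ i, y0 i ∈ S.Y i)
    (hrun : Z.IsRun S O a x0 y0 l0) (haux : Z.IsAux S O a y0 l0) (ω : Ω)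
    {y : Fin m → Vec q} (hy : ∀ i, y i ∈ S.Y i)
    {l : Vec m} (hl : l ∈ orthant m) {Λ : ℝ} (hΛ : norm1 l ≤ Λ) :
    ∑ k ∈ Finset.range K, a.t k * ∑ i, l i * (inner ℝ (S.grady i (Z.x (k + 1) ω)
        (Z.y (k + 1) ω i)) (y i - Z.y (k + 1) ω i) - S.μy / 2 * ‖y i - Z.y (k + 1) ω i‖ ^ 2)
      ≤ a.t 0 * a.σ 0 * wsq l (y - y0)
        + ∑ k ∈ Finset.range K, (a.t (k + 1) * a.σ (k + 1) - a.t k * a.σ k) / 2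
            * wsq l (y - Z.yt (k + 1) ω)
        - a.t K * a.σ K / 2 * wsq l (y - Z.yt K ω)
        + ∑ i, l i * ∑ k ∈ Finset.range K, a.t k
            * inner ℝ (Z.u O a k ω i - Z.ubar S a k ω i) (Z.y k ω i - Z.yt k ω i)
        + Λ * ∑ k ∈ Finset.range K, 3 / 2 * (a.t k / a.σ k)
            * ∑ i, ‖Z.u O a k ω i - Z.ubar S a k ω i‖ ^ 2
        + ∑ k ∈ Finset.range K, 7 * a.t (k + 1) * (a.θ (k + 1) * S.Lyx) ^ 2 * Λ / a.σ (k + 1)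
            * ‖Z.x (k + 1) ω - Z.x k ω‖ ^ 2
        + 7 * S.Hy ^ 2 * Λ * ∑ k ∈ Finset.range (K + 1), a.t k * a.θ k ^ 2 / a.σ k := by
  have hsum := Finset.sum_le_sum fun i (_ : i ∈ Finset.univ) => mul_le_mul_of_nonneg_left
    (y_block hconv hreg ha hcoupled hx0 hy0 hrun haux ω i (hy i)) (hl i)
  simp only [mul_add, mul_sub, Finset.sum_add_distrib, Finset.sum_sub_distrib] at hsum
  have swap : ∀ (c : ℕ → ℝ) (f : ℕ → Fin m → ℝ),
      ∑ i, l i * ∑ k ∈ Finset.range K, c k * f k i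
        = ∑ k ∈ Finset.range K, c k * ∑ i, l i * f k i := by
    intro c f
    simp only [Finset.mul_sum]
    rw [Finset.sum_comm]
    exact Finset.sum_congr rfl fun k _ => Finset.sum_congr rfl fun i _ => by ring
  have pull : ∀ (c : ℝ) (f : Fin m → ℝ), ∑ i, l i * (c * f i) = c * ∑ i, l i * f i := by
    intro c f
    rw [Finset.mul_sum]
    exact Finset.sum_congr rfl fun i _ => by ring
  have hD : ∑ i, l i * (∑ k ∈ Finset.range K,
        7 * a.t (k + 1) * (a.θ (k + 1) * S.Lyx) ^ 2 / a.σ (k + 1)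
            * ‖Z.x (k + 1) ω - Z.x k ω‖ ^ 2)
      ≤ ∑ k ∈ Finset.range K, 7 * a.t (k + 1) * (a.θ (k + 1) * S.Lyx) ^ 2 * Λ / a.σ (k + 1)
            * ‖Z.x (k + 1) ω - Z.x k ω‖ ^ 2 := by
    refine (sum_mul_le_of_norm1_le hΛ (Finset.sum_nonneg fun k _ => ?_)).trans_eq ?_
    · have := ha.t_nonneg (k + 1); have := ha.σ_pos (k + 1); positivity
    · rw [Finset.mul_sum]
      exact Finset.sum_congr rfl fun k _ => by ring
  have hH : ∑ i, l i * (7 * S.Hy ^ 2 * ∑ k ∈ Finset.range (K + 1), a.t k * a.θ k ^ 2 / a.σ k)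
      ≤ 7 * S.Hy ^ 2 * Λ * ∑ k ∈ Finset.range (K + 1), a.t k * a.θ k ^ 2 / a.σ k := by
    refine (sum_mul_le_of_norm1_le hΛ (mul_nonneg (by positivity)
      (Finset.sum_nonneg fun k _ => ?_))).trans_eq (by ring)
    have := ha.t_nonneg k; have := ha.σ_pos k; positivity
  have hU : ∑ i, l i * ∑ k ∈ Finset.range K, 3 / 2 * (a.t k / a.σ k)
            * ‖Z.u O a k ω i - Z.ubar S a k ω i‖ ^ 2
      ≤ Λ * ∑ k ∈ Finset.range K, 3 / 2 * (a.t k / a.σ k)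
            * ∑ i, ‖Z.u O a k ω i - Z.ubar S a k ω i‖ ^ 2 := by
    rw [swap (fun k => 3 / 2 * (a.t k / a.σ k)), Finset.mul_sum]
    refine Finset.sum_le_sum fun k _ => ?_
    have h1 : ∑ i, l i * ‖Z.u O a k ω i - Z.ubar S a k ω i‖ ^ 2
        ≤ ∑ i, Λ * ‖Z.u O a k ω i - Z.ubar S a k ω i‖ ^ 2 :=
      Finset.sum_le_sum fun i _ => mul_le_mul_of_nonneg_right (le_of_mem_orthant hl hΛ i)
        (sq_nonneg _)
    rw [← Finset.mul_sum] at h1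
    have h2 : 0 ≤ 3 / 2 * (a.t k / a.σ k) := by
      have := ha.t_nonneg k; have := ha.σ_pos k; positivity
    have h3 := mul_le_mul_of_nonneg_left h1 h2
    linarith
  rw [pull (a.t 0 * a.σ 0) (fun i => ‖y i - y0 i‖ ^ 2),
    pull (a.t K * a.σ K / 2) (fun i => ‖y i - Z.yt K ω i‖ ^ 2),
    swap (fun k => (a.t (k + 1) * a.σ (k + 1) - a.t k * a.σ k) / 2)] at hsum
  have e := swap a.t (fun k i => inner ℝ (S.grady i (Z.x (k + 1) ω)
        (Z.y (k + 1) ω i)) (y i - Z.y (k + 1) ω i) - S.μy / 2 * ‖y i - Z.y (k + 1) ω i‖ ^ 2)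
  rw [← e]
  simp only [mul_sub, Finset.sum_sub_distrib, wsq, Pi.sub_apply]
  linarith

/-- Holds at each outcome, without probability. The two last sums are reserves extracted from
`cond_γ` and `cond_x`, to be matched in expectation with the variances of `d` and `v`. -/
theorem gap_le (hconv : S.IsConvex) (hreg : S.IsRegular) (hK : 1 ≤ K)
    (ha : a.IsAdmissible K) (hcoupled : a.IsCoupled S O K)
    (hx0 : x0 ∈ S.X) (hy0 : ∀ i, y0 i ∈ S.Y i) (hl0 : l0 ∈ orthant m)
    (hrun : Z.IsRun S O a x0 y0 l0) (haux : Z.IsAux S O a y0 l0) (ω : Ω)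
    {x : Vec p} (hx : x ∈ S.X) {y : Fin m → Vec q} (hy : ∀ i, y i ∈ S.Y i)
    {l : Vec m} (hl : l ∈ orthant m) {Λ : ℝ} (hΛ : norm1 l ≤ Λ) :
    Z.gap S a K x l y ω
      ≤ (a.t 0 * a.τ 0 - a.t 0 * S.μf) / 2 * ‖x - x0‖ ^ 2
        + a.t 0 * a.γ 0 * ‖l - l0‖ ^ 2
        + a.t 0 * a.σ 0 * wsq l (y - y0)
        + ∑ k ∈ Finset.range K,
            (7 * a.t (k + 1) * (a.θ (k + 1) * S.Lyx) ^ 2 * Λ / a.σ (k + 1)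
              + a.t k * S.Lxx * Λ / 2 - a.t k * a.τ k / 16) * ‖Z.x (k + 1) ω - Z.x k ω‖ ^ 2
        + ∑ k ∈ Finset.range K, (a.t (k + 1) * a.γ (k + 1) - a.t k * a.γ k) / 2
            * ‖l - Z.lamt (k + 1) ω‖ ^ 2
        + ∑ k ∈ Finset.range K, (a.t (k + 1) * a.σ (k + 1) - a.t k * a.σ k) / 2
            * wsq l (y - Z.yt (k + 1) ω)
        - a.t K * a.γ K / 2 * ‖l - Z.lamt K ω‖ ^ 2
        - a.t K * a.σ K / 2 * wsq l (y - Z.yt K ω)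
        + 4 * (S.Hx ^ 2 * Λ ^ 2 + S.Hf ^ 2) * ∑ k ∈ Finset.range K, a.t k / a.τ k
        + 7 * S.Hy ^ 2 * Λ * ∑ k ∈ Finset.range (K + 1), a.t k * a.θ k ^ 2 / a.σ k
        + ∑ i, l i * ∑ k ∈ Finset.range K, a.t k
            * inner ℝ (Z.u O a k ω i - Z.ubar S a k ω i) (Z.y k ω i - Z.yt k ω i)
        + Λ * ∑ k ∈ Finset.range K, 3 / 2 * (a.t k / a.σ k)
            * ∑ i, ‖Z.u O a k ω i - Z.ubar S a k ω i‖ ^ 2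
        + ∑ k ∈ Finset.range K, a.t k
            * inner ℝ (Z.v O a k ω - Z.vbar S a k ω) (Z.lam k ω - Z.lamt k ω)
        + ∑ k ∈ Finset.range K, 3 / 2 * (a.t k / a.γ k) * ‖Z.v O a k ω - Z.vbar S a k ω‖ ^ 2
        - ∑ k ∈ Finset.range K, a.t k * inner ℝ (Z.d O k ω - Z.dbar S k ω) (Z.x k ω - x)
        + ∑ k ∈ Finset.range K, a.t k / a.τ k * ‖Z.d O k ω - Z.dbar S k ω‖ ^ 2
        - ∑ k ∈ Finset.range K, 4 * m * O.sg' ^ 2 * (a.t k / a.τ k)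
            * ‖l - Z.lam (k + 1) ω‖ ^ 2
        - ∑ k ∈ Finset.range K, (18 * m * O.sg' ^ 2 * (a.t (k + 1) / a.γ (k + 1))
            + 12 * m * O.sg' ^ 2 * (a.t (k + 2) / a.γ (k + 2)))
            * ‖Z.x (k + 1) ω - Z.x k ω‖ ^ 2 := by
  have hyb := y_blocks hconv hreg ha hcoupled hx0 hy0 hrun haux ω hy hl hΛ
  have hlb := lam_block hreg ha hcoupled hx0 hy0 hrun haux ω hl
  have hxb := sum_inner_descent hconv.X_convex a.t a.τ S.μf ha.t_nonneg ha.τ_pos K hK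
    (fun k hk => hcoupled.cond_τ k hk.le) (fun k => Z.d O k ω) (fun k => Z.dbar S k ω)
    (fun k => Z.x k ω) hx (fun k => hrun.x_step k ω)
  rw [hrun.x_zero] at hxb
  have hgap : Z.gap S a K x l y ω ≤ ∑ k ∈ Finset.range K,
      (a.t k * (inner ℝ (Z.dbar S k ω) (Z.x (k + 1) ω - x) - S.μf / 2 * ‖x - Z.x k ω‖ ^ 2)
        + a.t k * ((S.Lf / 2 * ‖Z.x (k + 1) ω - Z.x k ω‖ ^ 2 + S.Hf * ‖Z.x (k + 1) ω - Z.x k ω‖)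
          + Λ * (S.Lxx / 2 * ‖Z.x (k + 1) ω - Z.x k ω‖ ^ 2 + S.Hx * ‖Z.x (k + 1) ω - Z.x k ω‖))
        + a.t k * inner ℝ (S.lin (Z.x (k + 1) ω) (Z.x k ω) (Z.y (k + 1) ω)) (l - Z.lam (k + 1) ω)
        + a.t k * ∑ i, l i * (inner ℝ (S.grady i (Z.x (k + 1) ω)
            (Z.y (k + 1) ω i)) (y i - Z.y (k + 1) ω i)
            - S.μy / 2 * ‖y i - Z.y (k + 1) ω i‖ ^ 2)) := by
    refine Finset.sum_le_sum fun k _ => ?_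
    have h := mul_le_mul_of_nonneg_left (S.phi_sub_phi_le hconv hreg hx (hrun.x_mem hx0 k ω)
      (hrun.x_mem hx0 (k + 1) ω) hy (hrun.y_mem hy0 (k + 1) ω) hl
      (hrun.lam_mem hl0 (k + 1) ω) hΛ) (ha.t_nonneg k)
    refine h.trans_eq ?_
    rw [dbar]; ring
  simp only [Finset.sum_add_distrib] at hgap
  -- The budget `t τ / 4` of the descent step is split into four parts `t τ / 16`: one for `cond_x`,
  -- one for `Hf`, one for `Hx * Λ`, and one left negative in the residual.
  have hsmooth : ∑ k ∈ Finset.range K, a.t k *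
        (S.Lf / 2 * ‖Z.x (k + 1) ω - Z.x k ω‖ ^ 2 + S.Hf * ‖Z.x (k + 1) ω - Z.x k ω‖)
      + ∑ k ∈ Finset.range K, a.t k *
        (Λ * (S.Lxx / 2 * ‖Z.x (k + 1) ω - Z.x k ω‖ ^ 2 + S.Hx * ‖Z.x (k + 1) ω - Z.x k ω‖))
      + ∑ k ∈ Finset.range K, (6 * m * a.t (k + 1) * a.θ (k + 1) ^ 2 * S.Mx ^ 2 / a.γ (k + 1)
          + 24 * m * a.t (k + 2) * a.θ (k + 2) ^ 2 * S.Mx ^ 2 / a.γ (k + 2))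
          * ‖Z.x (k + 1) ω - Z.x k ω‖ ^ 2
      + ∑ k ∈ Finset.range K, 7 * a.t (k + 1) * (a.θ (k + 1) * S.Lyx) ^ 2 * Λ / a.σ (k + 1)
          * ‖Z.x (k + 1) ω - Z.x k ω‖ ^ 2
      + ∑ k ∈ Finset.range K, (18 * m * O.sg' ^ 2 * (a.t (k + 1) / a.γ (k + 1))
          + 12 * m * O.sg' ^ 2 * (a.t (k + 2) / a.γ (k + 2))) * ‖Z.x (k + 1) ω - Z.x k ω‖ ^ 2
      ≤ ∑ k ∈ Finset.range K, (7 * a.t (k + 1) * (a.θ (k + 1) * S.Lyx) ^ 2 * Λ / a.σ (k + 1)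
          + a.t k * S.Lxx * Λ / 2 - a.t k * a.τ k / 16) * ‖Z.x (k + 1) ω - Z.x k ω‖ ^ 2
        + ∑ k ∈ Finset.range K, a.t k * a.τ k / 4 * ‖Z.x (k + 1) ω - Z.x k ω‖ ^ 2
        + 4 * (S.Hx ^ 2 * Λ ^ 2 + S.Hf ^ 2) * ∑ k ∈ Finset.range K, a.t k / a.τ k := by
    rw [Finset.mul_sum]
    simp only [← Finset.sum_add_distrib]
    refine Finset.sum_le_sum fun k hk => ?_
    have hc := mul_le_mul_of_nonneg_right (hcoupled.cond_x k (Finset.mem_range.1 hk).le)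
      (sq_nonneg ‖Z.x (k + 1) ω - Z.x k ω‖)
    have hτ := ha.τ_pos k
    have young : ∀ b : ℝ, a.t k * (b * ‖Z.x (k + 1) ω - Z.x k ω‖)
        ≤ 4 * b ^ 2 * (a.t k / a.τ k) + a.t k * a.τ k / 16 * ‖Z.x (k + 1) ω - Z.x k ω‖ ^ 2 := by
      intro b
      set n := ‖Z.x (k + 1) ω - Z.x k ω‖
      have e : 4 * b ^ 2 * (a.t k / a.τ k) + a.t k * a.τ k / 16 * n ^ 2 - a.t k * (b * n)
          = a.t k * (4 * (b - a.τ k * n / 8) ^ 2 / a.τ k) := by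
        field_simp; ring
      have : 0 ≤ a.t k * (4 * (b - a.τ k * n / 8) ^ 2 / a.τ k) :=
        mul_nonneg (ha.t_nonneg k) (by positivity)
      linarith
    have y1 := young S.Hf
    have y2 := young (S.Hx * Λ)
    have e1 : 18 * m * O.sg' ^ 2 * a.t (k + 1) / a.γ (k + 1)
      = 18 * m * O.sg' ^ 2 * (a.t (k + 1) / a.γ (k + 1)) := by ring
    have e2 : 12 * m * O.sg' ^ 2 * a.t (k + 2) / a.γ (k + 2)
      = 12 * m * O.sg' ^ 2 * (a.t (k + 2) / a.γ (k + 2)) := by ring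
    rw [e1, e2] at hc
    linarith
  have hγ : ∑ k ∈ Finset.range K, (a.t (k + 1) * a.γ (k + 1) - a.t k * a.γ k) / 2
        * ‖l - Z.lam (k + 1) ω‖ ^ 2
      + ∑ k ∈ Finset.range K, 4 * m * O.sg' ^ 2 * (a.t k / a.τ k) * ‖l - Z.lam (k + 1) ω‖ ^ 2
      ≤ 0 := by
    rw [← Finset.sum_add_distrib]
    refine Finset.sum_nonpos fun k hk => ?_
    have hc := hcoupled.cond_γ k (Finset.mem_range.1 hk).le
    rw [← add_mul]
    refine mul_nonpos_of_nonpos_of_nonneg ?_ (sq_nonneg _)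
    have e1 : 8 * m * O.sg' ^ 2 * a.t k / a.τ k = 2 * (4 * m * O.sg' ^ 2 * (a.t k / a.τ k)) := by
      ring
    linarith
  simp only [mul_add, Finset.sum_add_distrib] at hgap hsmooth hyb ⊢
  linarith

end Processes
end Path

/-! ### Fresh samples -/

section Fresh

section Product

variable {Ω Ξ : Type*} [MeasurableSpace Ω] [MeasurableSpace Ξ]

variable {T : Type*} [MeasurableSpace T] {P : Measure Ω} [IsProbabilityMeasure P] {ν : Measure Ξ}
  {W : Ω → T} {ξ : Ω → Ξ}

theorem map_prodMk_eq_of_indepFun (hW : Measurable W) (hξ : Measurable ξ) (hind : IndepFun W ξ P)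
    (hlaw : P.map ξ = ν) : P.map (fun ω => (W ω, ξ ω)) = (P.map W).prod ν := by
  rw [← hlaw]
  exact (indepFun_iff_map_prod_eq_prod_map_map hW.aemeasurable hξ.aemeasurable).1 hind

/-- Independence makes the joint law a product, so Tonelli plays the role of conditioning on `W`. -/
theorem lintegral_of_indepFun (hW : Measurable W) (hξ : Measurable ξ) (hind : IndepFun W ξ P)
    (hlaw : P.map ξ = ν) {f : T × Ξ → ENNReal} (hf : Measurable f) :
    ∫⁻ ω, f (W ω, ξ ω) ∂P = ∫⁻ ω, ∫⁻ s, f (W ω, s) ∂ν ∂P := by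
  have : IsProbabilityMeasure ν := hlaw ▸ Measure.isProbabilityMeasure_map hξ.aemeasurable
  rw [← lintegral_map hf (hW.prodMk hξ), map_prodMk_eq_of_indepFun hW hξ hind hlaw,
    lintegral_prod _ hf.aemeasurable, lintegral_map hf.lintegral_prod_right' hW]

theorem integral_of_indepFun (hW : Measurable W) (hξ : Measurable ξ) (hind : IndepFun W ξ P)
    (hlaw : P.map ξ = ν) {f : T × Ξ → ℝ} (hf : Measurable f)
    (hint : Integrable (fun ω => f (W ω, ξ ω)) P) :
    ∫ ω, f (W ω, ξ ω) ∂P = ∫ ω, ∫ s, f (W ω, s) ∂ν ∂P := by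
  have : IsProbabilityMeasure ν := hlaw ▸ Measure.isProbabilityMeasure_map hξ.aemeasurable
  have : IsProbabilityMeasure (P.map W) := Measure.isProbabilityMeasure_map hW.aemeasurable
  have hint' : Integrable f ((P.map W).prod ν) := by
    rw [← map_prodMk_eq_of_indepFun hW hξ hind hlaw,
      integrable_map_measure hf.aestronglyMeasurable (hW.prodMk hξ).aemeasurable]
    exact hint
  rw [← integral_map (hW.prodMk hξ).aemeasurable hf.aestronglyMeasurable,
    map_prodMk_eq_of_indepFun hW hξ hind hlaw, integral_prod _ hint',
    integral_map hW.aemeasurable hf.stronglyMeasurable.integral_prod_right'.aestronglyMeasurable]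

end Product

/-- The sample `ξ` has law `ν` and is independent of the past `F`. -/
structure IsFresh {Ω Ξ : Type*} (F : MeasurableSpace Ω) {m0 : MeasurableSpace Ω}
    [mΞ : MeasurableSpace Ξ] (P : Measure Ω) (ν : Measure Ξ) (ξ : Ω → Ξ) : Prop where
  le : F ≤ m0
  meas : Measurable ξ
  law : P.map ξ = ν
  indep : Indep F (mΞ.comap ξ) P

namespace IsFresh

variable {Ω Ξ : Type*} {F m0 : MeasurableSpace Ω} [mΞ : MeasurableSpace Ξ] {P : Measure Ω}
  {ν : Measure Ξ} {ξ : Ω → Ξ}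

theorem measurable_id (h : IsFresh F P ν ξ) : @Measurable Ω Ω m0 F id := measurable_id'' h.le

/-- The past is encoded as the identity into `Ω` carrying `F`. Any integrand jointly measurable for
`F` and the sample can then be averaged by Fubini, without conditional expectations. -/
theorem indepFun_id (h : IsFresh F P ν ξ) : @IndepFun Ω Ω Ξ m0 F mΞ id ξ P := by
  refine (@IndepFun_iff_Indep _ _ _ m0 F mΞ id ξ P).2 ?_
  rw [MeasurableSpace.comap_id]
  exact h.indep

theorem measurable_comp {E : Type*} [MeasurableSpace E] {g : Ω → Ξ → E} (h : IsFresh F P ν ξ)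
    (hf : @Measurable _ _ (F.prod mΞ) _ (Function.uncurry g)) :
    Measurable fun ω => g ω (ξ ω) := by
  have h1 : @Measurable Ω (Ω × Ξ) m0 (F.prod mΞ) (fun ω => (id ω, ξ ω)) :=
    h.measurable_id.prodMk h.meas
  exact hf.comp h1

variable [IsProbabilityMeasure P]

theorem lintegral_eq (h : IsFresh F P ν ξ) {f : Ω → Ξ → ENNReal}
    (hf : @Measurable _ _ (F.prod mΞ) _ (Function.uncurry f)) :
    ∫⁻ ω, f ω (ξ ω) ∂P = ∫⁻ ω, ∫⁻ s, f ω s ∂ν ∂P :=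
  @lintegral_of_indepFun Ω Ξ m0 mΞ Ω F P _ ν id ξ h.measurable_id h.meas h.indepFun_id h.law
    (Function.uncurry f) hf

theorem integral_eq (h : IsFresh F P ν ξ) {f : Ω → Ξ → ℝ}
    (hf : @Measurable _ _ (F.prod mΞ) _ (Function.uncurry f))
    (hint : Integrable (fun ω => f ω (ξ ω)) P) :
    ∫ ω, f ω (ξ ω) ∂P = ∫ ω, ∫ s, f ω s ∂ν ∂P :=
  @integral_of_indepFun Ω Ξ m0 mΞ Ω F P _ ν id ξ h.measurable_id h.meas h.indepFun_id h.law
    (Function.uncurry f) hf hint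

variable [IsProbabilityMeasure ν] {n : ℕ} {f : Ω → Ξ → Vec n} {fb : Ω → Vec n}

/-- The selected gradients of the problem are not assumed measurable; at adapted points they become
so as means of jointly measurable oracles. -/
theorem measurable_mean (hf : @Measurable _ _ (F.prod mΞ) _ (Function.uncurry f))
    (hmean : ∀ ω, ∫ s, f ω s ∂ν = fb ω) : @Measurable _ _ F _ fb := by
  have e : fb = fun ω => ∫ s, f ω s ∂ν := funext fun ω => (hmean ω).symm
  rw [e]
  exact (@StronglyMeasurable.integral_prod_right Ω Ξ (Vec n) F mΞ ν _ _ _ _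
    hf.stronglyMeasurable).measurable

theorem measurable_centered (hf : @Measurable _ _ (F.prod mΞ) _ (Function.uncurry f))
    (hfb : @Measurable _ _ F _ fb) :
    @Measurable _ _ (F.prod mΞ) _ (Function.uncurry fun ω s => f ω s - fb ω) :=
  hf.sub (hfb.comp measurable_fst)

/-- A conditional second moment bound for the error of one oracle call. -/
theorem memLp_error (h : IsFresh F P ν ξ)
    (hf : @Measurable _ _ (F.prod mΞ) _ (Function.uncurry f))
    (hmean : ∀ ω, ∫ s, f ω s ∂ν = fb ω) {c : Ω → ℝ} (hc : Integrable c P)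
    (hvar : ∀ ω, Integrable (fun s => ‖f ω s - fb ω‖ ^ 2) ν ∧
      ∫ s, ‖f ω s - fb ω‖ ^ 2 ∂ν ≤ c ω) :
    MemLp (fun ω => f ω (ξ ω) - fb ω) 2 P ∧
      ∫ ω, ‖f ω (ξ ω) - fb ω‖ ^ 2 ∂P ≤ ∫ ω, c ω ∂P := by
  have hfb := measurable_mean hf hmean
  have hcen := measurable_centered hf hfb
  have hmeas : Measurable fun ω => f ω (ξ ω) - fb ω := h.measurable_comp hcen
  have hc0 : ∀ ω, 0 ≤ c ω := fun ω =>
    (integral_nonneg fun s => sq_nonneg ‖f ω s - fb ω‖).trans (hvar ω).2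
  -- The bound is proved for the extended integral because integrability is part of the conclusion.
  have hl : ∫⁻ ω, ENNReal.ofReal (‖f ω (ξ ω) - fb ω‖ ^ 2) ∂P ≤ ENNReal.ofReal (∫ ω, c ω ∂P) := by
    have hG : Measurable fun v : Vec n => ENNReal.ofReal (‖v‖ ^ 2) := by fun_prop
    have hm : @Measurable _ _ (F.prod mΞ) _
        (Function.uncurry fun ω s => ENNReal.ofReal (‖f ω s - fb ω‖ ^ 2)) := hG.comp hcen
    rw [h.lintegral_eq (f := fun ω s => ENNReal.ofReal (‖f ω s - fb ω‖ ^ 2)) hm,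
      ofReal_integral_eq_lintegral_ofReal hc (Filter.Eventually.of_forall hc0)]
    refine lintegral_mono fun ω => ?_
    rw [← ofReal_integral_eq_lintegral_ofReal (hvar ω).1
      (Filter.Eventually.of_forall fun s => sq_nonneg _)]
    exact ENNReal.ofReal_le_ofReal (hvar ω).2
  have hint : Integrable (fun ω => ‖f ω (ξ ω) - fb ω‖ ^ 2) P := by
    refine ⟨(hmeas.norm.pow_const 2).aestronglyMeasurable, ?_⟩
    rw [hasFiniteIntegral_iff_ofReal (Filter.Eventually.of_forall fun s => sq_nonneg _)]
    exact hl.trans_lt ENNReal.ofReal_lt_top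
  refine ⟨(memLp_two_iff_integrable_sq_norm hmeas.aestronglyMeasurable).2 hint, ?_⟩
  rw [← ofReal_integral_eq_lintegral_ofReal hint
    (Filter.Eventually.of_forall fun s => sq_nonneg _)] at hl
  exact (ENNReal.ofReal_le_ofReal_iff (integral_nonneg hc0)).1 hl

/-- The error of an oracle call is orthogonal to the past. -/
theorem integral_inner_error (h : IsFresh F P ν ξ)
    (hf : @Measurable _ _ (F.prod mΞ) _ (Function.uncurry f))
    (hmean : ∀ ω, Integrable (f ω) ν ∧ ∫ s, f ω s ∂ν = fb ω) {Y : Ω → Vec n}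
    (hY : @Measurable _ _ F _ Y) (hint : Integrable (fun ω => inner ℝ (f ω (ξ ω) - fb ω) (Y ω)) P) :
    ∫ ω, inner ℝ (f ω (ξ ω) - fb ω) (Y ω) ∂P = 0 := by
  have hcen := measurable_centered hf (measurable_mean hf fun ω => (hmean ω).2)
  have hm : @Measurable _ _ (F.prod mΞ) _
      (Function.uncurry fun ω s => inner ℝ (f ω s - fb ω) (Y ω)) :=
    hcen.inner (hY.comp measurable_fst)
  rw [h.integral_eq (f := fun ω s => inner ℝ (f ω s - fb ω) (Y ω)) hm hint]
  have : ∀ ω, ∫ s, inner ℝ (f ω s - fb ω) (Y ω) ∂ν = 0 := by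
    intro ω
    have h1 : Integrable (fun s => f ω s - fb ω) ν := (hmean ω).1.sub (integrable_const _)
    simp_rw [real_inner_comm (Y ω)]
    rw [integral_inner h1, integral_sub (hmean ω).1 (integrable_const _), (hmean ω).2]
    simp
  simp [this]

end IsFresh
end Fresh

/-! ### Measurability of proximal steps -/

/-- By nonexpansiveness `w'` depends only on `c = w - η⁻¹ • a`, in a 1-Lipschitz way. Thus it is a
Lipschitz function on the range of `c`, which extends to a continuous function on the whole space;
no measurable selection is involved. -/
theorem measurable_of_isProxStep {Ω : Type*} {_ : MeasurableSpace Ω} {n : ℕ} {W : Set (Vec n)}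
    (hW : Convex ℝ W) {η : ℝ} (hη : 0 < η) {a w w' : Ω → Vec n} (ha : Measurable a)
    (hw : Measurable w) (h : ∀ ω, IsProxStep W (a ω) (w ω) η (w' ω)) : Measurable w' := by
  set c : Ω → Vec n := fun ω => w ω - η⁻¹ • a ω with hc
  have hle : ∀ ω₁ ω₂, dist (w' ω₁) (w' ω₂) ≤ dist (c ω₁) (c ω₂) := fun ω₁ ω₂ => by
    rw [dist_eq_norm, dist_eq_norm]
    exact (h ω₁).nonexpansive (h ω₂) hW hη
  have hfac : Function.FactorsThrough w' c := fun ω₁ ω₂ he => by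
    have := hle ω₁ ω₂
    rw [he, dist_self] at this
    exact dist_le_zero.1 this
  set f := Function.extend c w' 0 with hf
  have hfc : ∀ ω, f (c ω) = w' ω := fun ω => hfac.extend_apply 0 ω
  have hlip : LipschitzOnWith 1 f (Set.range c) := by
    refine LipschitzOnWith.of_dist_le_mul ?_
    rintro _ ⟨ω₁, rfl⟩ _ ⟨ω₂, rfl⟩
    rw [hfc, hfc]
    simpa using hle ω₁ ω₂
  obtain ⟨g, hg, hgf⟩ := hlip.extend_finite_dimension
  have e : w' = g ∘ c := funext fun ω => by
    rw [Function.comp_apply, ← hgf ⟨ω, rfl⟩, hfc]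
  rw [e]
  exact hg.continuous.measurable.comp (hw.sub (ha.const_smul η⁻¹))

/-! ### Moments and measurability of the oracles -/

namespace Oracle.IsOracleFor

variable {Ξ : Type*} [MeasurableSpace Ξ] {ν : Measure Ξ} {S : Problem p q m} {O : Oracle p q m Ξ}

theorem integral_sq_le {E : Type*} [NormedAddCommGroup E] {e : Ξ → E} {b : Ξ → ℝ} {c : ℝ}
    (he : AEStronglyMeasurable e ν) (hb : Integrable b ν) (hle : ∀ s, ‖e s‖ ^ 2 ≤ b s)
    (hc : ∫ s, b s ∂ν ≤ c) :
    Integrable (fun s => ‖e s‖ ^ 2) ν ∧ ∫ s, ‖e s‖ ^ 2 ∂ν ≤ c := by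
  have h1 : Integrable (fun s => ‖e s‖ ^ 2) ν :=
    hb.mono' (he.norm.pow 2) (Filter.Eventually.of_forall fun s => by
      simpa using hle s)
  exact ⟨h1, (integral_mono h1 hb hle).trans hc⟩

theorem lin_mean (hO : O.IsOracleFor ν S) (x : Vec p) {x' : Vec p} (hx' : x' ∈ S.X)
    {y : Fin m → Vec q} (hy : ∀ i, y i ∈ S.Y i) :
    Integrable (fun s => O.lin x s x' y) ν ∧ ∫ s, O.lin x s x' y ∂ν = S.lin x x' y := by
  have h1 : ∀ i, Integrable (fun s => inner ℝ (O.gradX i x' (y i) s) (x - x')) ν := fun i =>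
    (hO.gradX_mean i x' hx' _ (hy i)).1.inner_const (x - x')
  have h : ∀ i, Integrable (fun s => O.lin x s x' y i) ν := fun i =>
    (hO.G_mean i x' hx' _ (hy i)).1.add (h1 i)
  refine ⟨Integrable.of_eval_piLp h, ?_⟩
  ext i
  rw [eval_integral_piLp h]
  simp only [Oracle.lin, Problem.lin]
  rw [integral_add (hO.G_mean i x' hx' _ (hy i)).1 (h1 i), (hO.G_mean i x' hx' _ (hy i)).2]
  simp_rw [real_inner_comm (x - x')]
  rw [integral_inner (hO.gradX_mean i x' hx' _ (hy i)).1, (hO.gradX_mean i x' hx' _ (hy i)).2]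

theorem lin_var (hO : O.IsOracleFor ν S) (x : Vec p) {x' : Vec p} (hx' : x' ∈ S.X)
    {y : Fin m → Vec q} (hy : ∀ i, y i ∈ S.Y i) [IsProbabilityMeasure ν] :
    Integrable (fun s => ‖O.lin x s x' y - S.lin x x' y‖ ^ 2) ν ∧
      ∫ s, ‖O.lin x s x' y - S.lin x x' y‖ ^ 2 ∂ν
        ≤ m * (2 * O.sg ^ 2 + 2 * O.sg' ^ 2 * ‖x - x'‖ ^ 2) := by
  have hm : AEStronglyMeasurable (fun s => O.lin x s x' y - S.lin x x' y) ν :=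
    ((hO.lin_mean x hx' hy).1.sub (integrable_const _)).aestronglyMeasurable
  have hi : ∀ i, Integrable (fun s => 2 * ‖O.G i x' (y i) s - S.g i x' (y i)‖ ^ 2
      + 2 * ‖x - x'‖ ^ 2 * ‖O.gradX i x' (y i) s - S.gradx i x' (y i)‖ ^ 2) ν := fun i =>
    ((hO.G_var i x' hx' _ (hy i)).1.const_mul 2).add
      ((hO.gradX_var i x' hx' _ (hy i)).1.const_mul _)
  refine integral_sq_le hm (b := fun s => ∑ i, (2 * ‖O.G i x' (y i) s - S.g i x' (y i)‖ ^ 2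
      + 2 * ‖x - x'‖ ^ 2 * ‖O.gradX i x' (y i) s - S.gradx i x' (y i)‖ ^ 2))
    (integrable_finsetSum _ fun i _ => hi i) (fun s => ?_) ?_
  · rw [norm_sq_eq_sum]
    refine Finset.sum_le_sum fun i _ => ?_
    have h1 := abs_real_inner_le_norm (O.gradX i x' (y i) s - S.gradx i x' (y i)) (x - x')
    have h2 := pow_le_pow_left₀ (abs_nonneg _) h1 2
    rw [sq_abs, mul_pow] at h2
    have e : (O.lin x s x' y - S.lin x x' y) i = (O.G i x' (y i) s - S.g i x' (y i))
        + inner ℝ (O.gradX i x' (y i) s - S.gradx i x' (y i)) (x - x') := by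
      simp only [Oracle.lin, Problem.lin, PiLp.sub_apply, inner_sub_left]; ring
    rw [e, Real.norm_eq_abs, sq_abs]
    nlinarith [sq_nonneg (O.G i x' (y i) s - S.g i x' (y i)
      - inner ℝ (O.gradX i x' (y i) s - S.gradx i x' (y i)) (x - x'))]
  · rw [integral_finsetSum _ fun i _ => hi i]
    calc _ ≤ ∑ _i : Fin m, (2 * O.sg ^ 2 + 2 * O.sg' ^ 2 * ‖x - x'‖ ^ 2) := by
          refine Finset.sum_le_sum fun i _ => ?_
          rw [integral_add ((hO.G_var i x' hx' _ (hy i)).1.const_mul 2)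
            ((hO.gradX_var i x' hx' _ (hy i)).1.const_mul _), integral_const_mul,
            integral_const_mul]
          have h1 := (hO.G_var i x' hx' _ (hy i)).2
          have h2 := mul_le_mul_of_nonneg_left (hO.gradX_var i x' hx' _ (hy i)).2
            (mul_nonneg zero_le_two (sq_nonneg ‖x - x'‖))
          linarith
      _ = _ := by simp; ring

/-- The sampled direction of the `x`-step at the point `(x, l, y)`. -/
def _root_.SIP.Oracle.dir (O : Oracle p q m Ξ) (x : Vec p) (l : Vec m) (y : Fin m → Vec q)
    (s : Ξ) : Vec p := O.gradF x s + ∑ i, l i • O.gradX i x (y i) s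

theorem dir_mean (hO : O.IsOracleFor ν S) {x : Vec p} (hx : x ∈ S.X) (l : Vec m)
    {y : Fin m → Vec q} (hy : ∀ i, y i ∈ S.Y i) :
    Integrable (fun s => O.dir x l y s) ν ∧
      ∫ s, O.dir x l y s ∂ν = S.gradf x + ∑ i, l i • S.gradx i x (y i) := by
  have h1 : ∀ i, Integrable (fun s => l i • O.gradX i x (y i) s) ν := fun i =>
    (hO.gradX_mean i x hx _ (hy i)).1.smul (l i)
  have h2 := integrable_finsetSum Finset.univ fun i (_ : i ∈ Finset.univ) => h1 i
  refine ⟨(hO.gradF_mean x hx).1.add h2, ?_⟩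
  simp only [Oracle.dir]
  rw [integral_add (hO.gradF_mean x hx).1 h2, (hO.gradF_mean x hx).2,
    integral_finsetSum _ fun i _ => h1 i]
  congr 1
  refine Finset.sum_congr rfl fun i _ => ?_
  rw [integral_smul, (hO.gradX_mean i x hx _ (hy i)).2]

/-- Cauchy–Schwarz with weights `l i` bounds the squared weighted sum of errors by `norm1 l` times
the weighted sum of squares. This yields `norm1 l ^ 2` with no factor `m`. -/
theorem dir_var (hO : O.IsOracleFor ν S) {x : Vec p} (hx : x ∈ S.X) {l : Vec m}
    (hl : l ∈ orthant m) {y : Fin m → Vec q} (hy : ∀ i, y i ∈ S.Y i) [IsProbabilityMeasure ν] :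
    Integrable (fun s => ‖O.dir x l y s - (S.gradf x + ∑ i, l i • S.gradx i x (y i))‖ ^ 2) ν ∧
      ∫ s, ‖O.dir x l y s - (S.gradf x + ∑ i, l i • S.gradx i x (y i))‖ ^ 2 ∂ν
        ≤ 2 * O.sf' ^ 2 + 2 * O.sg' ^ 2 * norm1 l ^ 2 := by
  have hm : AEStronglyMeasurable
      (fun s => O.dir x l y s - (S.gradf x + ∑ i, l i • S.gradx i x (y i))) ν :=
    ((hO.dir_mean hx l hy).1.sub (integrable_const _)).aestronglyMeasurable
  have hl1 : norm1 l = ∑ i, l i := Finset.sum_congr rfl fun i _ => abs_of_nonneg (hl i)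
  have hi : ∀ i, Integrable (fun s => l i * ‖O.gradX i x (y i) s - S.gradx i x (y i)‖ ^ 2) ν :=
    fun i => (hO.gradX_var i x hx _ (hy i)).1.const_mul _
  have hsi := integrable_finsetSum Finset.univ fun i (_ : i ∈ Finset.univ) => hi i
  refine integral_sq_le hm (b := fun s => 2 * ‖O.gradF x s - S.gradf x‖ ^ 2
      + 2 * norm1 l * ∑ i, l i * ‖O.gradX i x (y i) s - S.gradx i x (y i)‖ ^ 2)
    (((hO.gradF_var x hx).1.const_mul 2).add (hsi.const_mul _)) (fun s => ?_) ?_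
  · have e : O.dir x l y s - (S.gradf x + ∑ i, l i • S.gradx i x (y i))
        = (O.gradF x s - S.gradf x)
          + ∑ i, l i • (O.gradX i x (y i) s - S.gradx i x (y i)) := by
      simp only [Oracle.dir, smul_sub, Finset.sum_sub_distrib]; abel
    set A := O.gradF x s - S.gradf x
    set B := ∑ i, l i • (O.gradX i x (y i) s - S.gradx i x (y i)) with hB
    have hB1 : ‖B‖ ≤ ∑ i, l i * ‖O.gradX i x (y i) s - S.gradx i x (y i)‖ := by
      refine (norm_sum_le _ _).trans_eq (Finset.sum_congr rfl fun i _ => ?_)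
      rw [norm_smul, Real.norm_eq_abs, abs_of_nonneg (hl i)]
    have hB2 := Finset.sum_sq_le_sum_mul_sum_of_sq_le_mul Finset.univ
      (r := fun i => l i * ‖O.gradX i x (y i) s - S.gradx i x (y i)‖) (f := fun i => l i)
      (g := fun i => l i * ‖O.gradX i x (y i) s - S.gradx i x (y i)‖ ^ 2)
      (fun i _ => hl i) (fun i _ => mul_nonneg (hl i) (sq_nonneg _))
      (fun i _ => (by ring : _ = _).le)
    have hB3 := (pow_le_pow_left₀ (norm_nonneg _) hB1 2).trans hB2
    rw [← hl1] at hB3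
    have h4 : ‖A + B‖ ^ 2 ≤ 2 * ‖A‖ ^ 2 + 2 * ‖B‖ ^ 2 := by
      have := pow_le_pow_left₀ (norm_nonneg _) (norm_add_le A B) 2
      nlinarith [sq_nonneg (‖A‖ - ‖B‖)]
    rw [e]
    linarith
  · rw [integral_add ((hO.gradF_var x hx).1.const_mul 2) (hsi.const_mul _), integral_const_mul,
      integral_const_mul, integral_finsetSum _ fun i _ => hi i]
    have h1 := (hO.gradF_var x hx).2
    have h0 : 0 ≤ norm1 l := Finset.sum_nonneg fun i _ => abs_nonneg _
    have h2 : ∑ i, ∫ s, l i * ‖O.gradX i x (y i) s - S.gradx i x (y i)‖ ^ 2 ∂ν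
        ≤ norm1 l * O.sg' ^ 2 := by
      rw [hl1, Finset.sum_mul]
      refine Finset.sum_le_sum fun i _ => ?_
      rw [integral_const_mul]
      exact mul_le_mul_of_nonneg_left (hO.gradX_var i x hx _ (hy i)).2 (hl i)
    have h3 := mul_le_mul_of_nonneg_left h2 (mul_nonneg zero_le_two h0)
    linarith

section Measurability

variable {Ω : Type*} {F : MeasurableSpace Ω} {x x' : Ω → Vec p} {y : Ω → Fin m → Vec q}
  {l : Ω → Vec m}

theorem measurable_gradY (hO : O.IsOracleFor ν S) (hx : Measurable x) (hy : Measurable y)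
    (i : Fin m) : Measurable (Function.uncurry fun ω s => O.gradY i (x ω) (y ω i) s) :=
  (hO.gradY_meas i).comp ((hx.comp measurable_fst).prodMk
    ((((measurable_pi_apply i).comp hy).comp measurable_fst).prodMk measurable_snd))

theorem measurable_gradX (hO : O.IsOracleFor ν S) (hx : Measurable x) (hy : Measurable y)
    (i : Fin m) : Measurable (Function.uncurry fun ω s => O.gradX i (x ω) (y ω i) s) :=
  (hO.gradX_meas i).comp ((hx.comp measurable_fst).prodMk
    ((((measurable_pi_apply i).comp hy).comp measurable_fst).prodMk measurable_snd))

theorem measurable_G (hO : O.IsOracleFor ν S) (hx : Measurable x) (hy : Measurable y)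
    (i : Fin m) : Measurable (Function.uncurry fun ω s => O.G i (x ω) (y ω i) s) :=
  (hO.G_meas i).comp ((hx.comp measurable_fst).prodMk
    ((((measurable_pi_apply i).comp hy).comp measurable_fst).prodMk measurable_snd))

theorem measurable_lin (hO : O.IsOracleFor ν S) (hx : Measurable x) (hx' : Measurable x')
    (hy : Measurable y) : Measurable (Function.uncurry fun ω s => O.lin (x ω) s (x' ω) (y ω)) := by
  refine (PiLp.continuous_toLp 2 _).measurable.comp (measurable_pi_iff.2 fun i => ?_)
  exact (hO.measurable_G hx' hy i).add
    ((hO.measurable_gradX hx' hy i).inner ((hx.sub hx').comp measurable_fst))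

theorem measurable_dir (hO : O.IsOracleFor ν S) (hx : Measurable x) (hl : Measurable l)
    (hy : Measurable y) : Measurable (Function.uncurry fun ω s => O.dir (x ω) (l ω) (y ω) s) := by
  refine (hO.gradF_meas.comp ((hx.comp measurable_fst).prodMk measurable_snd)).add
    (Finset.measurable_sum _ fun i _ => ?_)
  have hli : Measurable fun ω => l ω i :=
    ((measurable_pi_apply i).comp (PiLp.continuous_ofLp 2 _).measurable).comp hl
  exact (hli.comp measurable_fst).smul (hO.measurable_gradX hx hy i)

end Measurability
end Oracle.IsOracleFor

/-! ### Histories of the sampling process -/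

section History

variable {Ω Ξ : Type*} [mΞ : MeasurableSpace Ξ]

namespace Processes

/-- The indices of the samples drawn before the `j`-th sample of iteration `k`. -/
def before (k : ℕ) (j : Fin 6) : Set (ℕ × Fin 6) := {i | i.1 < k ∨ i.1 = k ∧ i.2 < j}

theorem mem_before {k : ℕ} {j j' : Fin 6} (h : j < j') : (k, j) ∈ before k j' := Or.inr ⟨rfl, h⟩

/-- The `σ`-algebra generated by the samples drawn before the `j`-th sample of iteration `k`. -/
@[reducible] def past (Z : Processes p q m Ω Ξ) (k : ℕ) (j : Fin 6) : MeasurableSpace Ω :=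
  ⨆ i ∈ before k j, mΞ.comap (Z.ξ i.1 i.2)

variable {Z : Processes p q m Ω Ξ}

theorem past_mono {k k' : ℕ} {j j' : Fin 6} (h : before k j ⊆ before k' j') :
    Z.past k j ≤ Z.past k' j' :=
  biSup_mono h

theorem past_le_past {k : ℕ} {j j' : Fin 6} (h : j ≤ j') : Z.past k j ≤ Z.past k j' :=
  past_mono fun i hi => by
    rcases hi with hi | ⟨hi, hj⟩
    · exact Or.inl hi
    · exact Or.inr ⟨hi, hj.trans_le h⟩

theorem past_le_past_succ (k : ℕ) (j j' : Fin 6) : Z.past k j ≤ Z.past (k + 1) j' :=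
  past_mono fun i hi => by
    rcases hi with hi | ⟨hi, hj⟩
    · exact Or.inl (by omega)
    · exact Or.inl (by omega)

theorem measurable_sample {k k' : ℕ} {j j' : Fin 6} (h : (k, j) ∈ before k' j') :
    @Measurable _ _ (Z.past k' j') _ (Z.ξ k j) := by
  rw [measurable_iff_comap_le]
  exact le_biSup (fun i : ℕ × Fin 6 => mΞ.comap (Z.ξ i.1 i.2)) h

/-- The slot `j'` may lie beyond `j`, so all samples of one block are fresh relative to the same
past: slots `0, 1` after `past k 0`, slots `2, 3, 4` after `past k 2`. -/
theorem IsSampled.isFresh {m0 : MeasurableSpace Ω} {P : Measure Ω}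
  {ν : Measure Ξ}
    (hs : Z.IsSampled P ν) (k : ℕ) {j j' : Fin 6} (h : j ≤ j') :
    IsFresh (Z.past k j) P ν (Z.ξ k j') where
  le := iSup₂_le fun i _ => (hs.meas i.1 i.2).comap_le
  meas := hs.meas k j'
  law := hs.law k j'
  indep := by
    have hd : Disjoint (before k j) {(k, j')} := by
      rw [Set.disjoint_singleton_right]
      rintro (h1 | ⟨-, h1⟩)
      · exact lt_irrefl _ h1
      · exact absurd h1 (not_lt.2 h)
    have h1 := indep_iSup_of_disjoint (m := fun i : ℕ × Fin 6 => mΞ.comap (Z.ξ i.1 i.2))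
      (fun i => (hs.meas i.1 i.2).comap_le) hs.indep.iIndep hd
    simpa [past] using h1

end Processes
end History

/-! ### Adaptedness of the iterates. -/

theorem measurable_eval {Ω Ξ E : Type*} [mΞ : MeasurableSpace Ξ] [MeasurableSpace E]
    {F F' : MeasurableSpace Ω} {g : Ω → Ξ → E} {ξ : Ω → Ξ}
    (hg : @Measurable _ _ (F.prod mΞ) _ (Function.uncurry g)) (hle : F ≤ F')
    (hξ : @Measurable _ _ F' _ ξ) : @Measurable _ _ F' _ fun ω => g ω (ξ ω) := by
  have h1 : @Measurable Ω Ω F' F id := measurable_id'' hle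
  exact hg.comp (h1.prodMk hξ)

theorem measurable_blocks {Ω : Type*} {F : MeasurableSpace Ω} {y : Ω → Fin m → Vec q}
    (h : ∀ i, Measurable fun ω => y ω i) : Measurable y :=
  measurable_pi_iff.2 h

namespace Processes

section Adapted

variable {Ω Ξ : Type*} {S : Problem p q m} {O : Oracle p q m Ξ} {a : Params}
  {Z : Processes p q m Ω Ξ} {x0 : Vec p} {y0 : Fin m → Vec q} {l0 : Vec m}

/-- The state of the method at iteration `k` is `F`-measurable. -/
structure IsStateMeasurable (Z : Processes p q m Ω Ξ) (F : MeasurableSpace Ω) (k : ℕ) : Prop where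
  x : @Measurable _ _ F _ (Z.x k)
  y : @Measurable _ _ F _ (Z.y k)
  lam : @Measurable _ _ F _ (Z.lam k)
  yt : @Measurable _ _ F _ (Z.yt k)
  lamt : @Measurable _ _ F _ (Z.lamt k)

theorem IsStateMeasurable.mono {F F' : MeasurableSpace Ω} {k : ℕ}
    (h : Z.IsStateMeasurable F k) (hle : F ≤ F') : Z.IsStateMeasurable F' k :=
  ⟨h.x.mono hle le_rfl, h.y.mono hle le_rfl, h.lam.mono hle le_rfl, h.yt.mono hle le_rfl,
    h.lamt.mono hle le_rfl⟩

theorem measurable_lam_succ (hrun : Z.IsRun S O a x0 y0 l0) (hγ : ∀ k, 0 < a.γ k) {k : ℕ}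
    {F : MeasurableSpace Ω}
    (hlam : @Measurable _ _ F _ (Z.lam k)) (hv : @Measurable _ _ F _ (Z.v O a k)) :
    @Measurable _ _ F _ (Z.lam (k + 1)) :=
  measurable_of_isProxStep (convex_orthant m) (hγ k) hv.neg hlam (fun ω => hrun.lam_step k ω)

variable [MeasurableSpace Ξ] {ν : Measure Ξ} [IsProbabilityMeasure ν]

variable (hO : O.IsOracleFor ν S) (hx0 : x0 ∈ S.X) (hy0 : ∀ i, y0 i ∈ S.Y i)
  (hrun : Z.IsRun S O a x0 y0 l0)

omit [IsProbabilityMeasure ν] in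
include hO in
theorem measurable_u {k : ℕ} (hst : ∀ j ≤ k, Z.IsStateMeasurable (Z.past k 0) j) (i : Fin m) :
    @Measurable _ _ (Z.past k 2) _ (fun ω => Z.u O a k ω i) := by
  have hle : Z.past k 0 ≤ Z.past k 2 := past_le_past (by decide)
  have h1 := measurable_eval (hO.measurable_gradY (hst k le_rfl).x (hst k le_rfl).y i) hle
    (measurable_sample (j := 0) (mem_before (by decide)))
  have h2 := measurable_eval (hO.measurable_gradY (hst (k - 1) (by omega)).x
    (hst (k - 1) (by omega)).y i) hle (measurable_sample (j := 1) (mem_before (by decide)))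
  exact h1.add ((h1.sub h2).const_smul (a.θ k))

include hO hx0 hy0 hrun in
theorem measurable_grady {F : MeasurableSpace Ω} {k : ℕ} (h : Z.IsStateMeasurable F k)
    (i : Fin m) : @Measurable _ _ F _ (fun ω => S.grady i (Z.x k ω) (Z.y k ω i)) :=
  IsFresh.measurable_mean (hO.measurable_gradY h.x h.y i) fun ω =>
    (hO.gradY_mean i _ (hrun.x_mem hx0 k ω) _ (hrun.y_mem hy0 k ω i)).2

include hO hx0 hy0 hrun in
theorem measurable_ubar {k : ℕ} (hst : ∀ j ≤ k, Z.IsStateMeasurable (Z.past k 0) j)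
    (i : Fin m) : @Measurable _ _ (Z.past k 2) _ (fun ω => Z.ubar S a k ω i) := by
  have hle : Z.past k 0 ≤ Z.past k 2 := past_le_past (by decide)
  have h1 := (measurable_grady hO hx0 hy0 hrun (hst k le_rfl) i).mono hle le_rfl
  have h2 := (measurable_grady hO hx0 hy0 hrun (hst (k - 1) (by omega)) i).mono hle le_rfl
  exact h1.add ((h1.sub h2).const_smul (a.θ k))

omit [IsProbabilityMeasure ν] in
include hO hrun in
theorem measurable_y_succ (hconv : S.IsConvex) (hσ : ∀ k, 0 < a.σ k) {k : ℕ}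
    (hst : ∀ j ≤ k, Z.IsStateMeasurable (Z.past k 0) j) :
    @Measurable _ _ (Z.past k 2) _ (Z.y (k + 1)) := by
  have hle : Z.past k 0 ≤ Z.past k 2 := past_le_past (by decide)
  refine measurable_blocks fun i => ?_
  exact measurable_of_isProxStep (hconv.Y_convex i) (hσ k) (measurable_u hO hst i).neg
    ((measurable_pi_apply i).comp ((hst k le_rfl).y.mono hle le_rfl))
    (fun ω => hrun.y_step k ω i)

omit [IsProbabilityMeasure ν] in
include hO in
theorem measurable_v {k : ℕ} (hst : ∀ j ≤ k, Z.IsStateMeasurable (Z.past k 0) j)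
    (hy : @Measurable _ _ (Z.past k 2) _ (Z.y (k + 1))) :
    @Measurable _ _ (Z.past k 5) _ (Z.v O a k) := by
  have hle : Z.past k 0 ≤ Z.past k 2 := past_le_past (by decide)
  have hle5 : Z.past k 2 ≤ Z.past k 5 := past_le_past (by decide)
  have hst2 := fun j hj => (hst j hj).mono hle
  have h1 := measurable_eval (hO.measurable_lin (hst2 k le_rfl).x (hst2 (k - 1) (by omega)).x hy)
    hle5 (measurable_sample (j := 2) (mem_before (by decide)))
  have h2 := measurable_eval (hO.measurable_lin (hst2 k le_rfl).x (hst2 (k - 1) (by omega)).x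
    (hst2 k le_rfl).y) hle5 (measurable_sample (j := 3) (mem_before (by decide)))
  have h3 := measurable_eval (hO.measurable_lin (hst2 (k - 1) (by omega)).x
    (hst2 (k - 2) (by omega)).x (hst2 k le_rfl).y) hle5
    (measurable_sample (j := 4) (mem_before (by decide)))
  exact h1.add ((h2.sub h3).const_smul (a.θ k))

include hO hx0 hy0 hrun in
theorem measurable_vbar {k : ℕ} (hst : ∀ j ≤ k, Z.IsStateMeasurable (Z.past k 0) j)
    (hy : @Measurable _ _ (Z.past k 2) _ (Z.y (k + 1))) :
    @Measurable _ _ (Z.past k 2) _ (Z.vbar S a k) := by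
  have hle : Z.past k 0 ≤ Z.past k 2 := past_le_past (by decide)
  have hst2 := fun j hj => (hst j hj).mono hle
  have h1 := IsFresh.measurable_mean
    (hO.measurable_lin (hst2 k le_rfl).x (hst2 (k - 1) (by omega)).x hy)
    (fun ω => (hO.lin_mean (Z.x k ω) (hrun.x_mem hx0 (k - 1) ω) (hrun.y_mem hy0 (k + 1) ω)).2)
  have h2 := IsFresh.measurable_mean
    (hO.measurable_lin (hst2 k le_rfl).x (hst2 (k - 1) (by omega)).x (hst2 k le_rfl).y)
    (fun ω => (hO.lin_mean (Z.x k ω) (hrun.x_mem hx0 (k - 1) ω) (hrun.y_mem hy0 k ω)).2)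
  have h3 := IsFresh.measurable_mean
    (hO.measurable_lin (hst2 (k - 1) (by omega)).x (hst2 (k - 2) (by omega)).x (hst2 k le_rfl).y)
    (fun ω => (hO.lin_mean (Z.x (k - 1) ω) (hrun.x_mem hx0 (k - 2) ω) (hrun.y_mem hy0 k ω)).2)
  exact h1.add ((h2.sub h3).const_smul (a.θ k))

include hO hx0 hy0 hrun in
/-- The iterates are adapted. -/
theorem isStateMeasurable (hconv : S.IsConvex) (hτ : ∀ k, 0 < a.τ k) (hσ : ∀ k, 0 < a.σ k)
    (hγ : ∀ k, 0 < a.γ k) (haux : Z.IsAux S O a y0 l0) (k : ℕ) :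
    ∀ j ≤ k, Z.IsStateMeasurable (Z.past k 0) j := by
  induction k with
  | zero =>
    intro j hj
    obtain rfl : j = 0 := by omega
    have hx : Z.x 0 = fun _ => x0 := funext hrun.x_zero
    have hy : Z.y 0 = fun _ => y0 := funext hrun.y_zero
    have hl : Z.lam 0 = fun _ => l0 := funext hrun.lam_zero
    have hyt : Z.yt 0 = fun _ => y0 := funext haux.yt_zero
    have hlt : Z.lamt 0 = fun _ => l0 := funext haux.lamt_zero
    constructor
    · rw [hx]; exact measurable_const
    · rw [hy]; exact measurable_const
    · rw [hl]; exact measurable_const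
    · rw [hyt]; exact measurable_const
    · rw [hlt]; exact measurable_const
  | succ k ih =>
    intro j hj
    rcases Nat.lt_or_ge k j with hjk | hjk
    swap
    · exact (ih j hjk).mono (past_le_past_succ k 0 0)
    obtain rfl : j = k + 1 := by omega
    -- Order within an iteration: `y (k + 1)` is known after slots `0, 1`, `lam (k + 1)` after slots
    -- `2, 3, 4`, and `x (k + 1)` after slot `5`.
    have hle2 : Z.past k 0 ≤ Z.past k 2 := past_le_past (by decide)
    have hle5 : Z.past k 2 ≤ Z.past k 5 := past_le_past (by decide)
    have hs2 : Z.past k 2 ≤ Z.past (k + 1) 0 := past_le_past_succ k 2 0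
    have hs5 : Z.past k 5 ≤ Z.past (k + 1) 0 := past_le_past_succ k 5 0
    have hs := (ih k le_rfl).mono (past_le_past_succ k 0 0)
    have hy := measurable_y_succ hO hrun hconv hσ ih
    have hv := measurable_v (a := a) hO ih hy
    have hvb := measurable_vbar hO hx0 hy0 hrun ih hy
    have hlam := measurable_lam_succ hrun hγ ((ih k le_rfl).lam.mono (hle2.trans hle5) le_rfl) hv
    have hd := measurable_eval (hO.measurable_dir ((ih k le_rfl).x.mono (hle2.trans hle5) le_rfl)
      hlam (hy.mono hle5 le_rfl)) hs5 (measurable_sample (j := 5) (Or.inl (Nat.lt_succ_self k)))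
    refine ⟨?_, hy.mono hs2 le_rfl, hlam.mono hs5 le_rfl, ?_, ?_⟩
    · exact measurable_of_isProxStep hconv.X_convex (hτ k) hd hs.x (fun ω => hrun.x_step k ω)
    · refine measurable_blocks fun i => ?_
      exact measurable_of_isProxStep (hconv.Y_convex i) (hσ k)
        (((measurable_u hO ih i).sub (measurable_ubar hO hx0 hy0 hrun ih i)).mono hs2 le_rfl)
        ((measurable_pi_apply i).comp hs.yt) (fun ω => haux.yt_step k ω i)
    · exact measurable_of_isProxStep (convex_orthant m) (hγ k)
        ((hv.mono hs5 le_rfl).sub (hvb.mono hs2 le_rfl)) hs.lamt (fun ω => haux.lamt_step k ω)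

end Adapted
end Processes

/-! ### Square integrability of the iterates -/

theorem norm1_nonneg (l : Vec m) : 0 ≤ norm1 l := Finset.sum_nonneg fun _ _ => abs_nonneg _

theorem norm1_add_le (l l' : Vec m) : norm1 (l + l') ≤ norm1 l + norm1 l' := by
  rw [norm1, norm1, norm1, ← Finset.sum_add_distrib]
  exact Finset.sum_le_sum fun i _ => abs_add_le _ _

theorem norm1_sq_le (l : Vec m) : norm1 l ^ 2 ≤ m * ‖l‖ ^ 2 := by
  rw [norm_sq_eq_sum]
  have := sq_sum_le_card_mul_sum_sq (s := (Finset.univ : Finset (Fin m))) (f := fun i => |l i|)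
  simpa [norm1] using this

theorem measurable_norm1 : Measurable (norm1 : Vec m → ℝ) := by
  unfold norm1
  fun_prop

/-- Along feasible segments the growth of `f` controls the selected subgradients, so an `x`-step
cannot be much longer than the error of its direction. -/
theorem Problem.sq_norm_step_le (S : Problem p q m) (hconv : S.IsConvex) (hreg : S.IsRegular)
    {τ : ℝ} (hτ : 0 < τ) {x0 : Vec p} (hx0 : x0 ∈ S.X) :
    ∃ c : ℝ, 0 ≤ c ∧ ∀ (xk x1 e : Vec p) (l : Vec m) (y : Fin m → Vec q), xk ∈ S.X →
      l ∈ orthant m → (∀ i, y i ∈ S.Y i) →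
      IsProxStep S.X (S.gradf xk + ∑ i, l i • S.gradx i xk (y i) + e) xk τ x1 →
      ‖x1 - xk‖ ^ 2 ≤ c * (‖xk - x0‖ + ‖xk - x0‖ ^ 2)
        + 2 / τ ^ 2 * (S.Mx * norm1 l + ‖e‖ + (S.Hf + ‖S.gradf x0‖)) ^ 2 := by
  have hLf := hreg.Lf_nonneg
  have hHf := hreg.Hf_nonneg
  set G := ‖S.gradf x0‖ with hG
  have hG0 : 0 ≤ G := norm_nonneg _
  -- No bound on `‖gradf xk‖` is available. Its slope along the step is read off from the growth of
  -- `f` at the intermediate point `xk + s • D`; with this `s` the `Lf` term costs at most a quarter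
  -- of the proximal quadratic, even when `Lf` exceeds `τ`.
  set s := min 1 (τ / (2 * (S.Lf + 1))) with hs
  have hs0 : 0 < s := lt_min one_pos (by positivity)
  have hs1 : s ≤ 1 := min_le_left _ _
  have hsL : S.Lf / 2 * s ≤ τ / 4 := by
    have h1 : s ≤ τ / (2 * (S.Lf + 1)) := min_le_right _ _
    rw [le_div_iff₀ (by positivity)] at h1
    nlinarith
  refine ⟨2 / τ * ((2 * G + S.Hf + S.Lf) / s), by positivity, ?_⟩
  intro xk x1 e l y hxk hl hy hstep
  have hvi := hstep.variational hconv.X_convex hxk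
  have hx1 := hstep.1
  set D := x1 - xk with hD
  set n := ‖D‖ with hn
  set r := ‖xk - x0‖ with hr
  have hn0 : 0 ≤ n := norm_nonneg _
  have hr0 : 0 ≤ r := norm_nonneg _
  have hw : xk + s • D ∈ S.X := hconv.X_convex.add_smul_sub_mem hxk hx1 ⟨hs0.le, hs1⟩
  have e1 : xk - x1 = -D := by rw [hD]; abel
  rw [e1, inner_neg_right, inner_add_left, inner_add_left, inner_add_left, inner_smul_left,
    real_inner_self_eq_norm_sq, sum_inner] at hvi
  simp only [conj_trivial, inner_smul_left] at hvi
  have hgx : -∑ i, l i * inner ℝ (S.gradx i xk (y i)) D ≤ S.Mx * norm1 l * n := by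
    rw [← Finset.sum_neg_distrib, norm1, Finset.mul_sum, Finset.sum_mul]
    refine Finset.sum_le_sum fun i _ => ?_
    have h1 := (abs_le.1 (hreg.gradx_bound i x1 hx1 xk hxk _ (hy i))).1
    have h2 := mul_le_mul_of_nonneg_left h1 (hl i)
    rw [abs_of_nonneg (hl i)]
    linarith
  have he : -inner ℝ e D ≤ ‖e‖ * n := by
    rw [← inner_neg_left]; simpa using real_inner_le_norm (-e) D
  have hup := hreg.f_upper _ hw xk hxk
  rw [add_sub_cancel_left, inner_smul_right, norm_smul, Real.norm_eq_abs, abs_of_pos hs0] at hup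
  have hfk := hreg.f_upper xk hxk x0 hx0
  have hfw := hconv.gradf_sub x0 hx0 _ hw
  have hi1 : inner ℝ (S.gradf x0) (xk - x0) ≤ G * r := real_inner_le_norm _ _
  have hi2 : -inner ℝ (S.gradf x0) (xk + s • D - x0) ≤ G * (r + s * n) := by
    rw [← inner_neg_left]
    refine (real_inner_le_norm _ _).trans ?_
    rw [norm_neg]
    refine mul_le_mul_of_nonneg_left ?_ hG0
    have e2 : xk + s • D - x0 = (xk - x0) + s • D := by abel
    rw [e2]
    refine (norm_add_le _ _).trans_eq ?_
    rw [norm_smul, Real.norm_eq_abs, abs_of_pos hs0]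
  have hgf : -inner ℝ (S.gradf xk) D
      ≤ ((2 * G + S.Hf) * r + S.Lf / 2 * r ^ 2) / s + G * n + τ / 4 * n ^ 2 + S.Hf * n := by
    have h3 : s * (-inner ℝ (S.gradf xk) D) ≤ ((2 * G + S.Hf) * r + S.Lf / 2 * r ^ 2)
        + s * (G * n) + s * (S.Lf / 2 * s * n ^ 2) + s * (S.Hf * n) := by nlinarith
    have h4 : s * (S.Lf / 2 * s * n ^ 2) ≤ s * (τ / 4 * n ^ 2) :=
      mul_le_mul_of_nonneg_left (mul_le_mul_of_nonneg_right hsL (sq_nonneg _)) hs0.le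
    have h5 : s * (-inner ℝ (S.gradf xk) D) ≤ s * (((2 * G + S.Hf) * r + S.Lf / 2 * r ^ 2) / s
        + G * n + τ / 4 * n ^ 2 + S.Hf * n) := by
      have e3 : s * (((2 * G + S.Hf) * r + S.Lf / 2 * r ^ 2) / s)
          = (2 * G + S.Hf) * r + S.Lf / 2 * r ^ 2 := by field_simp
      rw [mul_add, mul_add, mul_add, e3]
      linarith
    exact le_of_mul_le_mul_left h5 hs0
  set B := S.Mx * norm1 l + ‖e‖ + (S.Hf + G) with hB
  set A := ((2 * G + S.Hf) * r + S.Lf / 2 * r ^ 2) / s with hA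
  have hmain : 3 / 4 * τ * n ^ 2 ≤ A + B * n := by linarith
  have hBn : B * n ≤ B ^ 2 / τ + τ / 4 * n ^ 2 := by
    have e4 : B ^ 2 / τ + τ / 4 * n ^ 2 - B * n = (B - τ / 2 * n) ^ 2 / τ := by
      field_simp; ring
    have : 0 ≤ (B - τ / 2 * n) ^ 2 / τ := by positivity
    linarith
  have hA' : A ≤ (2 * G + S.Hf + S.Lf) / s * (r + r ^ 2) := by
    rw [hA, div_mul_eq_mul_div (2 * G + S.Hf + S.Lf)]
    refine div_le_div_of_nonneg_right ?_ hs0.le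
    nlinarith [mul_nonneg hLf hr0, mul_nonneg hLf (sq_nonneg r),
      mul_nonneg (by positivity : 0 ≤ 2 * G + S.Hf) (sq_nonneg r)]
  have hfin : n ^ 2 ≤ 2 / τ * A + 2 / τ ^ 2 * B ^ 2 := by
    have h6 : τ / 2 * n ^ 2 ≤ A + B ^ 2 / τ := by linarith
    have h7 := mul_le_mul_of_nonneg_left h6 (by positivity : 0 ≤ 2 / τ)
    have e5 : 2 / τ * (τ / 2 * n ^ 2) = n ^ 2 := by field_simp
    have e6 : 2 / τ * (A + B ^ 2 / τ) = 2 / τ * A + 2 / τ ^ 2 * B ^ 2 := by field_simp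
    rwa [e5, e6] at h7
  have h8 := mul_le_mul_of_nonneg_left hA' (by positivity : 0 ≤ 2 / τ)
  rw [← mul_assoc] at h8
  linarith

/-! ### Calculus of expectations, carrying integrability along. -/

section Expectation

variable {Ω ι : Type*} [MeasurableSpace Ω] {P : Measure Ω} {f g : Ω → ℝ} {c d : ℝ}

/-- `f` is integrable with integral `c`. -/
def HasExpectation (P : Measure Ω) (f : Ω → ℝ) (c : ℝ) : Prop := Integrable f P ∧ ∫ ω, f ω ∂P = c

/-- `f` is integrable with integral at most `c`. -/
def ExpectationLE (P : Measure Ω) (f : Ω → ℝ) (c : ℝ) : Prop := Integrable f P ∧ ∫ ω, f ω ∂P ≤ c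

theorem _root_.MeasureTheory.Integrable.hasExpectation (hf : Integrable f P) :
    HasExpectation P f (∫ ω, f ω ∂P) := ⟨hf, rfl⟩

namespace HasExpectation

theorem le (hf : HasExpectation P f c) : ExpectationLE P f c := ⟨hf.1, hf.2.le⟩

theorem const [IsProbabilityMeasure P] (c : ℝ) : HasExpectation P (fun _ => c) c :=
  ⟨integrable_const c, by simp⟩

theorem add (hf : HasExpectation P f c) (hg : HasExpectation P g d) :
    HasExpectation P (fun ω => f ω + g ω) (c + d) :=
  ⟨hf.1.add hg.1, by rw [integral_add hf.1 hg.1, hf.2, hg.2]⟩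

theorem sub (hf : HasExpectation P f c) (hg : HasExpectation P g d) :
    HasExpectation P (fun ω => f ω - g ω) (c - d) :=
  ⟨hf.1.sub hg.1, by rw [integral_sub hf.1 hg.1, hf.2, hg.2]⟩

theorem const_mul (r : ℝ) (hf : HasExpectation P f c) :
    HasExpectation P (fun ω => r * f ω) (r * c) :=
  ⟨hf.1.const_mul r, by rw [integral_const_mul, hf.2]⟩

theorem sum (s : Finset ι) {F : ι → Ω → ℝ} {C : ι → ℝ}
    (h : ∀ i ∈ s, HasExpectation P (F i) (C i)) :
    HasExpectation P (fun ω => ∑ i ∈ s, F i ω) (∑ i ∈ s, C i) :=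
  ⟨integrable_finsetSum s fun i hi => (h i hi).1, by
    rw [integral_finsetSum s fun i hi => (h i hi).1]
    exact Finset.sum_congr rfl fun i hi => (h i hi).2⟩

end HasExpectation

namespace ExpectationLE

theorem add (hf : ExpectationLE P f c) (hg : ExpectationLE P g d) :
    ExpectationLE P (fun ω => f ω + g ω) (c + d) :=
  ⟨hf.1.add hg.1, by rw [integral_add hf.1 hg.1]; exact add_le_add hf.2 hg.2⟩

theorem sub (hf : ExpectationLE P f c) (hg : HasExpectation P g d) :
    ExpectationLE P (fun ω => f ω - g ω) (c - d) :=
  ⟨hf.1.sub hg.1, by rw [integral_sub hf.1 hg.1, hg.2]; exact sub_le_sub_right hf.2 d⟩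

theorem const_mul {r : ℝ} (hr : 0 ≤ r) (hf : ExpectationLE P f c) :
    ExpectationLE P (fun ω => r * f ω) (r * c) :=
  ⟨hf.1.const_mul r, by rw [integral_const_mul]; exact mul_le_mul_of_nonneg_left hf.2 hr⟩

theorem sum (s : Finset ι) {F : ι → Ω → ℝ} {C : ι → ℝ}
    (h : ∀ i ∈ s, ExpectationLE P (F i) (C i)) :
    ExpectationLE P (fun ω => ∑ i ∈ s, F i ω) (∑ i ∈ s, C i) :=
  ⟨integrable_finsetSum s fun i hi => (h i hi).1, by
    rw [integral_finsetSum s fun i hi => (h i hi).1]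
    exact Finset.sum_le_sum fun i hi => (h i hi).2⟩

theorem mono (hg : ExpectationLE P g c) (hf : Integrable f P) (hle : ∀ᵐ ω ∂P, f ω ≤ g ω) :
    ExpectationLE P f c := ⟨hf, (integral_mono_ae hf hg.1 hle).trans hg.2⟩

end ExpectationLE

end Expectation

/-! ### Square-integrable random vectors. -/

section L2

variable {Ω : Type*} [MeasurableSpace Ω] {P : Measure Ω} {n : ℕ}

theorem integrable_norm_sq_of_memLp {E : Type*} [NormedAddCommGroup E] {f : Ω → E}
    (hf : MemLp f 2 P) : Integrable (fun ω => ‖f ω‖ ^ 2) P :=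
  (memLp_two_iff_integrable_sq_norm hf.1).1 hf

theorem integrable_inner_of_memLp {f g : Ω → Vec n} (hf : MemLp f 2 P) (hg : MemLp g 2 P) :
    Integrable (fun ω => inner ℝ (f ω) (g ω)) P := by
  refine (((integrable_norm_sq_of_memLp hf).add (integrable_norm_sq_of_memLp hg))).mono'
    (hf.1.inner hg.1) (Filter.Eventually.of_forall fun ω => ?_)
  have h1 := abs_real_inner_le_norm (f ω) (g ω)
  rw [Real.norm_eq_abs]
  simp only [Pi.add_apply]
  nlinarith [sq_nonneg (‖f ω‖ - ‖g ω‖), sq_nonneg (‖f ω‖), sq_nonneg (‖g ω‖)]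

theorem memLp_two_of_sq_le {f : Ω → Vec n} (hf : AEStronglyMeasurable f P) {b : Ω → ℝ}
    (hb : Integrable b P) (hle : ∀ ω, ‖f ω‖ ^ 2 ≤ b ω) : MemLp f 2 P :=
  (memLp_two_iff_integrable_sq_norm hf).2 (hb.mono' (hf.norm.pow 2)
    (Filter.Eventually.of_forall fun ω => by simpa using hle ω))

theorem memLp_of_sub {f g : Ω → Vec n} (h : MemLp (fun ω => f ω - g ω) 2 P) (hg : MemLp g 2 P) :
    MemLp f 2 P := by
  have e : f = (fun ω => f ω - g ω) + g := by ext1 ω; simp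
  rw [e]
  exact h.add hg

theorem memLp_of_norm_sub_le {f g : Ω → Vec n} (hf : AEStronglyMeasurable f P)
    (hg : MemLp g 2 P) {b : Ω → ℝ} (hb : MemLp b 2 P) (hle : ∀ ω, ‖f ω - g ω‖ ≤ b ω) :
    MemLp f 2 P := by
  have h1 : MemLp (fun ω => f ω - g ω) 2 P := hb.mono (hf.sub hg.1)
    (Filter.Eventually.of_forall fun ω => (hle ω).trans (le_abs_self _))
  exact memLp_of_sub h1 hg

end L2

/-! ### Oracle errors at adapted points -/

section Errors

variable {Ω Ξ : Type*} {F m0 : MeasurableSpace Ω} [mΞ : MeasurableSpace Ξ] {P : Measure Ω}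
  [IsProbabilityMeasure P] {ν : Measure Ξ} [IsProbabilityMeasure ν] {ξ : Ω → Ξ}
  {S : Problem p q m} {O : Oracle p q m Ξ} {x x' : Ω → Vec p} {y : Ω → Fin m → Vec q}
  {l : Ω → Vec m}

theorem IsFresh.gradY_error (h : IsFresh F P ν ξ) (hO : O.IsOracleFor ν S)
    (hx : @Measurable _ _ F _ x) (hy : @Measurable _ _ F _ y) (hxX : ∀ ω, x ω ∈ S.X)
    (hyY : ∀ ω i, y ω i ∈ S.Y i) (i : Fin m) :
    MemLp (fun ω => O.gradY i (x ω) (y ω i) (ξ ω) - S.grady i (x ω) (y ω i)) 2 P ∧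
      ∫ ω, ‖O.gradY i (x ω) (y ω i) (ξ ω) - S.grady i (x ω) (y ω i)‖ ^ 2 ∂P ≤ O.sg' ^ 2 := by
  have h1 := h.memLp_error (hO.measurable_gradY hx hy i)
    (fun ω => (hO.gradY_mean i _ (hxX ω) _ (hyY ω i)).2) (integrable_const (O.sg' ^ 2))
    (fun ω => hO.gradY_var i _ (hxX ω) _ (hyY ω i))
  simpa using h1

theorem IsFresh.gradY_error_inner (h : IsFresh F P ν ξ) (hO : O.IsOracleFor ν S)
    (hx : @Measurable _ _ F _ x) (hy : @Measurable _ _ F _ y) (hxX : ∀ ω, x ω ∈ S.X)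
    (hyY : ∀ ω i, y ω i ∈ S.Y i) (i : Fin m) {Y : Ω → Vec q} (hY : @Measurable _ _ F _ Y)
    (hY2 : MemLp Y 2 P) :
    ∫ ω, inner ℝ (O.gradY i (x ω) (y ω i) (ξ ω) - S.grady i (x ω) (y ω i)) (Y ω) ∂P = 0 :=
  h.integral_inner_error (hO.measurable_gradY hx hy i)
    (fun ω => hO.gradY_mean i _ (hxX ω) _ (hyY ω i)) hY
    (integrable_inner_of_memLp (h.gradY_error hO hx hy hxX hyY i).1 hY2)

theorem IsFresh.lin_error (h : IsFresh F P ν ξ) (hO : O.IsOracleFor ν S)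
    (hx : @Measurable _ _ F _ x) (hx' : @Measurable _ _ F _ x') (hy : @Measurable _ _ F _ y)
    (hxX : ∀ ω, x' ω ∈ S.X) (hyY : ∀ ω i, y ω i ∈ S.Y i)
    (hD : Integrable (fun ω => ‖x ω - x' ω‖ ^ 2) P) :
    MemLp (fun ω => O.lin (x ω) (ξ ω) (x' ω) (y ω) - S.lin (x ω) (x' ω) (y ω)) 2 P ∧
      ∫ ω, ‖O.lin (x ω) (ξ ω) (x' ω) (y ω) - S.lin (x ω) (x' ω) (y ω)‖ ^ 2 ∂P
        ≤ m * (2 * O.sg ^ 2 + 2 * O.sg' ^ 2 * ∫ ω, ‖x ω - x' ω‖ ^ 2 ∂P) := by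
  have hD' := hD.const_mul (2 * O.sg' ^ 2)
  have h1 := h.memLp_error (hO.measurable_lin hx hx' hy)
    (fun ω => (hO.lin_mean (x ω) (hxX ω) (hyY ω)).2)
    (((integrable_const (2 * O.sg ^ 2)).add hD').const_mul (m : ℝ))
    (fun ω => hO.lin_var (x ω) (hxX ω) (hyY ω))
  refine ⟨h1.1, h1.2.trans_eq ?_⟩
  simp only [Pi.add_apply]
  rw [integral_const_mul, integral_add (integrable_const _) hD',
    integral_const_mul (2 * O.sg' ^ 2) fun ω => ‖x ω - x' ω‖ ^ 2]
  simp

theorem IsFresh.lin_error_inner (h : IsFresh F P ν ξ) (hO : O.IsOracleFor ν S)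
    (hx : @Measurable _ _ F _ x) (hx' : @Measurable _ _ F _ x') (hy : @Measurable _ _ F _ y)
    (hxX : ∀ ω, x' ω ∈ S.X) (hyY : ∀ ω i, y ω i ∈ S.Y i)
    (hD : Integrable (fun ω => ‖x ω - x' ω‖ ^ 2) P) {Y : Ω → Vec m}
    (hY : @Measurable _ _ F _ Y) (hY2 : MemLp Y 2 P) :
    ∫ ω, inner ℝ (O.lin (x ω) (ξ ω) (x' ω) (y ω) - S.lin (x ω) (x' ω) (y ω)) (Y ω) ∂P = 0 :=
  h.integral_inner_error (hO.measurable_lin hx hx' hy)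
    (fun ω => hO.lin_mean (x ω) (hxX ω) (hyY ω)) hY
    (integrable_inner_of_memLp (h.lin_error hO hx hx' hy hxX hyY hD).1 hY2)

theorem IsFresh.dir_error (h : IsFresh F P ν ξ) (hO : O.IsOracleFor ν S)
    (hx : @Measurable _ _ F _ x) (hl : @Measurable _ _ F _ l) (hy : @Measurable _ _ F _ y)
    (hxX : ∀ ω, x ω ∈ S.X) (hlm : ∀ ω, l ω ∈ orthant m) (hyY : ∀ ω i, y ω i ∈ S.Y i)
    (hl2 : Integrable (fun ω => norm1 (l ω) ^ 2) P) :
    MemLp (fun ω => O.dir (x ω) (l ω) (y ω) (ξ ω)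
        - (S.gradf (x ω) + ∑ i, l ω i • S.gradx i (x ω) (y ω i))) 2 P ∧
      ∫ ω, ‖O.dir (x ω) (l ω) (y ω) (ξ ω)
        - (S.gradf (x ω) + ∑ i, l ω i • S.gradx i (x ω) (y ω i))‖ ^ 2 ∂P
        ≤ 2 * O.sf' ^ 2 + 2 * O.sg' ^ 2 * ∫ ω, norm1 (l ω) ^ 2 ∂P := by
  have hl' := hl2.const_mul (2 * O.sg' ^ 2)
  have h1 := h.memLp_error (hO.measurable_dir hx hl hy)
    (fun ω => (hO.dir_mean (hxX ω) (l ω) (hyY ω)).2)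
    ((integrable_const (2 * O.sf' ^ 2)).add hl')
    (fun ω => hO.dir_var (hxX ω) (hlm ω) (hyY ω))
  refine ⟨h1.1, h1.2.trans_eq ?_⟩
  simp only [Pi.add_apply]
  rw [integral_add (integrable_const _) hl',
    integral_const_mul (2 * O.sg' ^ 2) fun ω => norm1 (l ω) ^ 2]
  simp

theorem IsFresh.dir_error_inner (h : IsFresh F P ν ξ) (hO : O.IsOracleFor ν S)
    (hx : @Measurable _ _ F _ x) (hl : @Measurable _ _ F _ l) (hy : @Measurable _ _ F _ y)
    (hxX : ∀ ω, x ω ∈ S.X) (hlm : ∀ ω, l ω ∈ orthant m) (hyY : ∀ ω i, y ω i ∈ S.Y i)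
    (hl2 : Integrable (fun ω => norm1 (l ω) ^ 2) P) {Y : Ω → Vec p}
    (hY : @Measurable _ _ F _ Y) (hY2 : MemLp Y 2 P) :
    ∫ ω, inner ℝ (O.dir (x ω) (l ω) (y ω) (ξ ω)
        - (S.gradf (x ω) + ∑ i, l ω i • S.gradx i (x ω) (y ω i))) (Y ω) ∂P = 0 :=
  h.integral_inner_error (hO.measurable_dir hx hl hy)
    (fun ω => hO.dir_mean (hxX ω) (l ω) (hyY ω)) hY
    (integrable_inner_of_memLp (h.dir_error hO hx hl hy hxX hlm hyY hl2).1 hY2)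

end Errors

theorem memLp_norm1 {Ω : Type*} [MeasurableSpace Ω] {P : Measure Ω}
    {l : Ω → Vec m} (hl : MemLp l 2 P) : MemLp (fun ω => norm1 (l ω)) 2 P := by
  refine (hl.norm.const_mul (Real.sqrt m)).mono
    (measurable_norm1.comp_aemeasurable hl.1.aemeasurable).aestronglyMeasurable
    (Filter.Eventually.of_forall fun ω => ?_)
  rw [Real.norm_eq_abs, Real.norm_eq_abs, abs_of_nonneg (norm1_nonneg _),
    abs_of_nonneg (by positivity)]
  refine abs_le_of_sq_le_sq' ?_ (by positivity) |>.2
  rw [mul_pow, Real.sq_sqrt (Nat.cast_nonneg m)]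
  exact norm1_sq_le _

/-! ### Moments of a stochastic run. -/

namespace Processes

/-- A run of the stochastic method together with its auxiliary sequences, on regular convex data,
with unbiased oracles, positive step parameters and feasible starting points. -/
structure IsStochasticRun {Ω Ξ : Type*} [MeasurableSpace Ω] [MeasurableSpace Ξ]
    (Z : Processes p q m Ω Ξ) (P : Measure Ω) (ν : Measure Ξ) (S : Problem p q m)
    (O : Oracle p q m Ξ) (a : Params) (x0 : Vec p) (y0 : Fin m → Vec q) (l0 : Vec m) : Prop where
  conv : S.IsConvex
  reg : S.IsRegular
  oracle : O.IsOracleFor ν S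
  τ_pos : ∀ k, 0 < a.τ k
  σ_pos : ∀ k, 0 < a.σ k
  γ_pos : ∀ k, 0 < a.γ k
  x0_mem : x0 ∈ S.X
  y0_mem : ∀ i, y0 i ∈ S.Y i
  l0_mem : l0 ∈ orthant m
  sampled : Z.IsSampled P ν
  run : Z.IsRun S O a x0 y0 l0
  aux : Z.IsAux S O a y0 l0

section Errors

variable {Ω Ξ : Type*} {S : Problem p q m} {O : Oracle p q m Ξ} {a : Params}
  {Z : Processes p q m Ω Ξ}

theorem v_sub_vbar (k : ℕ) (ω : Ω) : Z.v O a k ω - Z.vbar S a k ω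
    = (O.lin (Z.x k ω) (Z.ξ k 2 ω) (Z.x (k - 1) ω) (Z.y (k + 1) ω)
        - S.lin (Z.x k ω) (Z.x (k - 1) ω) (Z.y (k + 1) ω))
      + a.θ k • ((O.lin (Z.x k ω) (Z.ξ k 3 ω) (Z.x (k - 1) ω) (Z.y k ω)
          - S.lin (Z.x k ω) (Z.x (k - 1) ω) (Z.y k ω))
        - (O.lin (Z.x (k - 1) ω) (Z.ξ k 4 ω) (Z.x (k - 2) ω) (Z.y k ω)
          - S.lin (Z.x (k - 1) ω) (Z.x (k - 2) ω) (Z.y k ω))) := by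
  simp only [v, vbar, smul_sub]
  abel

end Errors

namespace IsStochasticRun

variable {Ω Ξ : Type*} {m0 : MeasurableSpace Ω} [mΞ : MeasurableSpace Ξ] {P : Measure Ω}
  {ν : Measure Ξ}
  {S : Problem p q m} {O : Oracle p q m Ξ} {a : Params}
  {Z : Processes p q m Ω Ξ} {x0 : Vec p} {y0 : Fin m → Vec q} {l0 : Vec m}
  (h : Z.IsStochasticRun P ν S O a x0 y0 l0)

include h

theorem x_mem (k : ℕ) (ω : Ω) : Z.x k ω ∈ S.X := h.run.x_mem h.x0_mem k ω

theorem y_mem (k : ℕ) (ω : Ω) (i : Fin m) : Z.y k ω i ∈ S.Y i := h.run.y_mem h.y0_mem k ω i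

theorem lam_mem (k : ℕ) (ω : Ω) : Z.lam k ω ∈ orthant m := h.run.lam_mem h.l0_mem k ω

theorem yt_mem (k : ℕ) (ω : Ω) (i : Fin m) : Z.yt k ω i ∈ S.Y i := h.aux.yt_mem h.y0_mem k ω i

theorem lamt_mem (k : ℕ) (ω : Ω) : Z.lamt k ω ∈ orthant m := h.aux.lamt_mem h.l0_mem k ω

theorem past_le (k : ℕ) (j : Fin 6) : Z.past k j ≤ m0 := (h.sampled.isFresh k le_rfl).le

/-- Linearizations grow at most affinely in the two `x`-points, uniformly in `y` because each `Y i`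
is bounded; so they inherit square integrability from the `x`-iterates. -/
theorem abs_lin_le {X X' : Vec p} {Y : Fin m → Vec q} (hX : X ∈ S.X) (hX' : X' ∈ S.X)
    (hY : ∀ i, Y i ∈ S.Y i) (i : Fin m) :
    |S.lin X X' Y i| ≤ |S.g i x0 (y0 i)| + S.My * S.Dy + S.Mx * ‖X' - x0‖ + S.Mx * ‖X - X'‖ := by
  have h1 := h.reg.g_lip i _ hX' x0 h.x0_mem _ (hY i) _ (h.y0_mem i)
  have h2 := h.reg.gradx_bound i _ hX _ hX' _ (hY i)
  have h3 := mul_le_mul_of_nonneg_left (h.conv.Y_diam i _ (hY i) _ (h.y0_mem i))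
    h.reg.My_nonneg
  have e : S.lin X X' Y i = (S.g i X' (Y i) - S.g i x0 (y0 i))
      + S.g i x0 (y0 i) + inner ℝ (S.gradx i X' (Y i)) (X - X') := by
    simp [Problem.lin]
  rw [e]
  have h4 := abs_add_three (S.g i X' (Y i) - S.g i x0 (y0 i)) (S.g i x0 (y0 i))
    (inner ℝ (S.gradx i X' (Y i)) (X - X'))
  linarith

variable [IsProbabilityMeasure ν]

theorem state {j k : ℕ} (hj : j ≤ k) : Z.IsStateMeasurable (Z.past k 0) j :=
  isStateMeasurable h.oracle h.x0_mem h.y0_mem h.run h.conv h.τ_pos h.σ_pos h.γ_pos h.aux k j hj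

theorem state_of_le {j k : ℕ} (hj : j ≤ k) (i : Fin 6) : Z.IsStateMeasurable (Z.past k i) j :=
  (h.state hj).mono (past_le_past (Fin.zero_le i))

theorem measurable_state (k : ℕ) : Z.IsStateMeasurable m0 k :=
  (h.state le_rfl).mono (h.past_le k 0)

theorem y_succ_measurable (k : ℕ) : @Measurable _ _ (Z.past k 2) _ (Z.y (k + 1)) :=
  measurable_y_succ h.oracle h.run h.conv h.σ_pos fun _ hj => h.state hj

theorem lam_succ_measurable (k : ℕ) : @Measurable _ _ (Z.past k 5) _ (Z.lam (k + 1)) :=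
  measurable_lam_succ h.run h.γ_pos (h.state_of_le le_rfl 5).lam
    (measurable_v h.oracle (fun _ hj => h.state hj) (h.y_succ_measurable k))

variable [IsProbabilityMeasure P]

omit [IsProbabilityMeasure ν] in
theorem memLp_lin {X X' : Ω → Vec p} {Y : Ω → Fin m → Vec q} (hX : MemLp X 2 P)
    (hX' : MemLp X' 2 P) (hXm : ∀ ω, X ω ∈ S.X) (hXm' : ∀ ω, X' ω ∈ S.X)
    (hY : ∀ ω i, Y ω i ∈ S.Y i) (hmeas : Measurable fun ω => S.lin (X ω) (X' ω) (Y ω)) :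
    MemLp (fun ω => S.lin (X ω) (X' ω) (Y ω)) 2 P := by
  refine MemLp.of_eval_piLp fun i => ?_
  have hmi : AEStronglyMeasurable (fun ω => S.lin (X ω) (X' ω) (Y ω) i) P :=
    ((EuclideanSpace.proj i).continuous.measurable.comp hmeas).aestronglyMeasurable
  have hb1 : MemLp (fun ω => S.Mx * ‖X' ω - x0‖) 2 P :=
    (hX'.sub (memLp_const x0)).norm.const_mul S.Mx
  have hb2 : MemLp (fun ω => S.Mx * ‖X ω - X' ω‖) 2 P := (hX.sub hX').norm.const_mul S.Mx
  have hb : MemLp (fun ω => (|S.g i x0 (y0 i)| + S.My * S.Dy) + S.Mx * ‖X' ω - x0‖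
      + S.Mx * ‖X ω - X' ω‖) 2 P :=
    ((memLp_const (|S.g i x0 (y0 i)| + S.My * S.Dy)).add hb1).add hb2
  refine hb.mono hmi (Filter.Eventually.of_forall fun ω => ?_)
  rw [Real.norm_eq_abs, Real.norm_eq_abs]
  exact (h.abs_lin_le (hXm ω) (hXm' ω) (hY ω) i).trans (le_abs_self _)

section Dual

variable {k : ℕ} (hx : ∀ j ≤ k, MemLp (Z.x j) 2 P)

include hx

theorem lin_error {i j : ℕ} (hi : i ≤ k) (hj : j ≤ k) {r : Fin 6} (hr : 2 ≤ r)
    {Y : Ω → Fin m → Vec q} (hY : @Measurable _ _ (Z.past k 2) _ Y)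
    (hYm : ∀ ω i, Y ω i ∈ S.Y i) :
    MemLp (fun ω => O.lin (Z.x i ω) (Z.ξ k r ω) (Z.x j ω) (Y ω)
        - S.lin (Z.x i ω) (Z.x j ω) (Y ω)) 2 P ∧
      ∫ ω, ‖O.lin (Z.x i ω) (Z.ξ k r ω) (Z.x j ω) (Y ω)
        - S.lin (Z.x i ω) (Z.x j ω) (Y ω)‖ ^ 2 ∂P
        ≤ m * (2 * O.sg ^ 2 + 2 * O.sg' ^ 2 * ∫ ω, ‖Z.x i ω - Z.x j ω‖ ^ 2 ∂P) :=
  (h.sampled.isFresh k hr).lin_error h.oracle (h.state_of_le hi 2).x (h.state_of_le hj 2).x hY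
    (h.x_mem j) hYm (integrable_norm_sq_of_memLp ((hx i hi).sub (hx j hj)))

theorem lin_error_inner {i j : ℕ} (hi : i ≤ k) (hj : j ≤ k) {r : Fin 6} (hr : 2 ≤ r)
    {Y : Ω → Fin m → Vec q} (hY : @Measurable _ _ (Z.past k 2) _ Y)
    (hYm : ∀ ω i, Y ω i ∈ S.Y i) {U : Ω → Vec m} (hU : @Measurable _ _ (Z.past k 2) _ U)
    (hU2 : MemLp U 2 P) :
    ∫ ω, inner ℝ (O.lin (Z.x i ω) (Z.ξ k r ω) (Z.x j ω) (Y ω)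
        - S.lin (Z.x i ω) (Z.x j ω) (Y ω)) (U ω) ∂P = 0 :=
  (h.sampled.isFresh k hr).lin_error_inner h.oracle (h.state_of_le hi 2).x
    (h.state_of_le hj 2).x hY (h.x_mem j) hYm
    (integrable_norm_sq_of_memLp ((hx i hi).sub (hx j hj))) hU hU2

theorem memLp_v_sub_vbar : MemLp (fun ω => Z.v O a k ω - Z.vbar S a k ω) 2 P := by
  simp_rw [v_sub_vbar]
  have hk1 : k - 1 ≤ k := by omega
  have hk2 : k - 2 ≤ k := by omega
  have hy := (h.state_of_le (le_refl k) 2).y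
  exact (h.lin_error hx le_rfl hk1 le_rfl (h.y_succ_measurable k) (h.y_mem (k + 1))).1.add
    (((h.lin_error hx le_rfl hk1 (by decide) hy (h.y_mem k)).1.sub
      (h.lin_error hx hk1 hk2 (by decide) hy (h.y_mem k)).1).const_smul (a.θ k))

theorem memLp_vbar : MemLp (Z.vbar S a k) 2 P := by
  have hk1 : k - 1 ≤ k := by omega
  have hk2 : k - 2 ≤ k := by omega
  have hst := h.measurable_state
  have key : ∀ {i j : ℕ} (hi : i ≤ k) (hj : j ≤ k) {l : ℕ}, MemLp (fun ω => S.lin (Z.x i ω)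
      (Z.x j ω) (Z.y l ω)) 2 P := fun {i j} hi hj {l} =>
    h.memLp_lin (hx _ hi) (hx _ hj) (h.x_mem _) (h.x_mem _) (h.y_mem l)
      (IsFresh.measurable_mean (h.oracle.measurable_lin (hst i).x (hst j).x (hst l).y)
        fun ω => (h.oracle.lin_mean (Z.x i ω) (h.x_mem j ω) (h.y_mem l ω)).2)
  exact (key le_rfl hk1).add (((key le_rfl hk1).sub (key hk1 hk2)).const_smul (a.θ k))

theorem memLp_lam_succ (hl : MemLp (Z.lam k) 2 P) : MemLp (Z.lam (k + 1)) 2 P := by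
  have hv : MemLp (Z.v O a k) 2 P := memLp_of_sub (h.memLp_v_sub_vbar hx) (h.memLp_vbar hx)
  refine memLp_of_norm_sub_le (h.measurable_state (k + 1)).lam.aestronglyMeasurable hl
    (hv.norm.mul_const (a.γ k)⁻¹) fun ω => ?_
  have h1 := (h.run.lam_step k ω).norm_sub_le (convex_orthant m) (h.lam_mem k ω) (h.γ_pos k)
  rwa [norm_neg, div_eq_mul_inv] at h1

theorem memLp_lamt_succ (hl : MemLp (Z.lamt k) 2 P) : MemLp (Z.lamt (k + 1)) 2 P := by
  refine memLp_of_norm_sub_le (h.measurable_state (k + 1)).lamt.aestronglyMeasurable hl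
    ((h.memLp_v_sub_vbar hx).norm.mul_const (a.γ k)⁻¹) fun ω => ?_
  have h1 := (h.aux.lamt_step k ω).norm_sub_le (convex_orthant m) (h.lamt_mem k ω) (h.γ_pos k)
  rwa [div_eq_mul_inv] at h1

end Dual

/-- Slot `5` is drawn after `past k 5`, which already determines `y (k + 1)` and `lam (k + 1)`;
these may therefore be treated as frozen. -/
theorem d_error {k : ℕ} (hl : MemLp (Z.lam (k + 1)) 2 P) :
    MemLp (fun ω => Z.d O k ω - Z.dbar S k ω) 2 P ∧
      ∫ ω, ‖Z.d O k ω - Z.dbar S k ω‖ ^ 2 ∂P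
        ≤ 2 * O.sf' ^ 2 + 2 * O.sg' ^ 2 * ∫ ω, norm1 (Z.lam (k + 1) ω) ^ 2 ∂P :=
  (h.sampled.isFresh k (le_refl 5)).dir_error h.oracle (h.state_of_le le_rfl 5).x
    (h.lam_succ_measurable k) ((h.y_succ_measurable k).mono (past_le_past (by decide)) le_rfl)
    (h.x_mem k) (h.lam_mem (k + 1)) (h.y_mem (k + 1)) (memLp_norm1 hl).integrable_sq

theorem integral_inner_d {k : ℕ} (hl : MemLp (Z.lam (k + 1)) 2 P) (hx : MemLp (Z.x k) 2 P)
    (x : Vec p) : ∫ ω, inner ℝ (Z.d O k ω - Z.dbar S k ω) (Z.x k ω - x) ∂P = 0 :=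
  (h.sampled.isFresh k (le_refl 5)).dir_error_inner h.oracle (h.state_of_le le_rfl 5).x
    (h.lam_succ_measurable k) ((h.y_succ_measurable k).mono (past_le_past (by decide)) le_rfl)
    (h.x_mem k) (h.lam_mem (k + 1)) (h.y_mem (k + 1)) (memLp_norm1 hl).integrable_sq
    (Y := fun ω => Z.x k ω - x) ((h.state_of_le le_rfl 5).x.sub measurable_const)
    (hx.sub (memLp_const x))

theorem memLp_x_succ {k : ℕ} (hl : MemLp (Z.lam (k + 1)) 2 P) (hx : MemLp (Z.x k) 2 P) :
    MemLp (Z.x (k + 1)) 2 P := by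
  obtain ⟨c, -, hc⟩ := S.sq_norm_step_le h.conv h.reg (h.τ_pos k) h.x0_mem
  have hr : MemLp (fun ω => ‖Z.x k ω - x0‖) 2 P := (hx.sub (memLp_const x0)).norm
  have hb : MemLp (fun ω => S.Mx * norm1 (Z.lam (k + 1) ω) + ‖Z.d O k ω - Z.dbar S k ω‖
      + (S.Hf + ‖S.gradf x0‖)) 2 P :=
    (((memLp_norm1 hl).const_mul S.Mx).add (h.d_error hl).1.norm).add (memLp_const _)
  have hst := h.measurable_state
  have hint := (((hr.integrable (by norm_num)).add hr.integrable_sq).const_mul c).add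
    (hb.integrable_sq.const_mul (2 / a.τ k ^ 2))
  have h1 : MemLp (fun ω => Z.x (k + 1) ω - Z.x k ω) 2 P := by
    refine memLp_two_of_sq_le ((hst (k + 1)).x.sub (hst k).x).aestronglyMeasurable hint fun ω => ?_
    refine hc _ _ (Z.d O k ω - Z.dbar S k ω) (Z.lam (k + 1) ω) (Z.y (k + 1) ω) (h.x_mem k ω)
      (h.lam_mem (k + 1) ω) (h.y_mem (k + 1) ω) ?_
    have e : S.gradf (Z.x k ω) + ∑ i, Z.lam (k + 1) ω i • S.gradx i (Z.x k ω) (Z.y (k + 1) ω i)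
        + (Z.d O k ω - Z.dbar S k ω) = Z.d O k ω := by
      rw [dbar]; abel
    rw [e]
    exact h.run.x_step k ω
  exact memLp_of_sub h1 hx

/-- All earlier indices are carried along because `v` looks two steps back. Within a step `lam (k +
1)` comes before `x (k + 1)`, whose direction it weights; the `y`-iterates live in bounded sets. -/
theorem memLp_state (k : ℕ) : ∀ j ≤ k, MemLp (Z.x j) 2 P ∧ MemLp (Z.lam j) 2 P ∧
    MemLp (Z.lamt j) 2 P := by
  induction k with
  | zero =>
    intro j hj
    obtain rfl : j = 0 := by omega
    have hx : Z.x 0 = fun _ => x0 := funext h.run.x_zero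
    have hl : Z.lam 0 = fun _ => l0 := funext h.run.lam_zero
    have hlt : Z.lamt 0 = fun _ => l0 := funext h.aux.lamt_zero
    rw [hx, hl, hlt]
    exact ⟨memLp_const _, memLp_const _, memLp_const _⟩
  | succ k ih =>
    intro j hj
    rcases Nat.lt_or_ge k j with hjk | hjk
    swap
    · exact ih j hjk
    obtain rfl : j = k + 1 := by omega
    have hx : ∀ j ≤ k, MemLp (Z.x j) 2 P := fun j hj => (ih j hj).1
    have hl := h.memLp_lam_succ hx (ih k le_rfl).2.1
    exact ⟨h.memLp_x_succ hl (hx k le_rfl), hl, h.memLp_lamt_succ hx (ih k le_rfl).2.2⟩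

theorem memLp_x (k : ℕ) : MemLp (Z.x k) 2 P := (h.memLp_state k k le_rfl).1

theorem memLp_lam (k : ℕ) : MemLp (Z.lam k) 2 P := (h.memLp_state k k le_rfl).2.1

theorem memLp_lamt (k : ℕ) : MemLp (Z.lamt k) 2 P := (h.memLp_state k k le_rfl).2.2

end IsStochasticRun
end Processes

/-! ### Variances and orthogonality of the direction errors. -/

theorem sq_norm_add_smul_sub_le {E : Type*} [NormedAddCommGroup E] [NormedSpace ℝ E] (u v : E)
    {θ : ℝ} (h0 : 0 ≤ θ) (h1 : θ ≤ 1) :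
    ‖u + θ • (u - v)‖ ^ 2 ≤ 8 * ‖u‖ ^ 2 + 2 * ‖v‖ ^ 2 := by
  have h2 : ‖u + θ • (u - v)‖ ≤ 2 * ‖u‖ + ‖v‖ := by
    refine (norm_add_le _ _).trans ?_
    rw [norm_smul, Real.norm_eq_abs, abs_of_nonneg h0]
    have := norm_sub_le u v
    have := mul_le_mul h1 this (norm_nonneg _) zero_le_one
    linarith
  have h3 := pow_le_pow_left₀ (norm_nonneg _) h2 2
  nlinarith [sq_nonneg (2 * ‖u‖ - ‖v‖)]

theorem sq_norm_add_smul_sub_le_three {E : Type*} [NormedAddCommGroup E] [NormedSpace ℝ E]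
    (u v w : E) {θ : ℝ} (h0 : 0 ≤ θ) (h1 : θ ≤ 1) :
    ‖u + θ • (v - w)‖ ^ 2 ≤ 3 * (‖u‖ ^ 2 + ‖v‖ ^ 2 + ‖w‖ ^ 2) := by
  have h2 : ‖u + θ • (v - w)‖ ≤ ‖u‖ + ‖v‖ + ‖w‖ := by
    refine (norm_add_le _ _).trans ?_
    rw [norm_smul, Real.norm_eq_abs, abs_of_nonneg h0]
    have := norm_sub_le v w
    have := mul_le_mul h1 this (norm_nonneg _) zero_le_one
    linarith
  have h3 := pow_le_pow_left₀ (norm_nonneg _) h2 2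
  nlinarith [sq_nonneg (‖u‖ - ‖v‖), sq_nonneg (‖u‖ - ‖w‖), sq_nonneg (‖v‖ - ‖w‖)]

namespace Processes

theorem u_sub_ubar {Ω Ξ : Type*} {S : Problem p q m} {O : Oracle p q m Ξ} {a : Params}
    {Z : Processes p q m Ω Ξ} (k : ℕ) (ω : Ω) (i : Fin m) :
    Z.u O a k ω i - Z.ubar S a k ω i
      = (O.gradY i (Z.x k ω) (Z.y k ω i) (Z.ξ k 0 ω) - S.grady i (Z.x k ω) (Z.y k ω i))
        + a.θ k • ((O.gradY i (Z.x k ω) (Z.y k ω i) (Z.ξ k 0 ω)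
            - S.grady i (Z.x k ω) (Z.y k ω i))
          - (O.gradY i (Z.x (k - 1) ω) (Z.y (k - 1) ω i) (Z.ξ k 1 ω)
            - S.grady i (Z.x (k - 1) ω) (Z.y (k - 1) ω i))) := by
  simp only [u, ubar, smul_sub]
  abel

namespace IsStochasticRun

variable {Ω Ξ : Type*} {m0 : MeasurableSpace Ω} [mΞ : MeasurableSpace Ξ] {P : Measure Ω}
  {ν : Measure Ξ} {S : Problem p q m} {O : Oracle p q m Ξ} {a : Params}
  {Z : Processes p q m Ω Ξ} {x0 : Vec p} {y0 : Fin m → Vec q} {l0 : Vec m}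
  [IsProbabilityMeasure ν] [IsProbabilityMeasure P]
  (h : Z.IsStochasticRun P ν S O a x0 y0 l0)

include h

theorem gradY_error {j k : ℕ} (hj : j ≤ k) (r : Fin 6) (i : Fin m) :
    MemLp (fun ω => O.gradY i (Z.x j ω) (Z.y j ω i) (Z.ξ k r ω)
        - S.grady i (Z.x j ω) (Z.y j ω i)) 2 P ∧
      ∫ ω, ‖O.gradY i (Z.x j ω) (Z.y j ω i) (Z.ξ k r ω)
        - S.grady i (Z.x j ω) (Z.y j ω i)‖ ^ 2 ∂P ≤ O.sg' ^ 2 :=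
  (h.sampled.isFresh k (Fin.zero_le r)).gradY_error h.oracle (h.state hj).x (h.state hj).y
    (h.x_mem j) (h.y_mem j) i

theorem memLp_u_sub_ubar (k : ℕ) (i : Fin m) :
    MemLp (fun ω => Z.u O a k ω i - Z.ubar S a k ω i) 2 P := by
  simp_rw [u_sub_ubar]
  have h1 := (h.gradY_error (le_refl k) 0 i).1
  have h2 := (h.gradY_error (Nat.sub_le k 1) 1 i).1
  exact h1.add ((h1.sub h2).const_smul (a.θ k))

/-- The same sample enters twice, so the error is `(1 + θ)` times one oracle error minus `θ` times
another, of norm at most `2 ‖e₁‖ + ‖e₂‖`. Then `10 = 8 + 2`, and the factor `3 / 2` turns it into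
the final `15`. -/
theorem integral_u_sub_ubar_le {k : ℕ} (h0 : 0 ≤ a.θ k) (h1 : a.θ k ≤ 1) (i : Fin m) :
    ∫ ω, ‖Z.u O a k ω i - Z.ubar S a k ω i‖ ^ 2 ∂P ≤ 10 * O.sg' ^ 2 := by
  have e1 := h.gradY_error (le_refl k) 0 i
  have e2 := h.gradY_error (Nat.sub_le k 1) 1 i
  have i1 : ExpectationLE P _ _ := ⟨integrable_norm_sq_of_memLp e1.1, e1.2⟩
  have i2 : ExpectationLE P _ _ := ⟨integrable_norm_sq_of_memLp e2.1, e2.2⟩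
  have hm := ((i1.const_mul (by norm_num : (0 : ℝ) ≤ 8)).add
    (i2.const_mul (by norm_num : (0 : ℝ) ≤ 2))).mono
    (integrable_norm_sq_of_memLp (h.memLp_u_sub_ubar k i)) (Filter.Eventually.of_forall fun ω => by
      rw [u_sub_ubar]
      exact sq_norm_add_smul_sub_le _ _ h0 h1)
  exact hm.2.trans_eq (by ring)

theorem integral_inner_u (k : ℕ) (i : Fin m) {Y : Ω → Vec q}
    (hY : @Measurable _ _ (Z.past k 0) _ Y) (hY2 : MemLp Y 2 P) :
    ∫ ω, inner ℝ (Z.u O a k ω i - Z.ubar S a k ω i) (Y ω) ∂P = 0 := by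
  have hk1 : k - 1 ≤ k := Nat.sub_le k 1
  have i1 := integrable_inner_of_memLp (h.gradY_error (le_refl k) 0 i).1 hY2
  have i2 := integrable_inner_of_memLp (h.gradY_error hk1 1 i).1 hY2
  have z1 := (h.sampled.isFresh k (Fin.zero_le 0)).gradY_error_inner h.oracle
    (h.state (le_refl k)).x (h.state (le_refl k)).y (h.x_mem k) (h.y_mem k) i hY hY2
  have z2 := (h.sampled.isFresh k (Fin.zero_le 1)).gradY_error_inner h.oracle
    (h.state hk1).x (h.state hk1).y (h.x_mem _) (h.y_mem _) i hY hY2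
  have h1 : HasExpectation P _ _ := ⟨i1, z1⟩
  have h2 : HasExpectation P _ _ := ⟨i2, z2⟩
  have e := (h1.add ((h1.sub h2).const_mul (a.θ k))).2
  simp only [sub_self, mul_zero, add_zero] at e
  rw [← e]
  congr 1
  ext1 ω
  rw [u_sub_ubar, inner_add_left, inner_smul_left, inner_sub_left (_ - _) (_ - _)]
  simp

theorem integral_v_sub_vbar_le {k : ℕ} (h0 : 0 ≤ a.θ k) (h1 : a.θ k ≤ 1) :
    ∫ ω, ‖Z.v O a k ω - Z.vbar S a k ω‖ ^ 2 ∂P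
      ≤ m * (18 * O.sg ^ 2 + 12 * O.sg' ^ 2 * ∫ ω, ‖Z.x k ω - Z.x (k - 1) ω‖ ^ 2 ∂P
        + 6 * O.sg' ^ 2 * ∫ ω, ‖Z.x (k - 1) ω - Z.x (k - 2) ω‖ ^ 2 ∂P) := by
  have hx : ∀ j ≤ k, MemLp (Z.x j) 2 P := fun j _ => h.memLp_x j
  have hk1 : k - 1 ≤ k := by omega
  have hk2 : k - 2 ≤ k := by omega
  have hy := (h.state_of_le (le_refl k) 2).y
  have e1 := h.lin_error hx le_rfl hk1 (le_refl 2) (h.y_succ_measurable k) (h.y_mem (k + 1))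
  have e2 := h.lin_error hx le_rfl hk1 (r := 3) (by decide) hy (h.y_mem k)
  have e3 := h.lin_error hx hk1 hk2 (r := 4) (by decide) hy (h.y_mem k)
  have i1 : ExpectationLE P _ _ := ⟨integrable_norm_sq_of_memLp e1.1, e1.2⟩
  have i2 : ExpectationLE P _ _ := ⟨integrable_norm_sq_of_memLp e2.1, e2.2⟩
  have i3 : ExpectationLE P _ _ := ⟨integrable_norm_sq_of_memLp e3.1, e3.2⟩
  have hm := (((i1.add i2).add i3).const_mul (by norm_num : (0 : ℝ) ≤ 3)).mono
    (integrable_norm_sq_of_memLp (h.memLp_v_sub_vbar hx)) (Filter.Eventually.of_forall fun ω => by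
      rw [v_sub_vbar]
      exact sq_norm_add_smul_sub_le_three _ _ _ h0 h1)
  exact hm.2.trans_eq (by ring)

theorem integral_inner_v (k : ℕ) :
    ∫ ω, inner ℝ (Z.v O a k ω - Z.vbar S a k ω) (Z.lam k ω - Z.lamt k ω) ∂P = 0 := by
  have hx : ∀ j ≤ k, MemLp (Z.x j) 2 P := fun j _ => h.memLp_x j
  have hk1 : k - 1 ≤ k := by omega
  have hk2 : k - 2 ≤ k := by omega
  have hst := h.state_of_le (le_refl k) 2
  have hU2 : MemLp (fun ω => Z.lam k ω - Z.lamt k ω) 2 P := (h.memLp_lam k).sub (h.memLp_lamt k)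
  have hU := hst.lam.sub hst.lamt
  have i1 := integrable_inner_of_memLp (h.lin_error hx le_rfl hk1 (le_refl 2)
    (h.y_succ_measurable k) (h.y_mem (k + 1))).1 hU2
  have i2 := integrable_inner_of_memLp (h.lin_error hx le_rfl hk1 (r := 3) (by decide) hst.y
    (h.y_mem k)).1 hU2
  have i3 := integrable_inner_of_memLp (h.lin_error hx hk1 hk2 (r := 4) (by decide) hst.y
    (h.y_mem k)).1 hU2
  have z1 := h.lin_error_inner hx le_rfl hk1 (le_refl 2) (h.y_succ_measurable k)
    (h.y_mem (k + 1)) hU hU2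
  have z2 := h.lin_error_inner hx le_rfl hk1 (r := 3) (by decide) hst.y (h.y_mem k) hU hU2
  have z3 := h.lin_error_inner hx hk1 hk2 (r := 4) (by decide) hst.y (h.y_mem k) hU hU2
  have h1 : HasExpectation P _ _ := ⟨i1, z1⟩
  have h2 : HasExpectation P _ _ := ⟨i2, z2⟩
  have h3 : HasExpectation P _ _ := ⟨i3, z3⟩
  have e := (h1.add ((h2.sub h3).const_mul (a.θ k))).2
  simp only [sub_self, mul_zero, add_zero] at e
  rw [← e]
  congr 1
  ext1 ω
  rw [v_sub_vbar, inner_add_left, inner_smul_left, inner_sub_left (_ - _) (_ - _)]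
  simp

/-! #### The martingale part of the `y`-steps -/

omit [IsProbabilityMeasure P] in
theorem measurable_y_sub_yt (k : ℕ) (i : Fin m) :
    @Measurable _ _ (Z.past k 0) _ fun ω => Z.y k ω i - Z.yt k ω i :=
  ((measurable_pi_apply i).comp (h.state (le_refl k)).y).sub
    ((measurable_pi_apply i).comp (h.state (le_refl k)).yt)

omit [IsProbabilityMeasure P] in
-- A product of square-integrable factors need not be square integrable; here the second is bounded
-- by the diameter of `Y i`.
theorem memLp_smul_y_sub_yt (k : ℕ) (i : Fin m) {N : Ω → ℝ} (hN : MemLp N 2 P) :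
    MemLp (fun ω => N ω • (Z.y k ω i - Z.yt k ω i)) 2 P := by
  have hm := (h.measurable_y_sub_yt k i).mono (h.past_le k 0) le_rfl
  refine (hN.norm.mul_const S.Dy).mono (hN.1.smul hm.aestronglyMeasurable)
    (Filter.Eventually.of_forall fun ω => ?_)
  rw [norm_smul]
  refine le_trans ?_ (le_abs_self _)
  exact mul_le_mul_of_nonneg_left (h.conv.Y_diam i _ (h.y_mem k ω i) _ (h.yt_mem k ω i))
    (norm_nonneg _)

theorem memLp_inner_u (k : ℕ) (i : Fin m) :
    MemLp (fun ω => inner ℝ (Z.u O a k ω i - Z.ubar S a k ω i) (Z.y k ω i - Z.yt k ω i)) 2 P := by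
  have hm := (h.measurable_y_sub_yt k i).mono (h.past_le k 0) le_rfl
  have hu := h.memLp_u_sub_ubar k i
  refine (hu.norm.mul_const S.Dy).mono (hu.1.inner hm.aestronglyMeasurable)
    (Filter.Eventually.of_forall fun ω => ?_)
  refine (abs_real_inner_le_norm _ _).trans (le_trans ?_ (le_abs_self _))
  exact mul_le_mul_of_nonneg_left (h.conv.Y_diam i _ (h.y_mem k ω i) _ (h.yt_mem k ω i))
    (norm_nonneg _)

theorem integral_sq_inner_u_le {k : ℕ} (h0 : 0 ≤ a.θ k) (h1 : a.θ k ≤ 1) (i : Fin m) :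
    ∫ ω, inner ℝ (Z.u O a k ω i - Z.ubar S a k ω i) (Z.y k ω i - Z.yt k ω i) ^ 2 ∂P
      ≤ 10 * O.sg' ^ 2 * S.Dy ^ 2 := by
  have hu := (integrable_norm_sq_of_memLp (h.memLp_u_sub_ubar k i)).const_mul (S.Dy ^ 2)
  refine (integral_mono (h.memLp_inner_u k i).integrable_sq hu fun ω => ?_).trans ?_
  · have h2 := abs_real_inner_le_norm (Z.u O a k ω i - Z.ubar S a k ω i)
      (Z.y k ω i - Z.yt k ω i)
    have h3 := h2.trans (mul_le_mul_of_nonneg_left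
      (h.conv.Y_diam i _ (h.y_mem k ω i) _ (h.yt_mem k ω i)) (norm_nonneg _))
    have h4 := pow_le_pow_left₀ (abs_nonneg _) h3 2
    rw [sq_abs, mul_pow] at h4
    simpa only [mul_comm (S.Dy ^ 2)] using h4
  · rw [integral_const_mul]
    have := mul_le_mul_of_nonneg_left (h.integral_u_sub_ubar_le h0 h1 i) (sq_nonneg S.Dy)
    linarith

omit [IsProbabilityMeasure P] in
theorem martingale_measurable (K : ℕ) (i : Fin m) :
    @Measurable _ _ (Z.past K 0) _ fun ω => ∑ k ∈ Finset.range K, a.t k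
      * inner ℝ (Z.u O a k ω i - Z.ubar S a k ω i) (Z.y k ω i - Z.yt k ω i) := by
  refine Finset.measurable_sum _ fun k hk => ?_
  have hst : ∀ j ≤ k, Z.IsStateMeasurable (Z.past k 0) j := fun _ hj => h.state hj
  have hu := (measurable_u (a := a) h.oracle hst i).sub
    (measurable_ubar h.oracle h.x0_mem h.y0_mem h.run hst i)
  have hle : Z.past k 2 ≤ Z.past K 0 := past_mono fun r hr => by
    have := Finset.mem_range.1 hk
    rcases hr with hr | ⟨hr, -⟩
    · exact Or.inl (by omega)
    · exact Or.inl (by omega)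
  have hy := (h.measurable_y_sub_yt k i).mono (past_le_past (by decide : (0 : Fin 6) ≤ 2)) le_rfl
  exact ((hu.inner hy).const_mul (a.t k)).mono hle le_rfl

theorem memLp_martingale (K : ℕ) (i : Fin m) :
    MemLp (fun ω => ∑ k ∈ Finset.range K, a.t k
      * inner ℝ (Z.u O a k ω i - Z.ubar S a k ω i) (Z.y k ω i - Z.yt k ω i)) 2 P :=
  memLp_finsetSum _ fun k _ => (h.memLp_inner_u k i).const_mul (a.t k)

/-- The increments are orthogonal: the partial sum is known before iteration `K`, hence can be moved
into the vector paired with the new error. -/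
theorem integral_sq_martingale_le (K : ℕ) (h0 : ∀ k < K, 0 ≤ a.θ k) (h1 : ∀ k < K, a.θ k ≤ 1)
    (i : Fin m) :
    ∫ ω, (∑ k ∈ Finset.range K, a.t k
      * inner ℝ (Z.u O a k ω i - Z.ubar S a k ω i) (Z.y k ω i - Z.yt k ω i)) ^ 2 ∂P
      ≤ 10 * O.sg' ^ 2 * S.Dy ^ 2 * ∑ k ∈ Finset.range K, a.t k ^ 2 := by
  induction K with
  | zero => simp
  | succ K ih =>
    have ih' := ih (fun k hk => h0 k (by omega)) (fun k hk => h1 k (by omega))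
    have hN := h.memLp_martingale K i
    have hNm := h.martingale_measurable K i
    have hX := h.memLp_inner_u K i
    have hXle := h.integral_sq_inner_u_le (h0 K (by omega)) (h1 K (by omega)) i
    have hcross := h.integral_inner_u K i (Y := fun ω => (∑ k ∈ Finset.range K, a.t k
      * inner ℝ (Z.u O a k ω i - Z.ubar S a k ω i) (Z.y k ω i - Z.yt k ω i))
        • (Z.y K ω i - Z.yt K ω i)) (hNm.smul (h.measurable_y_sub_yt K i))
      (h.memLp_smul_y_sub_yt K i hN)
    have hcint := integrable_inner_of_memLp (h.memLp_u_sub_ubar K i)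
      (h.memLp_smul_y_sub_yt K i hN)
    simp only [inner_smul_right] at hcross hcint
    set N : Ω → ℝ := fun ω => ∑ k ∈ Finset.range K, a.t k
      * inner ℝ (Z.u O a k ω i - Z.ubar S a k ω i) (Z.y k ω i - Z.yt k ω i) with hNdef
    set X : Ω → ℝ := fun ω => inner ℝ (Z.u O a K ω i - Z.ubar S a K ω i)
      (Z.y K ω i - Z.yt K ω i) with hXdef
    have e : ∀ ω, (∑ k ∈ Finset.range (K + 1), a.t k
        * inner ℝ (Z.u O a k ω i - Z.ubar S a k ω i) (Z.y k ω i - Z.yt k ω i)) ^ 2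
        = N ω ^ 2 + (2 * a.t K * (N ω * X ω) + a.t K ^ 2 * X ω ^ 2) := by
      intro ω
      rw [Finset.sum_range_succ]
      simp only [hNdef, hXdef]
      ring
    have h2 : HasExpectation P (fun ω => N ω * X ω) 0 := ⟨hcint, hcross⟩
    have h3 : ExpectationLE P (fun ω => X ω ^ 2) _ := ⟨hX.integrable_sq, hXle⟩
    have h4 : ExpectationLE P (fun ω => N ω ^ 2) _ := ⟨hN.integrable_sq, ih'⟩
    simp_rw [e]
    refine (h4.add ((h2.const_mul (2 * a.t K)).le.add
      (h3.const_mul (sq_nonneg (a.t K))))).2.trans_eq ?_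
    rw [Finset.sum_range_succ]
    ring

end IsStochasticRun
end Processes

/-- Nothing is known about `f` off `s`; setting it to `0` there changes the composition only on a
null set. -/
theorem aestronglyMeasurable_of_continuousOn {Ω E : Type*} [MeasurableSpace Ω] {P : Measure Ω}
    [TopologicalSpace E] [MeasurableSpace E] [BorelSpace E] {f : E → ℝ} {s : Set E}
    (hf : ContinuousOn f s) (hs : MeasurableSet s) {u : Ω → E} (hu : Measurable u)
    (hmem : ∀ᵐ ω ∂P, u ω ∈ s) : AEStronglyMeasurable (fun ω => f (u ω)) P := by
  classical
  have h1 : Measurable (s.piecewise f 0) := hf.measurable_piecewise continuousOn_const hs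
  refine (h1.comp hu).aestronglyMeasurable.congr ?_
  filter_upwards [hmem] with ω hω
  simp [hω]

/-! ### Random weights bounded in `ℓ₁`. -/

section Bounded

variable {Ω : Type*} [MeasurableSpace Ω] {P : Measure Ω} [IsProbabilityMeasure P]
  {l : Ω → Vec m} {Λ : ℝ}

theorem measurable_coord (hl : Measurable l) (i : Fin m) : Measurable fun ω => l ω i :=
  (EuclideanSpace.proj (𝕜 := ℝ) i).continuous.measurable.comp hl

theorem abs_coord_le_norm1 (v : Vec m) (i : Fin m) : |v i| ≤ norm1 v :=
  Finset.single_le_sum (f := fun j => |v j|) (fun j _ => abs_nonneg (v j)) (Finset.mem_univ i)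

theorem memLp_of_norm1_le (hl : Measurable l) (hΛ : ∀ᵐ ω ∂P, norm1 (l ω) ≤ Λ) :
    MemLp l 2 P :=
  MemLp.of_eval_piLp fun i => MemLp.of_bound (measurable_coord hl i).aestronglyMeasurable Λ
    (hΛ.mono fun ω hω => (abs_coord_le_norm1 (l ω) i).trans hω)

theorem nonneg_of_norm1_le (hΛ : ∀ᵐ ω ∂P, norm1 (l ω) ≤ Λ) : 0 ≤ Λ := by
  obtain ⟨ω, hω⟩ := hΛ.exists
  exact (norm1_nonneg _).trans hω

/-- A bounded random weight may depend on the whole past: the square moments of the summands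
still control the weighted sum. -/
theorem expectationLE_weighted_sum (hl : Measurable l) (hΛ : ∀ᵐ ω ∂P, norm1 (l ω) ≤ Λ)
    {N : Fin m → Ω → ℝ} (hN : ∀ i, MemLp (N i) 2 P) {c : ℝ} (hc : ∀ i, ∫ ω, N i ω ^ 2 ∂P ≤ c) :
    ExpectationLE P (fun ω => ∑ i, l ω i * N i ω) (Λ * Real.sqrt (m * c)) := by
  have hΛ0 := nonneg_of_norm1_le hΛ
  have hl2 := memLp_of_norm1_le hl hΛ
  have hint : Integrable (fun ω => ∑ i, l ω i * N i ω) P :=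
    integrable_finsetSum _ fun i _ => (hl2.eval_piLp i).integrable_mul (hN i)
  have hV : MemLp (fun ω => (WithLp.toLp 2 fun i => N i ω : Vec m)) 2 P :=
    MemLp.of_eval_piLp fun i => hN i
  have hR : MemLp (fun ω => ‖(WithLp.toLp 2 fun i => N i ω : Vec m)‖) 2 P := hV.norm
  have hRsq : ∫ ω, ‖(WithLp.toLp 2 fun i => N i ω : Vec m)‖ ^ 2 ∂P ≤ m * c := by
    have h1 : ∀ i ∈ Finset.univ, ExpectationLE P (fun ω => N i ω ^ 2) c := fun i _ =>
      ⟨(hN i).integrable_sq, hc i⟩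
    have h2 := (ExpectationLE.sum Finset.univ h1).2
    simp only [Finset.sum_const, Finset.card_univ, Fintype.card_fin, nsmul_eq_mul] at h2
    simpa [norm_sq_eq_sum] using h2
  have hRle : ∫ ω, ‖(WithLp.toLp 2 fun i => N i ω : Vec m)‖ ∂P ≤ Real.sqrt (m * c) := by
    refine Real.le_sqrt_of_sq_le (le_trans ?_ hRsq)
    -- Nonnegativity of the variance serves as Jensen's inequality for the square.
    have h1 := variance_nonneg (fun ω => ‖(WithLp.toLp 2 fun i => N i ω : Vec m)‖) P
    rw [variance_eq_sub hR] at h1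
    simpa using h1
  have hle : ExpectationLE P (fun ω => Λ * ‖(WithLp.toLp 2 fun i => N i ω : Vec m)‖)
      (Λ * Real.sqrt (m * c)) :=
    ExpectationLE.const_mul hΛ0 ⟨hR.integrable (by norm_num), hRle⟩
  refine hle.mono hint ?_
  filter_upwards [hΛ] with ω hω
  calc ∑ i, l ω i * N i ω
      ≤ ∑ i, |l ω i| * ‖(WithLp.toLp 2 fun i => N i ω : Vec m)‖ := by
        refine Finset.sum_le_sum fun i _ => (le_abs_self _).trans ?_
        rw [abs_mul]
        exact mul_le_mul_of_nonneg_left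
          (PiLp.norm_apply_le (WithLp.toLp 2 fun i => N i ω : Vec m) i) (abs_nonneg _)
    _ = norm1 (l ω) * ‖(WithLp.toLp 2 fun i => N i ω : Vec m)‖ := by
        rw [norm1, Finset.sum_mul]
    _ ≤ _ := mul_le_mul_of_nonneg_right hω (norm_nonneg _)

end Bounded

/-! ### Integrability of the gap and of the distances. -/

namespace Processes.IsStochasticRun

variable {Ω Ξ : Type*} {m0 : MeasurableSpace Ω} [mΞ : MeasurableSpace Ξ] {P : Measure Ω}
  {ν : Measure Ξ} {S : Problem p q m} {O : Oracle p q m Ξ} {a : Params}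
  {Z : Processes p q m Ω Ξ} {x0 : Vec p} {y0 : Fin m → Vec q} {l0 : Vec m}
  [IsProbabilityMeasure ν] [IsProbabilityMeasure P]
  (h : Z.IsStochasticRun P ν S O a x0 y0 l0)
  {Λ : ℝ} {x : Vec p} {y : Ω → Fin m → Vec q} {l : Ω → Vec m}

include h

/-- Unlike `l`, the iterate `lam (k + 1)` has no a priori bound. Its `ℓ₁` norm is compared with that
of `l`, and the resulting distance is what the reserve of `cond_γ` cancels. -/
theorem expectationLE_d {k : ℕ} (hl_meas : Measurable l) (hΛ : ∀ᵐ ω ∂P, norm1 (l ω) ≤ Λ) :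
    ExpectationLE P (fun ω => ‖Z.d O k ω - Z.dbar S k ω‖ ^ 2)
      (2 * O.sf' ^ 2 + 4 * O.sg' ^ 2 * Λ ^ 2
        + 4 * m * O.sg' ^ 2 * ∫ ω, ‖l ω - Z.lam (k + 1) ω‖ ^ 2 ∂P) := by
  have hlam := h.memLp_lam (k + 1)
  have hd := h.d_error hlam
  have hl2 := memLp_of_norm1_le hl_meas hΛ
  refine ⟨integrable_norm_sq_of_memLp hd.1, hd.2.trans ?_⟩
  have h1 : ExpectationLE P (fun ω => norm1 (Z.lam (k + 1) ω) ^ 2)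
      (2 * Λ ^ 2 + 2 * m * ∫ ω, ‖l ω - Z.lam (k + 1) ω‖ ^ 2 ∂P) := by
    refine ((HasExpectation.const (2 * Λ ^ 2)).le.add
      ((integrable_norm_sq_of_memLp (hl2.sub hlam)).hasExpectation.const_mul (2 * m : ℝ)).le).mono
      (memLp_norm1 hlam).integrable_sq ?_
    filter_upwards [hΛ] with ω hω
    have h2 : norm1 (Z.lam (k + 1) ω) ≤ Λ + norm1 (Z.lam (k + 1) ω - l ω) := by
      have := norm1_add_le (l ω) (Z.lam (k + 1) ω - l ω)
      rw [add_sub_cancel] at this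
      linarith
    have h3 := norm1_sq_le (Z.lam (k + 1) ω - l ω)
    have h4 := pow_le_pow_left₀ (norm1_nonneg _) h2 2
    rw [norm_sub_rev] at h3
    simp only [Pi.sub_apply]
    nlinarith [sq_nonneg (Λ - norm1 (Z.lam (k + 1) ω - l ω))]
  have h5 := mul_le_mul_of_nonneg_left h1.2 (mul_nonneg zero_le_two (sq_nonneg O.sg'))
  linarith

theorem integrable_f (k : ℕ) : Integrable (fun ω => S.f (Z.x k ω)) P := by
  have hm : AEStronglyMeasurable (fun ω => S.f (Z.x k ω)) P :=
    aestronglyMeasurable_of_continuousOn h.conv.f_cont h.conv.X_closed.measurableSet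
      (h.measurable_state k).x (Filter.Eventually.of_forall (h.x_mem k))
  have hr : MemLp (fun ω => ‖Z.x k ω - x0‖) 2 P := ((h.memLp_x k).sub (memLp_const x0)).norm
  have hb := ((integrable_const |S.f x0|).add ((hr.integrable (by norm_num)).const_mul
    (‖S.gradf x0‖ + S.Hf))).add (hr.integrable_sq.const_mul (S.Lf / 2))
  refine hb.mono' hm (Filter.Eventually.of_forall fun ω => ?_)
  have h1 := h.reg.f_upper _ (h.x_mem k ω) x0 h.x0_mem
  have h2 := h.conv.gradf_sub x0 h.x0_mem _ (h.x_mem k ω)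
  have h3 := abs_le.1 (abs_real_inner_le_norm (S.gradf x0) (Z.x k ω - x0))
  have h4 := abs_le.1 (le_refl |S.f x0|)
  have h5 : 0 ≤ S.Lf / 2 * ‖Z.x k ω - x0‖ ^ 2 := by
    have := h.reg.Lf_nonneg; positivity
  have h6 := mul_nonneg h.reg.Hf_nonneg (norm_nonneg (Z.x k ω - x0))
  rw [Real.norm_eq_abs, abs_le]
  simp only [Pi.add_apply]
  constructor <;> linarith

omit [IsProbabilityMeasure ν] in
-- Integrability alone would not suffice, as these values are multiplied by `lam (k + 1)`, known
-- only to be square integrable.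
theorem memLp_g {X : Ω → Vec p} {Y : Ω → Vec q} (i : Fin m) (hXm : Measurable X)
    (hX2 : MemLp X 2 P) (hYm : Measurable Y) (hX : ∀ ω, X ω ∈ S.X)
    (hY : ∀ᵐ ω ∂P, Y ω ∈ S.Y i) : MemLp (fun ω => S.g i (X ω) (Y ω)) 2 P := by
  have hm : AEStronglyMeasurable (fun ω => S.g i (X ω) (Y ω)) P :=
    aestronglyMeasurable_of_continuousOn (h.conv.g_cont i)
      (h.conv.X_closed.measurableSet.prod (h.conv.Y_closed i).measurableSet) (hXm.prodMk hYm)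
      (hY.mono fun ω hω => ⟨hX ω, hω⟩)
  have hb1 : MemLp (fun ω => S.Mx * ‖X ω - x0‖) 2 P :=
    (hX2.sub (memLp_const x0)).norm.const_mul S.Mx
  have hb : MemLp (fun ω => (|S.g i x0 (y0 i)| + S.My * S.Dy) + S.Mx * ‖X ω - x0‖) 2 P :=
    (memLp_const (|S.g i x0 (y0 i)| + S.My * S.Dy)).add hb1
  refine hb.mono hm ?_
  filter_upwards [hY] with ω hω
  refine le_trans ?_ (le_abs_self _)
  have h1 := abs_le.1 (h.reg.g_lip i _ (hX ω) x0 h.x0_mem _ hω _ (h.y0_mem i))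
  have h3 := mul_le_mul_of_nonneg_left (h.conv.Y_diam i _ hω _ (h.y0_mem i)) h.reg.My_nonneg
  have h4 := abs_le.1 (le_refl |S.g i x0 (y0 i)|)
  rw [Real.norm_eq_abs, abs_le]
  constructor <;> linarith

theorem integrable_gap (hx : x ∈ S.X) (hy_meas : Measurable y)
    (hy : ∀ᵐ ω ∂P, ∀ i, y ω i ∈ S.Y i) (hl_meas : Measurable l)
    (hΛ : ∀ᵐ ω ∂P, norm1 (l ω) ≤ Λ) (K : ℕ) :
    Integrable (fun ω => Z.gap S a K x (l ω) (y ω) ω) P := by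
  have hl2 := memLp_of_norm1_le hl_meas hΛ
  refine integrable_finsetSum _ fun k _ => Integrable.const_mul (Integrable.sub ?_ ?_) _
  · refine (h.integrable_f (k + 1)).add (integrable_finsetSum _ fun i _ => ?_)
    exact (hl2.eval_piLp i).integrable_mul (h.memLp_g i (h.measurable_state (k + 1)).x
      (h.memLp_x (k + 1)) ((measurable_pi_apply i).comp hy_meas) (h.x_mem (k + 1))
      (hy.mono fun ω hω => hω i))
  · refine (integrable_const (S.f x)).add (integrable_finsetSum _ fun i _ => ?_)
    exact ((h.memLp_lam (k + 1)).eval_piLp i).integrable_mul (h.memLp_g i measurable_const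
      (memLp_const x) ((measurable_pi_apply i).comp (h.measurable_state (k + 1)).y) (fun _ => hx)
      (Filter.Eventually.of_forall fun ω => h.y_mem (k + 1) ω i))

omit h [IsProbabilityMeasure ν] in
theorem integrable_wsq (hconv : S.IsConvex) {y' : Ω → Fin m → Vec q}
    (hy_meas : Measurable y) (hy : ∀ᵐ ω ∂P, ∀ i, y ω i ∈ S.Y i) (hy'_meas : Measurable y')
    (hy' : ∀ ω i, y' ω i ∈ S.Y i) (hl_meas : Measurable l) (hΛ : ∀ᵐ ω ∂P, norm1 (l ω) ≤ Λ) :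
    Integrable (fun ω => wsq (l ω) (y ω - y' ω)) P := by
  refine integrable_finsetSum _ fun i _ => ?_
  have hm : Measurable fun ω => l ω i * ‖(y ω - y' ω) i‖ ^ 2 :=
    (measurable_coord hl_meas i).mul ((((measurable_pi_apply i).comp hy_meas).sub
      ((measurable_pi_apply i).comp hy'_meas)).norm.pow_const 2)
  refine Integrable.of_bound hm.aestronglyMeasurable (Λ * S.Dy ^ 2) ?_
  filter_upwards [hy, hΛ] with ω h1 h2
  rw [norm_mul, Real.norm_eq_abs, Real.norm_eq_abs, abs_of_nonneg (sq_nonneg ‖_‖)]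
  have h3 : ‖(y ω - y' ω) i‖ ≤ S.Dy := hconv.Y_diam i _ (h1 i) _ (hy' ω i)
  exact mul_le_mul ((abs_coord_le_norm1 _ i).trans h2) (pow_le_pow_left₀ (norm_nonneg _) h3 2)
    (sq_nonneg _) ((norm1_nonneg _).trans h2)

end Processes.IsStochasticRun

/-! ### Expected size of the error sums. -/

namespace Processes.IsStochasticRun

variable {Ω Ξ : Type*} {m0 : MeasurableSpace Ω} [mΞ : MeasurableSpace Ξ] {P : Measure Ω}
  {ν : Measure Ξ} {S : Problem p q m} {O : Oracle p q m Ξ} {a : Params}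
  {Z : Processes p q m Ω Ξ} {x0 : Vec p} {y0 : Fin m → Vec q} {l0 : Vec m}
  [IsProbabilityMeasure ν] [IsProbabilityMeasure P]
  (h : Z.IsStochasticRun P ν S O a x0 y0 l0) {K : ℕ} (ha : a.IsAdmissible K)
  {Λ : ℝ} {l : Ω → Vec m}

include h

theorem integrable_sq_sub_lamt (hl_meas : Measurable l) (hΛ : ∀ᵐ ω ∂P, norm1 (l ω) ≤ Λ)
    (k : ℕ) : Integrable (fun ω => ‖l ω - Z.lamt k ω‖ ^ 2) P :=
  integrable_norm_sq_of_memLp ((memLp_of_norm1_le hl_meas hΛ).sub (h.memLp_lamt k))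

theorem integrable_sq_sub_lam (hl_meas : Measurable l) (hΛ : ∀ᵐ ω ∂P, norm1 (l ω) ≤ Λ)
    (k : ℕ) : Integrable (fun ω => ‖l ω - Z.lam k ω‖ ^ 2) P :=
  integrable_norm_sq_of_memLp ((memLp_of_norm1_le hl_meas hΛ).sub (h.memLp_lam k))

theorem integrable_sq_x_sub (j k : ℕ) : Integrable (fun ω => ‖Z.x j ω - Z.x k ω‖ ^ 2) P :=
  integrable_norm_sq_of_memLp ((h.memLp_x j).sub (h.memLp_x k))

include ha

theorem expectationLE_martingale (hl_meas : Measurable l) (hΛ : ∀ᵐ ω ∂P, norm1 (l ω) ≤ Λ) :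
    ExpectationLE P (fun ω => ∑ i, l ω i * ∑ k ∈ Finset.range K, a.t k
        * inner ℝ (Z.u O a k ω i - Z.ubar S a k ω i) (Z.y k ω i - Z.yt k ω i))
      (Λ * Real.sqrt (10 * m * O.sg' ^ 2 * S.Dy ^ 2 * ∑ k ∈ Finset.range K, a.t k ^ 2)) := by
  have h1 := expectationLE_weighted_sum hl_meas hΛ (h.memLp_martingale K)
    (h.integral_sq_martingale_le K (fun k _ => ha.θ_nonneg k) ha.θ_le_one)
  convert h1 using 3
  ring

theorem expectationLE_sum_u (hΛ0 : 0 ≤ Λ) :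
    ExpectationLE P (fun ω => Λ * ∑ k ∈ Finset.range K, 3 / 2 * (a.t k / a.σ k)
        * ∑ i, ‖Z.u O a k ω i - Z.ubar S a k ω i‖ ^ 2)
      (15 * m * Λ * O.sg' ^ 2 * ∑ k ∈ Finset.range K, a.t k / a.σ k) := by
  have h1 : ExpectationLE P (fun ω => Λ * ∑ k ∈ Finset.range K, 3 / 2 * (a.t k / a.σ k)
        * ∑ i, ‖Z.u O a k ω i - Z.ubar S a k ω i‖ ^ 2)
      (Λ * ∑ k ∈ Finset.range K, 3 / 2 * (a.t k / a.σ k) * ∑ _i : Fin m, 10 * O.sg' ^ 2) := by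
    refine .const_mul hΛ0 (.sum _ fun k hk => .const_mul ?_ (.sum _ fun i _ => ⟨?_, ?_⟩))
    · have := ha.t_nonneg k; have := ha.σ_pos k; positivity
    · exact integrable_norm_sq_of_memLp (h.memLp_u_sub_ubar k i)
    · exact h.integral_u_sub_ubar_le (ha.θ_nonneg k) (ha.θ_le_one k (Finset.mem_range.1 hk)) i
  convert h1 using 1
  simp only [Finset.sum_const, Finset.card_univ, Fintype.card_fin, nsmul_eq_mul, Finset.mul_sum]
  exact Finset.sum_congr rfl fun k _ => by ring

/-- The variance at iteration `k` involves the increments of index `k` and `k - 1`. Shifting the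
sums by one and by two matches them with the reserve from `cond_x`; the exact constants `27` and `9`
are rounded up to `30` and `12`. -/
theorem expectationLE_sum_v :
    ExpectationLE P (fun ω => ∑ k ∈ Finset.range K, 3 / 2 * (a.t k / a.γ k)
        * ‖Z.v O a k ω - Z.vbar S a k ω‖ ^ 2)
      (30 * m * O.sg ^ 2 * ∑ k ∈ Finset.range K, a.t k / a.γ k
        + ∑ k ∈ Finset.range K, (18 * m * O.sg' ^ 2 * (a.t (k + 1) / a.γ (k + 1))
            + 12 * m * O.sg' ^ 2 * (a.t (k + 2) / a.γ (k + 2)))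
            * ∫ ω, ‖Z.x (k + 1) ω - Z.x k ω‖ ^ 2 ∂P) := by
  have hc : ∀ k, 0 ≤ a.t k / a.γ k := fun k => div_nonneg (ha.t_nonneg k) (ha.γ_pos k).le
  set D : ℕ → ℝ := fun k => ∫ ω, ‖Z.x k ω - Z.x (k - 1) ω‖ ^ 2 ∂P with hD
  have hD0 : D 0 = 0 := by simp [hD]
  have hDn : ∀ k, 0 ≤ D k := fun k => integral_nonneg fun ω => sq_nonneg _
  have h1 : ExpectationLE P (fun ω => ∑ k ∈ Finset.range K, 3 / 2 * (a.t k / a.γ k)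
        * ‖Z.v O a k ω - Z.vbar S a k ω‖ ^ 2)
      (∑ k ∈ Finset.range K, 3 / 2 * (a.t k / a.γ k)
        * (m * (18 * O.sg ^ 2 + 12 * O.sg' ^ 2 * D k + 6 * O.sg' ^ 2 * D (k - 1)))) := by
    refine .sum _ fun k hk => .const_mul (mul_nonneg (by norm_num) (hc k)) ⟨?_, ?_⟩
    · exact integrable_norm_sq_of_memLp (h.memLp_v_sub_vbar fun j _ => h.memLp_x j)
    · exact h.integral_v_sub_vbar_le (ha.θ_nonneg k) (ha.θ_le_one k (Finset.mem_range.1 hk))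
  refine ⟨h1.1, h1.2.trans ?_⟩
  have s1 := sum_range_le_shift (fun k => a.t k / a.γ k * D k) (by simp [hD0])
    (fun k => mul_nonneg (hc k) (hDn k)) K
  have s2 := sum_range_le_shift (fun k => a.t k / a.γ k * D (k - 1)) (by simp [hD0])
    (fun k => mul_nonneg (hc k) (hDn _)) K
  have s3 := sum_range_le_shift (fun k => a.t (k + 1) / a.γ (k + 1) * D k) (by simp [hD0])
    (fun k => mul_nonneg (hc _) (hDn _)) K
  have n1 : 0 ≤ ∑ k ∈ Finset.range K, a.t k / a.γ k := Finset.sum_nonneg fun k _ => hc k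
  have n2 : 0 ≤ ∑ k ∈ Finset.range K, a.t (k + 1 + 1) / a.γ (k + 1 + 1) * D (k + 1) :=
    Finset.sum_nonneg fun k _ => mul_nonneg (hc _) (hDn _)
  have e1 : ∑ k ∈ Finset.range K, 3 / 2 * (a.t k / a.γ k)
        * (m * (18 * O.sg ^ 2 + 12 * O.sg' ^ 2 * D k + 6 * O.sg' ^ 2 * D (k - 1)))
      = 27 * m * O.sg ^ 2 * ∑ k ∈ Finset.range K, a.t k / a.γ k
        + 18 * m * O.sg' ^ 2 * ∑ k ∈ Finset.range K, a.t k / a.γ k * D k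
        + 9 * m * O.sg' ^ 2 * ∑ k ∈ Finset.range K, a.t k / a.γ k * D (k - 1) := by
    simp only [Finset.mul_sum, ← Finset.sum_add_distrib]
    exact Finset.sum_congr rfl fun k _ => by ring
  have e2 : ∑ k ∈ Finset.range K, (18 * m * O.sg' ^ 2 * (a.t (k + 1) / a.γ (k + 1))
            + 12 * m * O.sg' ^ 2 * (a.t (k + 2) / a.γ (k + 2)))
            * ∫ ω, ‖Z.x (k + 1) ω - Z.x k ω‖ ^ 2 ∂P
      = 18 * m * O.sg' ^ 2 * ∑ k ∈ Finset.range K, a.t (k + 1) / a.γ (k + 1) * D (k + 1)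
        + 12 * m * O.sg' ^ 2
          * ∑ k ∈ Finset.range K, a.t (k + 1 + 1) / a.γ (k + 1 + 1) * D (k + 1) := by
    simp only [Finset.mul_sum, ← Finset.sum_add_distrib]
    exact Finset.sum_congr rfl fun k _ => by simp only [hD, Nat.add_sub_cancel]; ring
  rw [e1, e2]
  simp only [Nat.add_sub_cancel] at s2
  have b1 := mul_le_mul_of_nonneg_left s1 (by positivity : 0 ≤ 18 * m * O.sg' ^ 2)
  have b2 := mul_le_mul_of_nonneg_left (s2.trans s3) (by positivity : 0 ≤ 9 * m * O.sg' ^ 2)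
  have b3 := mul_nonneg (by positivity : 0 ≤ 3 * m * O.sg' ^ 2) n2
  have b4 := mul_nonneg (by positivity : 0 ≤ 3 * m * O.sg ^ 2) n1
  linarith

theorem expectationLE_sum_d (hl_meas : Measurable l) (hΛ : ∀ᵐ ω ∂P, norm1 (l ω) ≤ Λ) :
    ExpectationLE P (fun ω => ∑ k ∈ Finset.range K, a.t k / a.τ k
        * ‖Z.d O k ω - Z.dbar S k ω‖ ^ 2)
      ((2 * O.sf' ^ 2 + 4 * O.sg' ^ 2 * Λ ^ 2) * ∑ k ∈ Finset.range K, a.t k / a.τ k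
        + ∑ k ∈ Finset.range K, 4 * m * O.sg' ^ 2 * (a.t k / a.τ k)
            * ∫ ω, ‖l ω - Z.lam (k + 1) ω‖ ^ 2 ∂P) := by
  have h1 := ExpectationLE.sum (P := P) (Finset.range K) fun k _ =>
    (h.expectationLE_d (k := k) hl_meas hΛ).const_mul
      (div_nonneg (ha.t_nonneg k) (ha.τ_pos k).le)
  convert h1 using 1
  simp only [Finset.mul_sum, ← Finset.sum_add_distrib]
  exact Finset.sum_congr rfl fun k _ => by ring

omit ha

theorem hasExpectation_inner_v (c : ℕ → ℝ) :
    HasExpectation P (fun ω => ∑ k ∈ Finset.range K, c k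
      * inner ℝ (Z.v O a k ω - Z.vbar S a k ω) (Z.lam k ω - Z.lamt k ω)) 0 := by
  have h1 := HasExpectation.sum (P := P) (Finset.range K) fun k _ =>
    HasExpectation.const_mul (c k) ⟨integrable_inner_of_memLp
      (h.memLp_v_sub_vbar (k := k) fun j _ => h.memLp_x j)
      ((h.memLp_lam k).sub (h.memLp_lamt k)), h.integral_inner_v k⟩
  simpa using h1

theorem hasExpectation_inner_d (c : ℕ → ℝ) (x : Vec p) :
    HasExpectation P (fun ω => ∑ k ∈ Finset.range K, c k
      * inner ℝ (Z.d O k ω - Z.dbar S k ω) (Z.x k ω - x)) 0 := by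
  have h1 := HasExpectation.sum (P := P) (Finset.range K) fun k _ =>
    HasExpectation.const_mul (c k) ⟨integrable_inner_of_memLp
      (h.d_error (h.memLp_lam (k + 1))).1 ((h.memLp_x k).sub (memLp_const x)),
      h.integral_inner_d (h.memLp_lam (k + 1)) (h.memLp_x k) x⟩
  simpa using h1

end Processes.IsStochasticRun

end SIP

end

/-! ### Assembly of the bound in expectation. -/

open SIP in
theorem proposition1 {p q m : ℕ} {Ω Ξ : Type*} [MeasurableSpace Ω] [MeasurableSpace Ξ]
    (P : Measure Ω) [IsProbabilityMeasure P] (ν : Measure Ξ) [IsProbabilityMeasure ν]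
    (S : Problem p q m) (hconv : S.IsConvex) (hreg : S.IsRegular)
    (O : Oracle p q m Ξ) (hO : O.IsOracleFor ν S)
    (a : Params) (K : ℕ) (hK : 1 ≤ K) (ha : a.IsAdmissible K) (hcoupled : a.IsCoupled S O K)
    (x0 : Vec p) (y0 : Fin m → Vec q) (l0 : Vec m)
    (hx0 : x0 ∈ S.X) (hy0 : ∀ i, y0 i ∈ S.Y i) (hl0 : l0 ∈ orthant m)
    (Z : Processes p q m Ω Ξ) (hsample : Z.IsSampled P ν)
    (hrun : Z.IsRun S O a x0 y0 l0) (haux : Z.IsAux S O a y0 l0)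
    (Λ : ℝ) (x : Vec p) (hx : x ∈ S.X)
    (y : Ω → Fin m → Vec q) (hy_meas : Measurable y) (hy : ∀ᵐ ω ∂P, ∀ i, y ω i ∈ S.Y i)
    (l : Ω → Vec m) (hl_meas : Measurable l) (hl : ∀ᵐ ω ∂P, l ω ∈ orthant m)
    (hΛ : ∀ᵐ ω ∂P, norm1 (l ω) ≤ Λ) :
    Integrable (fun ω => Z.gap S a K x (l ω) (y ω) ω) P ∧
    (∀ k < K, Integrable (fun ω => ‖Z.x (k + 1) ω - Z.x k ω‖ ^ 2) P) ∧
    (∀ k ≤ K, Integrable (fun ω => ‖l ω - Z.lamt k ω‖ ^ 2) P) ∧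
    (∀ k ≤ K, Integrable (fun ω => wsq (l ω) (y ω - Z.yt k ω)) P) ∧
    ∫ ω, Z.gap S a K x (l ω) (y ω) ω ∂P ≤
      (a.t 0 * a.τ 0 - a.t 0 * S.μf) / 2 * ‖x - x0‖ ^ 2
      + a.t 0 * a.γ 0 * ∫ ω, ‖l ω - l0‖ ^ 2 ∂P
      + a.t 0 * a.σ 0 * ∫ ω, wsq (l ω) (y ω - y0) ∂P
      + Z.residual S a P Λ K
      + ∑ k ∈ Finset.range K, (a.t (k + 1) * a.γ (k + 1) - a.t k * a.γ k) / 2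
          * ∫ ω, ‖l ω - Z.lamt (k + 1) ω‖ ^ 2 ∂P
      + ∑ k ∈ Finset.range K, (a.t (k + 1) * a.σ (k + 1) - a.t k * a.σ k) / 2
          * ∫ ω, wsq (l ω) (y ω - Z.yt (k + 1) ω) ∂P
      - a.t K * a.γ K / 2 * ∫ ω, ‖l ω - Z.lamt K ω‖ ^ 2 ∂P
      - a.t K * a.σ K / 2 * ∫ ω, wsq (l ω) (y ω - Z.yt K ω) ∂P
      + 4 * (S.Hx ^ 2 * Λ ^ 2 + S.Hf ^ 2) * ∑ k ∈ Finset.range K, a.t k / a.τ k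
      + 7 * S.Hy ^ 2 * Λ * ∑ k ∈ Finset.range (K + 1), a.t k * a.θ k ^ 2 / a.σ k
      + Λ * Real.sqrt (10 * m * O.sg' ^ 2 * S.Dy ^ 2 * ∑ k ∈ Finset.range K, a.t k ^ 2)
      + (2 * O.sf' ^ 2 + 4 * O.sg' ^ 2 * Λ ^ 2) * ∑ k ∈ Finset.range K, a.t k / a.τ k
      + 15 * m * Λ * O.sg' ^ 2 * ∑ k ∈ Finset.range K, a.t k / a.σ k
      + 30 * m * O.sg ^ 2 * ∑ k ∈ Finset.range K, a.t k / a.γ k := by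
  have h : Z.IsStochasticRun P ν S O a x0 y0 l0 := ⟨hconv, hreg, hO, ha.τ_pos, ha.σ_pos, ha.γ_pos,
    hx0, hy0, hl0, hsample, hrun, haux⟩
  have hgap := h.integrable_gap hx hy_meas hy hl_meas hΛ K
  have hX := fun k => h.integrable_sq_x_sub (k + 1) k
  have hL := h.integrable_sq_sub_lamt hl_meas hΛ
  have hW := fun k => Processes.IsStochasticRun.integrable_wsq hconv hy_meas hy
    (h.measurable_state k).yt (h.yt_mem k) hl_meas hΛ
  have hW0 := Processes.IsStochasticRun.integrable_wsq hconv hy_meas hy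
    (measurable_const (a := y0)) (fun _ => hy0) hl_meas hΛ
  have hL0 : Integrable (fun ω => ‖l ω - l0‖ ^ 2) P :=
    integrable_norm_sq_of_memLp ((memLp_of_norm1_le hl_meas hΛ).sub (memLp_const l0))
  refine ⟨hgap, fun k _ => hX k, fun k _ => hL k, fun k _ => hW k, ?_⟩
  -- The chain reproduces the right side of `gap_le` in its order of summation, so the pathwise
  -- bound applies by monotonicity. Terms of signed coefficient keep exact expectations; only the
  -- martingale and squared-error sums are estimated.
  have key := (HasExpectation.const (P := P) ((a.t 0 * a.τ 0 - a.t 0 * S.μf) / 2 * ‖x - x0‖ ^ 2)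
    |>.add (hL0.hasExpectation.const_mul (a.t 0 * a.γ 0))
    |>.add (hW0.hasExpectation.const_mul (a.t 0 * a.σ 0))
    |>.add (.sum (Finset.range K) fun k _ => (hX k).hasExpectation.const_mul
      (7 * a.t (k + 1) * (a.θ (k + 1) * S.Lyx) ^ 2 * Λ / a.σ (k + 1)
        + a.t k * S.Lxx * Λ / 2 - a.t k * a.τ k / 16))
    |>.add (.sum (Finset.range K) fun k _ => (hL (k + 1)).hasExpectation.const_mul
      ((a.t (k + 1) * a.γ (k + 1) - a.t k * a.γ k) / 2))
    |>.add (.sum (Finset.range K) fun k _ => (hW (k + 1)).hasExpectation.const_mul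
      ((a.t (k + 1) * a.σ (k + 1) - a.t k * a.σ k) / 2))
    |>.sub ((hL K).hasExpectation.const_mul (a.t K * a.γ K / 2))
    |>.sub ((hW K).hasExpectation.const_mul (a.t K * a.σ K / 2))
    |>.add (.const (4 * (S.Hx ^ 2 * Λ ^ 2 + S.Hf ^ 2) * ∑ k ∈ Finset.range K, a.t k / a.τ k))
    |>.add (.const (7 * S.Hy ^ 2 * Λ * ∑ k ∈ Finset.range (K + 1), a.t k * a.θ k ^ 2 / a.σ k))
    |>.le
    |>.add (h.expectationLE_martingale ha hl_meas hΛ)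
    |>.add (h.expectationLE_sum_u ha (nonneg_of_norm1_le hΛ))
    |>.add (h.hasExpectation_inner_v (K := K) a.t).le
    |>.add (h.expectationLE_sum_v ha)
    |>.sub (h.hasExpectation_inner_d (K := K) a.t x)
    |>.add (h.expectationLE_sum_d ha hl_meas hΛ)
    |>.sub (.sum (Finset.range K) fun k _ =>
      (h.integrable_sq_sub_lam hl_meas hΛ (k + 1)).hasExpectation.const_mul
        (4 * m * O.sg' ^ 2 * (a.t k / a.τ k)))
    |>.sub (.sum (Finset.range K) fun k _ => (hX k).hasExpectation.const_mul
      (18 * m * O.sg' ^ 2 * (a.t (k + 1) / a.γ (k + 1))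
        + 12 * m * O.sg' ^ 2 * (a.t (k + 2) / a.γ (k + 2))))).mono hgap (by
      filter_upwards [hy, hl, hΛ] with ω h1 h2 h3
      exact Processes.gap_le hconv hreg hK ha hcoupled hx0 hy0 hl0 hrun haux ω hx h1 h2 h3)
  refine key.2.trans ?_
  rw [Processes.residual]
  -- The two reserves cancel the run-dependent parts of the `d` and `v` variances.
  linarith
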